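/- **Setting.** Consider $N$ players with finite-dimensional normed action spaces $\mathcal V_i$, and write $x=(x_i)_i$ for action profiles, $u_i$ for the payoff functions, and $v(x)=(\nabla_{x_i}u_i(x))_i\in\prod_i\mathcal V_i^*$ for the profile of individual payoff gradients. Actions lie in nonempty closed convex sets $\mathcal X_i\subseteq\mathcal V_i$, $\mathcal X=\prod_i\mathcal X_i$, and each $u_i$ is differentiable on $\mathcal X$ (relative to $\mathcal X$, with a fixed choice of gradient $\nabla u_i$ if $\mathcal X$ has empty interior), with $u_i$ and $\nabla u_i$ Lipschitz continuous on $\mathcal X$. Let $Q=(Q_i)_i$, $Q_i(y_i)=\arg\max_{x_i\in\mathcal X_i}\{\langle y_i,x_i\rangle-h_i(x_i)\}$, be the mirror map of regularizers $h_i$ that are continuous and strongly convex on $\mathcal X_i$ (and $+\infty$ outside). The *unconstrained case* is $\mathcal X_i=\mathbb R^{d_i}$ with $Q=\mathrm{id}$ (dual and primal vectors identified, $Y_n=X_n$). In a *finite game* with nonempty finite sets $\mathcal A_i$ of pure strategies, $\mathcal X_i=\Delta(\mathcal A_i)$, $u_i$ is the mixed payoff, $v_i(x)=(u_i(\alpha_i;x_{-i}))_{\alpha_i\in\mathcal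 A_i}$, and $Q=\Lambda$ is the logit map $\Lambda_{i}(y)=\big(e^{y_{i\alpha}}/\sum_{\beta}e^{y_{i\beta}}\big)_{\alpha\in\mathcal A_i}$. The mean dynamics are $$\dot y=v(Q(y)).\tag{MD}$$ Let $\gamma_n=\gamma/n^p$ ($n\ge1$, $\gamma>0$, $p\in[0,1]$), $\tau_n=\sum_{k=1}^n\gamma_k$, and let $\bar Y(t)=Y_n+\frac{t-\tau_n}{\tau_{n+1}-\tau_n}(Y_{n+1}-Y_n)$ for $t\in[\tau_n,\tau_{n+1}]$. The sequence $Y_n$ (equivalently, by convention, $X_n=Q(Y_n)$) is an *asymptotic pseudotrajectory* (APT) of (MD) if (MD) has a global flow $\Phi$ and $$\lim_{t\to\infty}\ \sup_{0\le s\le T}\|\bar Y(t+s)-\Phi_s(\bar Y(t))\|=0\qquad\text{for all }T>0 .$$ **Randomness.** Everything lives on a probability space with a filtration $(\mathcal F_n)$; the initial data are $\mathcal F_1$-measurable, and the seeds and random draws of stage $n$ are $\mathcal F_{n+1}$-measurable. An oracle returns $V(x;\omega)=v(x)+U(x;\omega)$, with $U$ jointly measurable. Fix $q\in[2,\infty]$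 and $\sigma\ge0$; at every oracle query made at stage $n\ge1$, with query point $Z$ and seed $\omega$, the error is in $L^q$ and satisfies $\mathbb E[U(Z;\omega)\mid\mathcal F_n]=0$ and $\mathbb E[\|U(Z;\omega)\|^q\mid\mathcal F_n]\le\sigma^q$ (if $q=\infty$: $\|U(Z;\omega)\|\le\sigma$ almost surely). For sequential gradient ascent this is required of the component $U_i$ at the point queried by player $i$. For optimistic gradient it is required of the query $(X_{n+1/2};\omega_n)$ of each stage $n\ge1$, while $X_{1/2}$ and $\omega_0$ are arbitrary $\mathcal F_1$-measurable initial data. **Algorithms** ($n\ge1$). * SGA (unconstrained): $X_{n+1}=X_n+\gamma_nV(X_n;\omega_n)$. * seqGA (unconstrained): $X_{i,n+1}=X_{i,n}+\gamma_nV_i(X_{1,n+1},\dots,X_{i-1,n+1},X_{i,n},\dots,X_{N,n};\omega_n)$. * EG (unconstrained): $X_{n+1/2}=X_n+\gamma_nV(X_n;\omega_n)$, $X_{n+1}=X_n+\gamma_nV(X_{n+1/2};\omega_{n+1/2})$. * OG (unconstrained): $X_{n+1/2}=X_n+\gamma_nV(X_{n-1/2};\omega_{n-1})$, $X_{n+1}=X_n+\gamma_nV(X_{n+1/2};\omega_n)$.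 * MP (general $\mathcal X$, $Q$): $Y_{n+1/2}=Y_n+\gamma_nV(X_n;\omega_n)$, $Y_{n+1}=Y_n+\gamma_nV(X_{n+1/2};\omega_{n+1/2})$, with $X_k=Q(Y_k)$ throughout. * EW (finite game): $Y_{n+1}=Y_n+\gamma_n\hat v_n$, $X_n=\Lambda(Y_n)$, where either $\hat v_n=v(X_n)$ (full information) or $\hat v_{n}=(u_i(\alpha;\alpha_{-i,n}))_{i,\alpha}$ (realization-based), the pure strategies $\alpha_{i,n}$ being drawn given $\mathcal F_n$ from $X_{i,n}$, independently across players. * SPSA (unconstrained, bounded $u_i$): $X_{i,n+1}=X_{i,n}+\gamma_n\frac{d_i}{\delta_n}u_i(X_n+\delta_nW_n)W_{i,n}$, where, given $\mathcal F_n$, the $W_{i,n}$ are independent across players and uniform on $\{\pm e_1,\dots,\pm e_{d_i}\}$; $\delta_n=\delta/n^r$ with $\delta>0$, $r\in(0,1/2)$. * EXP3 (finite game): $Y_{i\alpha,n+1}=Y_{i\alpha,n}+\gamma_n\frac{\mathbf 1\{\hat\alpha_{i,n}=\alpha\}}{\hat X_{i\alpha,n}}u_i(\hat\alpha_n)$,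 $X_n=\Lambda(Y_n)$, $\hat X_{i,n}=(1-\delta_n)X_{i,n}+\delta_n\,\mathrm{unif}(\mathcal A_i)$, the $\hat\alpha_{i,n}$ being drawn given $\mathcal F_n$ from $\hat X_{i,n}$, independently across players; $\delta_n=\delta/n^r$ with $\delta\in(0,1]$, $r\in(0,1/2)$. **Corollary.** With probability $1$, the sequence generated by each algorithm is an APT of the corresponding mean dynamics (MD) provided that: * for SGA, seqGA, EG, OG and MP: $p>2/(2+q)$ (that is, $p>0$ if $q=\infty$); * for EW: $p>0$; * for SPSA and EXP3: $p>2r>0$. In particular, the mean dynamics of OG are the same gradient dynamics $\dot x=v(x)$ as those of SGA. -/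

import Mathlib

open MeasureTheory ProbabilityTheory Filter Topology
open scoped ENNReal

noncomputable section

namespace LearningInGames

/-! ### Step-sizes, mean dynamics and asymptotic pseudotrajectories.
All sequences start at index `1`; their value at index `0` plays no role unless noted. -/

/-- The schedule `c / n ^ a`, `n = 1, 2, …`, of a step-size or of a sampling parameter. -/
def schedule (c a : ℝ) (n : ℕ) : ℝ := c / (n : ℝ) ^ a

/-- The effective time `τ n = γ 1 + … + γ n`. -/
def effTime (γ : ℕ → ℝ) (n : ℕ) : ℝ := ∑ k ∈ Finset.Icc 1 n, γ k

/-- The last index `n` with `τ n ≤ t`. -/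
def lastIndex (γ : ℕ → ℝ) (t : ℝ) : ℕ := sSup {n : ℕ | effTime γ n ≤ t}

/-- The affine interpolation of the sequence `Y`, which takes the value `Y n` at time `τ n` and is
affine on each `[τ n, τ (n + 1)]`, `n = 1, 2, …` -/
def interpolation {D : Type*} [NormedAddCommGroup D] [NormedSpace ℝ D]
    (γ : ℕ → ℝ) (Y : ℕ → D) (t : ℝ) : D :=
  Y (lastIndex γ t) +
    ((t - effTime γ (lastIndex γ t)) /
      (effTime γ (lastIndex γ t + 1) - effTime γ (lastIndex γ t))) •
        (Y (lastIndex γ t + 1) - Y (lastIndex γ t))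

/-- `Φ` is the flow of the autonomous differential equation `ẏ = F y`: for every `y`, the curve
`t ↦ Φ t y` is the orbit defined for all times that starts at `y`. -/
structure IsFlow {D : Type*} [NormedAddCommGroup D] [NormedSpace ℝ D]
    (F : D → D) (Φ : ℝ → D → D) : Prop where
  initial : ∀ y, Φ 0 y = y
  orbit : ∀ y t, HasDerivAt (fun s => Φ s y) (F (Φ t y)) t

/-- The sequence `Y`, run with step-sizes `γ`, is an asymptotic pseudotrajectory of `ẏ = F y`. -/
def IsAPT {D : Type*} [NormedAddCommGroup D] [NormedSpace ℝ D]
    (F : D → D) (γ : ℕ → ℝ) (Y : ℕ → D) : Prop :=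
  ∃ Φ : ℝ → D → D, IsFlow F Φ ∧ ∀ T : ℝ, 0 < T →
    Tendsto (fun t : ℝ => ⨆ s ∈ Set.Icc (0 : ℝ) T,
      edist (interpolation γ Y (t + s)) (Φ s (interpolation γ Y t))) atTop (𝓝 0)

/-! ### Stochastic first-order oracles -/

/-- The error `U` of an oracle query has zero mean conditionally on the history `G`, and it is
bounded in `L^q` by `σ` conditionally on `G`; for `q = ∞` it is bounded by `σ` almost surely. -/
structure OracleError {Ω D : Type*} [m : MeasurableSpace Ω] [NormedAddCommGroup D]
    [NormedSpace ℝ D] [CompleteSpace D] (μ : Measure Ω) (G : MeasurableSpace Ω)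
    (q : ℝ≥0∞) (σ : ℝ) (U : Ω → D) : Prop where
  memLp : MemLp U q μ
  unbiased : μ[U | G] =ᵐ[μ] 0
  moment : q ≠ ∞ → μ[fun ω => ‖U ω‖ ^ q.toReal | G] ≤ᵐ[μ] fun _ => σ ^ q.toReal
  bounded : q = ∞ → ∀ᵐ ω ∂μ, ‖U ω‖ ≤ σ

/-- The oracle output at `x` with seed `s`, for the field `v` and the error function `err`. -/
def oracle {P D S : Type*} [Add D] (v : P → D) (err : P → S → D) (x : P) (s : S) : D :=
  v x + err x s

/-! ### Unconstrained games, in which player `i` chooses an action in `ℝ ^ (d i)` -/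

section Unconstrained

variable {N : ℕ} {d : Fin N → ℕ} {Ω S : Type*} [m : MeasurableSpace Ω] [MeasurableSpace S]

/-- Action profiles of an unconstrained game. -/
abbrev Profile {N : ℕ} (d : Fin N → ℕ) : Type := ∀ i, EuclideanSpace ℝ (Fin (d i))

/-- The payoff functions `u i` are differentiable, Lipschitz continuous and Lipschitz smooth. -/
structure IsSmoothGame (u : Fin N → Profile d → ℝ) : Prop where
  differentiable : ∀ i, Differentiable ℝ (u i)
  lipschitz : ∀ i, ∃ G, LipschitzWith G (u i)
  smooth : ∀ i, ∃ L, LipschitzWith L (fderiv ℝ (u i))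

/-- The profile of individual payoff gradients `v i x = ∇_{x i} (u i) (x i; x (-i))`. -/
def payoffGradient (u : Fin N → Profile d → ℝ) (x : Profile d) : Profile d :=
  fun i => gradient (fun z => u i (Function.update x i z)) (x i)

/-- Stochastic gradient ascent. -/
structure IsSGA (μ : Measure Ω) (ℱ : Filtration ℕ m) (u : Fin N → Profile d → ℝ)
    (err : Profile d → S → Profile d) (q : ℝ≥0∞) (σ : ℝ) (γ : ℕ → ℝ)
    (seed : ℕ → Ω → S) (X : ℕ → Ω → Profile d) : Prop where
  init : Measurable[ℱ 1] (X 1)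
  seed_measurable : ∀ n, 1 ≤ n → Measurable[ℱ (n + 1)] (seed n)
  error : ∀ n, 1 ≤ n → OracleError μ (ℱ n) q σ (fun ω => err (X n ω) (seed n ω))
  step : ∀ n, 1 ≤ n → ∀ ω,
    X (n + 1) ω = X n ω + γ n • oracle (payoffGradient u) err (X n ω) (seed n ω)

/-- The profile `(…, x' (i - 1), x i, x (i + 1), …)` in which the players before `i` have already
moved from `x` to `x'`. -/
def seqQuery (x x' : Profile d) (i : Fin N) : Profile d := fun j => if j < i then x' j else x j

/-- Sequential (alternating) stochastic gradient ascent. Player `i` makes use of component `i` of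
the oracle output at the intermediate profile, so the requirements on the error concern this
component at this profile. -/
structure IsSeqGA (μ : Measure Ω) (ℱ : Filtration ℕ m) (u : Fin N → Profile d → ℝ)
    (err : Profile d → S → Profile d) (q : ℝ≥0∞) (σ : ℝ) (γ : ℕ → ℝ)
    (seed : ℕ → Ω → S) (X : ℕ → Ω → Profile d) : Prop where
  init : Measurable[ℱ 1] (X 1)
  seed_measurable : ∀ n, 1 ≤ n → Measurable[ℱ (n + 1)] (seed n)
  error : ∀ n, 1 ≤ n → ∀ i,
    OracleError μ (ℱ n) q σ (fun ω => err (seqQuery (X n ω) (X (n + 1) ω) i) (seed n ω) i)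
  step : ∀ n, 1 ≤ n → ∀ ω i, X (n + 1) ω i = X n ω i +
    γ n • oracle (payoffGradient u) err (seqQuery (X n ω) (X (n + 1) ω) i) (seed n ω) i

/-- Extra-gradient: `lead n` is the state at stage `n + 1/2` and `leadSeed n` the seed at that
stage. -/
structure IsEG (μ : Measure Ω) (ℱ : Filtration ℕ m) (u : Fin N → Profile d → ℝ)
    (err : Profile d → S → Profile d) (q : ℝ≥0∞) (σ : ℝ) (γ : ℕ → ℝ)
    (seed leadSeed : ℕ → Ω → S) (X lead : ℕ → Ω → Profile d) : Prop where
  init : Measurable[ℱ 1] (X 1)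
  seed_measurable : ∀ n, 1 ≤ n → Measurable[ℱ (n + 1)] (seed n)
  leadSeed_measurable : ∀ n, 1 ≤ n → Measurable[ℱ (n + 1)] (leadSeed n)
  error : ∀ n, 1 ≤ n → OracleError μ (ℱ n) q σ (fun ω => err (X n ω) (seed n ω))
  leadError : ∀ n, 1 ≤ n → OracleError μ (ℱ n) q σ (fun ω => err (lead n ω) (leadSeed n ω))
  leadStep : ∀ n, 1 ≤ n → ∀ ω,
    lead n ω = X n ω + γ n • oracle (payoffGradient u) err (X n ω) (seed n ω)
  step : ∀ n, 1 ≤ n → ∀ ω,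
    X (n + 1) ω = X n ω + γ n • oracle (payoffGradient u) err (lead n ω) (leadSeed n ω)

/-- Optimistic gradient: `lead n` is the state at stage `n + 1/2`. The state `lead 0` (at stage
`1/2`) and the seed `seed 0` initialize the method. -/
structure IsOG (μ : Measure Ω) (ℱ : Filtration ℕ m) (u : Fin N → Profile d → ℝ)
    (err : Profile d → S → Profile d) (q : ℝ≥0∞) (σ : ℝ) (γ : ℕ → ℝ)
    (seed : ℕ → Ω → S) (X lead : ℕ → Ω → Profile d) : Prop where
  init : Measurable[ℱ 1] (X 1)
  leadInit : Measurable[ℱ 1] (lead 0)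
  seed_measurable : ∀ n, Measurable[ℱ (n + 1)] (seed n)
  error : ∀ n, 1 ≤ n → OracleError μ (ℱ n) q σ (fun ω => err (lead n ω) (seed n ω))
  leadStep : ∀ n ω, lead (n + 1) ω =
    X (n + 1) ω + γ (n + 1) • oracle (payoffGradient u) err (lead n ω) (seed n ω)
  step : ∀ n, 1 ≤ n → ∀ ω,
    X (n + 1) ω = X n ω + γ n • oracle (payoffGradient u) err (lead n ω) (seed n ω)

/-- The index set of the signed basis vectors `± e_k` of `ℝ ^ k`. -/
abbrev SignedIndex (k : ℕ) : Type := Fin k × ℤˣ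

/-- The profile of signed basis vectors with indices `j`. -/
def signedBasis (j : ∀ i, SignedIndex (d i)) : Profile d :=
  fun i => EuclideanSpace.single (j i).1 (((j i).2 : ℤ) : ℝ)

/-- Simultaneous perturbation stochastic approximation with sampling parameters `δ n`: given the
history, the directions are uniform over all profiles of signed basis vectors. -/
structure IsSPSA (μ : Measure Ω) (ℱ : Filtration ℕ m) (u : Fin N → Profile d → ℝ)
    (γ δ : ℕ → ℝ) (dir : ℕ → Ω → ∀ i, SignedIndex (d i)) (X : ℕ → Ω → Profile d) : Prop where
  init : Measurable[ℱ 1] (X 1)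
  dir_measurable : ∀ n, 1 ≤ n → ∀ j, MeasurableSet[ℱ (n + 1)] {ω | dir n ω = j}
  dir_law : ∀ n, 1 ≤ n → ∀ j,
    μ⟦{ω | dir n ω = j} | ℱ n⟧ =ᵐ[μ] fun _ => ∏ i, (1 / (2 * (d i : ℝ)))
  step : ∀ n, 1 ≤ n → ∀ ω i, X (n + 1) ω i = X n ω i +
    γ n • ((d i / δ n * u i (X n ω + δ n • signedBasis (dir n ω))) • signedBasis (dir n ω) i)

end Unconstrained

/-! ### Mirror maps and games with general action spaces -/

section Mirror

/-- `h` is a regularizer on `X`. Being supported on `X`, it equals `+∞` outside `X`; so only its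
(finite) values on `X` matter. -/
structure IsRegularizer {V : Type*} [NormedAddCommGroup V] [NormedSpace ℝ V]
    (X : Set V) (h : V → ℝ) : Prop where
  continuousOn : ContinuousOn h X
  strongConvex : ∃ K : ℝ, 0 < K ∧ StrongConvexOn X K h

open Classical in
/-- The mirror map `y ↦ argmax {⟨y, x⟩ - h x : x ∈ X}`. -/
def mirrorMap {V : Type*} [NormedAddCommGroup V] [NormedSpace ℝ V]
    (X : Set V) (h : V → ℝ) (y : StrongDual ℝ V) : V :=
  Classical.epsilon fun x => x ∈ X ∧ IsMaxOn (fun z => y z - h z) X x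

variable {N : ℕ} {V : Fin N → Type*} [∀ i, NormedAddCommGroup (V i)] [∀ i, NormedSpace ℝ (V i)]

/-- A continuous game with closed convex action sets `X i` in `V i` and payoff functions `u i`
that are differentiable on the set of action profiles with gradients `du i`, Lipschitz continuous
and Lipschitz smooth. -/
structure IsContinuousGame (X : ∀ i, Set (V i)) (u : Fin N → (∀ i, V i) → ℝ)
    (du : Fin N → (∀ i, V i) → StrongDual ℝ (∀ i, V i)) : Prop where
  nonempty : ∀ i, (X i).Nonempty
  closed : ∀ i, IsClosed (X i)
  convex : ∀ i, Convex ℝ (X i)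
  hasGradient : ∀ i, ∀ x ∈ Set.univ.pi X, HasFDerivWithinAt (u i) (du i x) (Set.univ.pi X) x
  lipschitz : ∀ i, ∃ G, LipschitzOnWith G (u i) (Set.univ.pi X)
  smooth : ∀ i, ∃ L, LipschitzOnWith L (du i) (Set.univ.pi X)

/-- The profile of individual payoff gradients: `v i x` is the restriction of the gradient of `u i`
at `x` to the directions of player `i`. -/
def dualGradient (du : Fin N → (∀ i, V i) → StrongDual ℝ (∀ i, V i)) (x : ∀ i, V i) :
    ∀ i, StrongDual ℝ (V i) :=
  fun i => (du i x).comp (ContinuousLinearMap.single ℝ V i)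

/-- The mirror map of all players. -/
def mirrorProfile (X : ∀ i, Set (V i)) (h : ∀ i, V i → ℝ) (y : ∀ i, StrongDual ℝ (V i)) :
    ∀ i, V i :=
  fun i => mirrorMap (X i) (h i) (y i)

/-- Mirror-prox: `Y n`, `leadY n` are the dual states at stages `n` and `n + 1/2`, and the
corresponding action profiles are their images under the mirror map. -/
structure IsMP [∀ i, MeasurableSpace (V i)] {Ω S : Type*} [m : MeasurableSpace Ω]
    [MeasurableSpace S] (μ : Measure Ω) (ℱ : Filtration ℕ m)
    (X : ∀ i, Set (V i)) (h : ∀ i, V i → ℝ)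
    (du : Fin N → (∀ i, V i) → StrongDual ℝ (∀ i, V i))
    (err : (∀ i, V i) → S → ∀ i, StrongDual ℝ (V i)) (q : ℝ≥0∞) (σ : ℝ) (γ : ℕ → ℝ)
    (seed leadSeed : ℕ → Ω → S) (Y leadY : ℕ → Ω → ∀ i, StrongDual ℝ (V i)) : Prop where
  init : Measurable[ℱ 1] (Y 1)
  seed_measurable : ∀ n, 1 ≤ n → Measurable[ℱ (n + 1)] (seed n)
  leadSeed_measurable : ∀ n, 1 ≤ n → Measurable[ℱ (n + 1)] (leadSeed n)
  error : ∀ n, 1 ≤ n →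
    OracleError μ (ℱ n) q σ (fun ω => err (mirrorProfile X h (Y n ω)) (seed n ω))
  leadError : ∀ n, 1 ≤ n →
    OracleError μ (ℱ n) q σ (fun ω => err (mirrorProfile X h (leadY n ω)) (leadSeed n ω))
  leadStep : ∀ n, 1 ≤ n → ∀ ω, leadY n ω = Y n ω +
    γ n • oracle (dualGradient du) err (mirrorProfile X h (Y n ω)) (seed n ω)
  step : ∀ n, 1 ≤ n → ∀ ω, Y (n + 1) ω = Y n ω +
    γ n • oracle (dualGradient du) err (mirrorProfile X h (leadY n ω)) (leadSeed n ω)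

end Mirror

/-! ### Finite games -/

section Finite

variable {N : ℕ} {A : Fin N → Type*} [∀ i, Fintype (A i)]

/-- The mixed payoff of player `i` at the profile `x` of mixed strategies. -/
def mixedPayoff (u : Fin N → (∀ i, A i) → ℝ) (i : Fin N) (x : ∀ i, A i → ℝ) : ℝ :=
  ∑ a : ∀ j, A j, (∏ j, x j (a j)) * u i a

open Classical in
/-- The mixed payoff vectors `v i x = (u i (α; x (-i)))_α`. -/
def payoffVector (u : Fin N → (∀ i, A i) → ℝ) (x : ∀ i, A i → ℝ) : ∀ i, A i → ℝ :=
  fun i α => mixedPayoff u i (Function.update x i (Pi.single α 1))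

/-- The logit choice map of all players. -/
def logit (y : ∀ i, A i → ℝ) : ∀ i, A i → ℝ :=
  fun i α => Real.exp (y i α) / ∑ β, Real.exp (y i β)

/-- Mean dynamics in the dual space for the logit choice map. -/
def logitField (u : Fin N → (∀ i, A i) → ℝ) (y : ∀ i, A i → ℝ) : ∀ i, A i → ℝ :=
  payoffVector u (logit y)

/-- Given the history, the pure strategies `a n` are drawn, independently across players, from the
mixed strategies `x n`; they are known at the next stage. -/
structure IsDrawn {Ω : Type*} [m : MeasurableSpace Ω] (μ : Measure Ω) (ℱ : Filtration ℕ m)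
    (x : ℕ → Ω → ∀ i, A i → ℝ) (a : ℕ → Ω → ∀ i, A i) : Prop where
  measurable : ∀ n, 1 ≤ n → ∀ b, MeasurableSet[ℱ (n + 1)] {ω | a n ω = b}
  law : ∀ n, 1 ≤ n → ∀ b,
    μ⟦{ω | a n ω = b} | ℱ n⟧ =ᵐ[μ] fun ω => ∏ i, x n ω i (b i)

/-- The two oracle models in finite games. -/
inductive Feedback where
  | full
  | realized

open Classical in
/-- The oracle output at mixed profile `x` when `a` is the realized pure profile: mixed payoff
vectors for full information, pure payoff vectors for realization-based feedback. -/
def finiteOracle (u : Fin N → (∀ i, A i) → ℝ) (fb : Feedback) (x : ∀ i, A i → ℝ)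
    (a : ∀ i, A i) : ∀ i, A i → ℝ :=
  match fb with
  | .full => payoffVector u x
  | .realized => fun i α => u i (Function.update a i α)

/-- The exponential weights algorithm; the mixed strategies at stage `n` are `logit (Y n)`. -/
structure IsEW {Ω : Type*} [m : MeasurableSpace Ω] (μ : Measure Ω) (ℱ : Filtration ℕ m)
    (u : Fin N → (∀ i, A i) → ℝ) (fb : Feedback) (γ : ℕ → ℝ)
    (a : ℕ → Ω → ∀ i, A i) (Y : ℕ → Ω → ∀ i, A i → ℝ) : Prop where
  init : Measurable[ℱ 1] (Y 1)
  drawn : IsDrawn μ ℱ (fun n ω => logit (Y n ω)) a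
  step : ∀ n, 1 ≤ n → ∀ ω,
    Y (n + 1) ω = Y n ω + γ n • finiteOracle u fb (logit (Y n ω)) (a n ω)

/-- The sampling strategies `(1 - ε) x i + ε unif (A i)`. -/
def explore (ε : ℝ) (x : ∀ i, A i → ℝ) : ∀ i, A i → ℝ :=
  fun i α => (1 - ε) * x i α + ε * (1 / (Fintype.card (A i) : ℝ))

open Classical in
/-- The importance-weighted estimator at the sampling strategies `z` for the realized profile
`a`. -/
def iwe (u : Fin N → (∀ i, A i) → ℝ) (z : ∀ i, A i → ℝ) (a : ∀ i, A i) : ∀ i, A i → ℝ :=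
  fun i α => (if a i = α then 1 else 0) / z i α * u i a

/-- The EXP3 algorithm with exploration parameters `δ n`. -/
structure IsEXP3 {Ω : Type*} [m : MeasurableSpace Ω] (μ : Measure Ω) (ℱ : Filtration ℕ m)
    (u : Fin N → (∀ i, A i) → ℝ) (γ δ : ℕ → ℝ)
    (a : ℕ → Ω → ∀ i, A i) (Y : ℕ → Ω → ∀ i, A i → ℝ) : Prop where
  init : Measurable[ℱ 1] (Y 1)
  drawn : IsDrawn μ ℱ (fun n ω => explore (δ n) (logit (Y n ω))) a
  step : ∀ n, 1 ≤ n → ∀ ω,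
    Y (n + 1) ω = Y n ω + γ n • iwe u (explore (δ n) (logit (Y n ω))) (a n ω)

end Finite

end LearningInGames

end

open LearningInGames

/-! Every algorithm is brought to the form Y_{n+1} = Y_n + γ_n (F(Y_n) + U_n + b_n), with martingale
differences U_n and a bias b_n → 0, and `IsTameField.isAPT` is applied path by path. Noise enters
through the recursive averages Z_{n+1} = Z_n + γ_n (U_n - Z_n). If Z_n → 0, then W_n = Y_n - Z_n
satisfies W_{n+1} = W_n + γ_n (F(W_n) + o(1)), a noiseless Euler scheme, because F is Lipschitz.
Grönwall's inequality keeps the interpolation of W near the flow on bounded time windows, and Y and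
W merge.

Almost sure convergence Z_n → 0 rests on an inequality for |Z_n|^q (`exists_average_rpow_le`):
averaging contracts it by 1 - γ_n/2, the term linear in U_n has zero conditional mean, and the rest
is of order γ_n^{1+q/2} |U_n|^q. A Robbins–Siegmund argument (`ae_tendsto_zero_of_condExp_le`) then
asks that γ_n^{1+q/2} times the q-th moment be summable. For bounded moments this is p(1+q/2) > 1,
that is p > 2/(2+q). For bounded noise q is free, and if the bound grows like n^r the condition
p(1+q/2) - rq > 1 can be met by a large q exactly when p > 2r.

Two features of the setting shape the argument. The time τ_n already contains γ_n, so the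
interpolation spends time γ_{n+1} on an increment of size γ_n; the mismatch (γ_n/γ_{n+1} - 1) F(W_n)
vanishes since F grows at most like τ_n along the sequence. Moreover, on action sets with empty
interior the payoffs control their gradients only along the sets, so F may be unbounded in norm. It
is bounded in `directionalSeminorm`, and it is Lipschitz for this seminorm because the mirror map
sees nothing else.

For methods with intermediate queries, the query is one vanishing step away from the state, which
yields a vanishing bias. For EW, EXP3 and SPSA the noise comes from a finite draw; in the last two,
estimators of size O(1/δ_n) = O(n^r) have a bias O(δ_n). -/

namespace LearningInGames

/-! ### Global flows of Lipschitz fields -/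

section Flow

variable {D : Type*} [NormedAddCommGroup D] [NormedSpace ℝ D] {F : D → D} {K : NNReal}

/-- `α` solves `ẏ = F y` on the time interval `(-a, a)`. -/
def SolvesOn (F : D → D) (a : ℝ) (α : ℝ → D) : Prop :=
  ∀ t ∈ Set.Ioo (-a) a, HasDerivAt α (F (α t)) t

lemma SolvesOn.shift {a b : ℝ} {α : ℝ → D} (h : SolvesOn F a α) {t : ℝ}
    (ht : t - b ∈ Set.Ioo (-a) a) :
    HasDerivAt (fun s => α (s - b)) (F (α (t - b))) t :=
  HasDerivAt.comp_sub_const t b (h _ ht)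

lemma SolvesOn.eqOn (hF : LipschitzWith K F) {a b : ℝ} (hab : a ≤ b) {α β : ℝ → D}
    (hα : SolvesOn F a α) (hβ : SolvesOn F b β) (h0 : α 0 = β 0) :
    Set.EqOn α β (Set.Ioo (-a) a) := by
  intro t ht
  have ha : 0 < a := by have := ht.1.trans ht.2; linarith
  exact ODE_solution_unique_of_mem_Ioo (v := fun _ => F) (s := fun _ => Set.univ) (K := K)
    (fun _ _ => hF.lipschitzOnWith) (t₀ := 0) ⟨by linarith, ha⟩
    (fun s hs => ⟨hα s hs, trivial⟩)
    (fun s hs => ⟨hβ s ⟨by linarith [hs.1], by linarith [hs.2]⟩, trivial⟩) h0 ht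

/-- On the ball of radius `‖F y‖` around `y` the field is at most `(1 + K) * ‖F y‖`, so in time `1 /
(2 * (K + 1))` a solution uses half of the radius. This lifetime does not depend on `y`, which makes
the extension possible. -/
lemma exists_solvesOn_short [CompleteSpace D] (hF : LipschitzWith K F) (y : D) :
    ∃ α : ℝ → D, α 0 = y ∧ SolvesOn F (1 / (2 * (K + 1))) α := by
  have hε : 0 < 1 / (2 * ((K : ℝ) + 1)) := by positivity
  set ε : ℝ := 1 / (2 * ((K : ℝ) + 1)) with hεdef
  have hpl : IsPicardLindelof (fun _ : ℝ => F) (tmin := -ε) (tmax := ε)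
      ⟨0, by constructor <;> linarith⟩ y ‖F y‖₊ 0 (‖F y‖₊ + K * ‖F y‖₊) K := by
    apply IsPicardLindelof.of_time_independent
    · intro x hx
      have h1 := hF.norm_sub_le x y
      have h2 : ‖F x‖ ≤ ‖F y‖ + ‖F x - F y‖ := by
        simpa using norm_add_le (F y) (F x - F y)
      have h3 : ‖x - y‖ ≤ ‖F y‖ := by simpa [dist_eq_norm] using hx
      have h4 : (K : ℝ) * ‖x - y‖ ≤ K * ‖F y‖ := by gcongr
      rw [NNReal.coe_add, NNReal.coe_mul, coe_nnnorm]
      linarith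
    · exact hF.lipschitzOnWith
    · simp only [NNReal.coe_add, NNReal.coe_mul, coe_nnnorm, sub_zero, zero_sub, neg_neg,
        max_self, NNReal.coe_zero]
      have : (‖F y‖ + K * ‖F y‖) * ε = ‖F y‖ / 2 := by
        rw [hεdef]; field_simp; ring
      rw [this]
      linarith [norm_nonneg (F y)]
  obtain ⟨α, h0, hα⟩ := hpl.exists_eq_forall_mem_Icc_hasDerivWithinAt₀
  exact ⟨α, h0, fun t ht => (hα t (Set.Ioo_subset_Icc_self ht)).hasDerivAt
    (Icc_mem_nhds ht.1 ht.2)⟩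

/-- Restart the solution at the times `±a / 2`, where it is still alive, and glue: uniqueness makes
the pieces agree on the overlaps. -/
lemma exists_solvesOn_extend (hF : LipschitzWith K F) {a : ℝ} (ha : 0 < a)
    (h : ∀ y, ∃ α : ℝ → D, α 0 = y ∧ SolvesOn F a α) (y : D) :
    ∃ α : ℝ → D, α 0 = y ∧ SolvesOn F (3 / 2 * a) α := by
  choose A hA0 hA using h
  set p : ℝ → D := fun t => A (A y (a / 2)) (t - a / 2) with hp
  set m : ℝ → D := fun t => A (A y (-(a / 2))) (t - -(a / 2)) with hm
  have hpe : Set.EqOn (A y) p (Set.Ioo (-(a / 2)) a) :=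
    ODE_solution_unique_of_mem_Ioo (v := fun _ => F) (s := fun _ => Set.univ) (K := K)
      (fun _ _ => hF.lipschitzOnWith) (t₀ := a / 2) ⟨by linarith, by linarith⟩
      (fun s hs => ⟨hA y s ⟨by linarith [hs.1], hs.2⟩, trivial⟩)
      (fun s hs => ⟨(hA _).shift ⟨by linarith [hs.1], by linarith [hs.2]⟩, trivial⟩)
      (by simp [hp, hA0])
  have hme : Set.EqOn (A y) m (Set.Ioo (-a) (a / 2)) :=
    ODE_solution_unique_of_mem_Ioo (v := fun _ => F) (s := fun _ => Set.univ) (K := K)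
      (fun _ _ => hF.lipschitzOnWith) (t₀ := -(a / 2)) ⟨by linarith, by linarith⟩
      (fun s hs => ⟨hA y s ⟨by linarith [hs.1], by linarith [hs.2]⟩, trivial⟩)
      (fun s hs => ⟨(hA _).shift ⟨by linarith [hs.1], by linarith [hs.2]⟩, trivial⟩)
      (by simp [hm, hA0])
  set κ : ℝ → D := fun t => if t ≤ -(a / 2) then m t else if t < a / 2 then A y t else p t
    with hκ
  have hin : Set.EqOn κ (A y) (Set.Ioo (-a) a) := by
    intro t ht
    simp only [hκ]
    split_ifs with h1 h2
    · exact (hme ⟨ht.1, by linarith⟩).symm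
    · rfl
    · exact (hpe ⟨by linarith, ht.2⟩).symm
  refine ⟨κ, by rw [hin ⟨by linarith, ha⟩, hA0], fun t ht => ?_⟩
  rcases lt_or_ge t a with h1 | h1
  · rcases lt_or_ge (-a) t with h2 | h2
    · rw [hin ⟨h2, h1⟩]
      exact (hA y t ⟨h2, h1⟩).congr_of_eventuallyEq
        (hin.eventuallyEq_of_mem (Ioo_mem_nhds h2 h1))
    · have he : κ =ᶠ[𝓝 t] m := by
        filter_upwards [Iio_mem_nhds (show t < -(a / 2) by linarith)] with s hs
        exact if_pos (le_of_lt hs)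
      rw [he.eq_of_nhds]
      exact ((hA _).shift ⟨by linarith [ht.1], by linarith⟩).congr_of_eventuallyEq he
  · have he : κ =ᶠ[𝓝 t] p := by
      filter_upwards [Ioi_mem_nhds (show a / 2 < t by linarith)] with s hs
      have hs' : a / 2 < s := hs
      simp only [hκ]
      rw [if_neg (by linarith), if_neg (by linarith)]
    rw [he.eq_of_nhds]
    exact ((hA _).shift ⟨by linarith, by linarith [ht.2]⟩).congr_of_eventuallyEq he

/-- A Lipschitz continuous field on a Banach space has a global flow. -/
theorem exists_isFlow [CompleteSpace D] (hF : LipschitzWith K F) : ∃ Φ, IsFlow F Φ := by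
  have hε : 0 < 1 / (2 * ((K : ℝ) + 1)) := by positivity
  have hpow : ∀ n : ℕ, ∀ y, ∃ α : ℝ → D, α 0 = y ∧
      SolvesOn F ((3 / 2) ^ n * (1 / (2 * ((K : ℝ) + 1)))) α := by
    intro n
    induction n with
    | zero => intro y; simpa using exists_solvesOn_short hF y
    | succ n ih =>
      intro y
      obtain ⟨α, h0, h⟩ := exists_solvesOn_extend hF (by positivity) ih y
      exact ⟨α, h0, by rwa [pow_succ', mul_assoc]⟩
  have hall : ∀ (a : ℝ) (y : D), ∃ α : ℝ → D, α 0 = y ∧ SolvesOn F a α := by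
    intro a y
    obtain ⟨n, hn⟩ := pow_unbounded_of_one_lt (a * (2 * ((K : ℝ) + 1)))
      (show (1 : ℝ) < 3 / 2 by norm_num)
    obtain ⟨α, h0, h⟩ := hpow n y
    have hle : a ≤ (3 / 2) ^ n * (1 / (2 * ((K : ℝ) + 1))) := by
      rw [mul_one_div, le_div_iff₀ (by positivity)]; exact hn.le
    exact ⟨α, h0, fun t ht => h t ⟨by linarith [ht.1], by linarith [ht.2]⟩⟩
  choose A hA0 hA using hall
  refine ⟨fun t y => A (|t| + 1) y t, ⟨fun y => hA0 _ _, fun y t => ?_⟩⟩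
  -- The chosen solution varies with the time itself; near `t` uniqueness replaces all the choices
  -- by the single one of lifetime `|t| + 2`, which can be differentiated.
  have he : (fun s => A (|s| + 1) y s) =ᶠ[𝓝 t] A (|t| + 2) y := by
    filter_upwards [Metric.ball_mem_nhds t one_pos] with s hs
    have h1 : |s - t| < 1 := by simpa [Real.dist_eq] using hs
    have h2 : |s| ≤ |t| + |s - t| := by simpa using abs_add_le t (s - t)
    exact (hA (|s| + 1) y).eqOn hF (by linarith) (hA (|t| + 2) y) (by rw [hA0, hA0])
      ⟨by linarith [neg_abs_le s], by linarith [le_abs_self s]⟩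
  have h3 := hA (|t| + 2) y t ⟨by linarith [neg_abs_le t], by linarith [le_abs_self t]⟩
  rw [← he.eq_of_nhds] at h3
  exact h3.congr_of_eventuallyEq he

lemma IsFlow.dist_le {Φ : ℝ → D → D} (hΦ : IsFlow F Φ) (hF : LipschitzWith K F) (x y : D)
    {s : ℝ} (hs : 0 ≤ s) : dist (Φ s x) (Φ s y) ≤ dist x y * Real.exp (K * s) := by
  have hc : ∀ z, Continuous fun r => Φ r z := fun z =>
    continuous_iff_continuousAt.2 fun r => (hΦ.orbit z r).continuousAt
  have := dist_le_of_trajectories_ODE (v := fun _ => F) (fun _ => hF) (a := 0) (b := s)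
    (hc x).continuousOn (fun t _ => (hΦ.orbit x t).hasDerivWithinAt)
    (hc y).continuousOn (fun t _ => (hΦ.orbit y t).hasDerivWithinAt) le_rfl s ⟨hs, le_rfl⟩
  simpa [hΦ.initial] using this

end Flow

/-! ### Interpolation and asymptotic pseudotrajectories -/

/-- Step-sizes that vanish, are not summable, and vary slowly. -/
structure IsStepSize (γ : ℕ → ℝ) : Prop where
  pos : ∀ n, 1 ≤ n → 0 < γ n
  tendsto_zero : Tendsto γ atTop (𝓝 0)
  tendsto_effTime : Tendsto (effTime γ) atTop atTop
  -- The interpolation divides an increment of size `γ n` by the time `γ (n + 1)`. The weight `1 + τ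
  -- n` tolerates fields that grow linearly in time along the sequence.
  slow : Tendsto (fun n => (γ n / γ (n + 1) - 1) * (1 + effTime γ n)) atTop (𝓝 0)

lemma effTime_zero (γ : ℕ → ℝ) : effTime γ 0 = 0 := by simp [effTime]

lemma effTime_succ (γ : ℕ → ℝ) (n : ℕ) : effTime γ (n + 1) = effTime γ n + γ (n + 1) := by
  rw [effTime, effTime, Finset.sum_Icc_succ_top (by omega)]

namespace IsStepSize

variable {γ : ℕ → ℝ} (hγ : IsStepSize γ)
include hγ

lemma strictMono_effTime : StrictMono (effTime γ) :=
  strictMono_nat_of_lt_succ fun n => by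
    rw [effTime_succ]; linarith [hγ.pos (n + 1) (by omega)]

lemma effTime_nonneg (n : ℕ) : 0 ≤ effTime γ n :=
  effTime_zero γ ▸ hγ.strictMono_effTime.monotone (Nat.zero_le n)

lemma lastIndex_eq {n : ℕ} {t : ℝ} (h1 : effTime γ n ≤ t) (h2 : t < effTime γ (n + 1)) :
    lastIndex γ t = n := by
  have : {k : ℕ | effTime γ k ≤ t} = Set.Iic n := by
    ext k
    simp only [Set.mem_ofPred_eq, Set.mem_Iic]
    constructor
    · intro hk
      have := hγ.strictMono_effTime.lt_iff_lt.1 (hk.trans_lt h2)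
      omega
    · intro hk
      exact (hγ.strictMono_effTime.monotone hk).trans h1
  rw [lastIndex, this, csSup_Iic]

lemma exists_index {t : ℝ} (ht : 0 ≤ t) : ∃ n, effTime γ n ≤ t ∧ t < effTime γ (n + 1) := by
  have hex : ∃ n, t < effTime γ n := (hγ.tendsto_effTime.eventually_gt_atTop t).exists
  classical
  have h0 : Nat.find hex ≠ 0 := by
    intro h
    have := Nat.find_spec hex
    rw [h, effTime_zero] at this
    linarith
  obtain ⟨n, hn⟩ := Nat.exists_eq_succ_of_ne_zero h0
  refine ⟨n, not_lt.1 (Nat.find_min hex (by omega)), ?_⟩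
  have := Nat.find_spec hex
  rwa [hn] at this

lemma exists_index_ge {t : ℝ} {m : ℕ} (ht : effTime γ m ≤ t) :
    ∃ n, m ≤ n ∧ effTime γ n ≤ t ∧ t < effTime γ (n + 1) := by
  obtain ⟨n, h1, h2⟩ := hγ.exists_index ((hγ.effTime_nonneg m).trans ht)
  have := hγ.strictMono_effTime.lt_iff_lt.1 (ht.trans_lt h2)
  exact ⟨n, by omega, h1, h2⟩

end IsStepSize

section Interpolation

variable {D : Type*} [NormedAddCommGroup D] [NormedSpace ℝ D] {γ : ℕ → ℝ}

/-- The slope of the interpolation of `W` between the times `τ n` and `τ (n + 1)`. -/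
noncomputable def slope (γ : ℕ → ℝ) (W : ℕ → D) (n : ℕ) : D := (γ (n + 1))⁻¹ • (W (n + 1) - W n)

lemma interpolation_eq (hγ : IsStepSize γ) (W : ℕ → D) {n : ℕ} {t : ℝ}
    (ht : t ∈ Set.Icc (effTime γ n) (effTime γ (n + 1))) :
    interpolation γ W t = W n + (t - effTime γ n) • slope γ W n := by
  have hp := hγ.pos (n + 1) (by omega)
  rcases ht.2.lt_or_eq with h | h
  · rw [interpolation, hγ.lastIndex_eq ht.1 h, effTime_succ, slope, smul_smul, add_sub_cancel_left,
      div_eq_mul_inv]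
  -- At the right endpoint `lastIndex` is already `n + 1`, so the definition uses the next segment,
  -- with zero elapsed time.
  · have h2 : t < effTime γ (n + 1 + 1) := h ▸ hγ.strictMono_effTime (by omega)
    rw [interpolation, hγ.lastIndex_eq h.ge h2, h, sub_self, zero_div, zero_smul, add_zero,
      effTime_succ, slope, smul_smul, add_sub_cancel_left, mul_inv_cancel₀ hp.ne', one_smul,
      add_sub_cancel]

lemma continuousOn_interpolation (hγ : IsStepSize γ) (W : ℕ → D) (a b : ℝ) (ha : 0 ≤ a) :
    ContinuousOn (interpolation γ W) (Set.Icc a b) := by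
  have h : ∀ n, ContinuousOn (interpolation γ W) (Set.Icc 0 (effTime γ n)) := by
    intro n
    induction n with
    | zero => rw [effTime_zero, Set.Icc_self]; exact continuousOn_singleton _ _
    | succ n ih =>
      rw [← Set.Icc_union_Icc_eq_Icc (hγ.effTime_nonneg n)
        (hγ.strictMono_effTime.monotone n.le_succ)]
      refine ih.union_of_isClosed ?_ isClosed_Icc isClosed_Icc
      exact ContinuousOn.congr (by fun_prop) fun t ht => interpolation_eq hγ W ht
  obtain ⟨n, hn⟩ := (hγ.tendsto_effTime.eventually_ge_atTop b).exists
  exact (h n).mono (Set.Icc_subset_Icc ha hn)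

lemma hasDerivWithinAt_interpolation (hγ : IsStepSize γ) (W : ℕ → D) {n : ℕ} {t : ℝ}
    (h1 : effTime γ n ≤ t) (h2 : t < effTime γ (n + 1)) :
    HasDerivWithinAt (interpolation γ W) (slope γ W n) (Set.Ici t) t := by
  have hd : HasDerivAt (fun s => W n + (s - effTime γ n) • slope γ W n) (slope γ W n) t := by
    simpa using (((hasDerivAt_id t).sub_const (effTime γ n)).smul_const (slope γ W n)).const_add
      (W n)
  refine hd.hasDerivWithinAt.congr_of_eventuallyEq ?_ (interpolation_eq hγ W ⟨h1, h2.le⟩)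
  filter_upwards [Ico_mem_nhdsGE h2] with s hs
  exact interpolation_eq hγ W ⟨h1.trans hs.1, hs.2.le⟩

/-- Interpolations of asymptotically equal sequences are asymptotically equal. -/
lemma eventually_dist_interpolation_le (hγ : IsStepSize γ) {Y W : ℕ → D}
    (h : Tendsto (fun n => Y n - W n) atTop (𝓝 0)) {ε : ℝ} (hε : 0 < ε) :
    ∀ᶠ t in atTop, dist (interpolation γ Y t) (interpolation γ W t) ≤ ε := by
  obtain ⟨m, hm⟩ := eventually_atTop.1
    ((tendsto_zero_iff_norm_tendsto_zero.1 h).eventually_le_const hε)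
  filter_upwards [eventually_ge_atTop (effTime γ m)] with t ht
  obtain ⟨n, hmn, h1, h2⟩ := hγ.exists_index_ge ht
  have hp := hγ.pos (n + 1) (by omega)
  rw [interpolation_eq hγ Y ⟨h1, h2.le⟩, interpolation_eq hγ W ⟨h1, h2.le⟩, dist_eq_norm]
  set θ : ℝ := (t - effTime γ n) * (γ (n + 1))⁻¹ with hθ
  have hθ0 : 0 ≤ θ := mul_nonneg (by linarith) (by positivity)
  have hθ1 : θ ≤ 1 := by
    rw [hθ, ← div_eq_mul_inv, div_le_one hp]
    rw [effTime_succ] at h2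
    linarith
  have he : Y n + (t - effTime γ n) • slope γ Y n - (W n + (t - effTime γ n) • slope γ W n) =
      (1 - θ) • (Y n - W n) + θ • (Y (n + 1) - W (n + 1)) := by
    rw [slope, slope, smul_smul, smul_smul, ← hθ]
    module
  rw [he]
  calc ‖(1 - θ) • (Y n - W n) + θ • (Y (n + 1) - W (n + 1))‖
      ≤ (1 - θ) * ‖Y n - W n‖ + θ * ‖Y (n + 1) - W (n + 1)‖ := by
        refine (norm_add_le _ _).trans_eq ?_
        rw [norm_smul, norm_smul, Real.norm_of_nonneg hθ0, Real.norm_of_nonneg (by linarith)]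
    _ ≤ (1 - θ) * ε + θ * ε := by
        have := hm n hmn
        have := hm (n + 1) (by omega)
        have : 0 ≤ 1 - θ := by linarith
        gcongr
    _ = ε := by ring

end Interpolation

section Pseudotrajectory

variable {D : Type*} [NormedAddCommGroup D] [NormedSpace ℝ D] {γ : ℕ → ℝ} {F : D → D}

/-- The field `F` is Lipschitz continuous with respect to a seminorm in which it is bounded. -/
structure IsTameField (F : D → D) (π : Seminorm ℝ D) (L G : ℝ) : Prop where
  nonneg : 0 ≤ L
  le_norm : ∀ y, π y ≤ ‖y‖
  lipschitz : ∀ y z, ‖F y - F z‖ ≤ L * π (y - z)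
  bounded : ∀ y, π (F y) ≤ G

namespace IsTameField

variable {π : Seminorm ℝ D} {L G : ℝ} (hF : IsTameField F π L G)
include hF

lemma lipschitzWith : LipschitzWith L.toNNReal F :=
  LipschitzWith.of_dist_le' fun y z => by
    rw [dist_eq_norm, dist_eq_norm]
    exact (hF.lipschitz y z).trans (mul_le_mul_of_nonneg_left (hF.le_norm _) hF.nonneg)

/-- An interpolated sequence whose slopes follow the field follows the flow. -/
lemma eventually_dist_flow_le (hγ : IsStepSize γ) {Φ : ℝ → D → D} (hΦ : IsFlow F Φ) {W : ℕ → D}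
    (h1 : Tendsto (fun n => slope γ W n - F (W n)) atTop (𝓝 0))
    (h2 : Tendsto (fun n => γ (n + 1) * π (slope γ W n)) atTop (𝓝 0)) (T : ℝ) {ε : ℝ}
    (hε : 0 < ε) :
    ∀ᶠ t in atTop, ∀ s ∈ Set.Icc 0 T,
      dist (interpolation γ W (t + s)) (Φ s (interpolation γ W t)) ≤ ε := by
  -- Slopes within `η` of the field cost at most `gronwallBound 0 L η T` over the window, and this
  -- vanishes with `η`.
  obtain ⟨η, hη, hη0⟩ : ∃ η, gronwallBound 0 L.toNNReal η T < ε ∧ 0 < η := by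
    have hc := (gronwallBound_continuous_ε 0 L.toNNReal T).tendsto 0
    rw [gronwallBound_ε0_δ0] at hc
    exact (((hc.eventually_lt_const hε).filter_mono nhdsWithin_le_nhds).and
      (self_mem_nhdsWithin (s := Set.Ioi (0 : ℝ)))).exists
  have h3 : Tendsto (fun n => ‖slope γ W n - F (W n)‖ + L * (γ (n + 1) * π (slope γ W n))) atTop
      (𝓝 0) := by
    simpa using (tendsto_zero_iff_norm_tendsto_zero.1 h1).add (h2.const_mul L)
  obtain ⟨m, hm⟩ := eventually_atTop.1 (h3.eventually_le_const hη0)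
  -- Grönwall compares the slope with the field at the current point of the segment, not at its left
  -- end `W n`; the two points differ in `π` by at most `γ (n + 1) * π (slope γ W n)`.
  have hslope : ∀ n, m ≤ n → ∀ t, effTime γ n ≤ t → t < effTime γ (n + 1) →
      dist (slope γ W n) (F (interpolation γ W t)) ≤ η := by
    intro n hn t ht1 ht2
    have hp := hγ.pos (n + 1) (by omega)
    rw [interpolation_eq hγ W ⟨ht1, ht2.le⟩, dist_eq_norm]
    refine le_trans ?_ (hm n hn)
    have ha := hF.lipschitz (W n) (W n + (t - effTime γ n) • slope γ W n)
    have hb : π (W n - (W n + (t - effTime γ n) • slope γ W n)) ≤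
        γ (n + 1) * π (slope γ W n) := by
      rw [sub_add_cancel_left, map_neg_eq_map, map_smul_eq_mul,
        Real.norm_of_nonneg (by linarith)]
      rw [effTime_succ] at ht2
      exact mul_le_mul_of_nonneg_right (by linarith) (apply_nonneg π _)
    have hc := mul_le_mul_of_nonneg_left hb hF.nonneg
    have hd := norm_add_le (slope γ W n - F (W n))
      (F (W n) - F (W n + (t - effTime γ n) • slope γ W n))
    rw [sub_add_sub_cancel] at hd
    linarith
  filter_upwards [eventually_ge_atTop (effTime γ m)] with t ht s hs
  have ht0 : 0 ≤ t := (hγ.effTime_nonneg m).trans ht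
  -- The slope must be a function of all real `r`; negative times get the dummy index `0`.
  have hidx : ∀ r : ℝ, ∃ n, 0 ≤ r → m ≤ n ∧ effTime γ n ≤ t + r ∧ t + r < effTime γ (n + 1) := by
    intro r
    by_cases hr : 0 ≤ r
    · obtain ⟨n, hn⟩ := hγ.exists_index_ge (show effTime γ m ≤ t + r by linarith)
      exact ⟨n, fun _ => hn⟩
    · exact ⟨0, fun h => absurd h hr⟩
  choose ν hν using hidx
  have hcomp : ContinuousOn (fun r => interpolation γ W (t + r)) (Set.Icc 0 T) :=
    (continuousOn_interpolation hγ W t (t + T) ht0).comp (by fun_prop)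
      fun r hr => ⟨by linarith [hr.1], by linarith [hr.2]⟩
  have hderiv : ∀ r ∈ Set.Ico 0 T, HasDerivWithinAt (fun r => interpolation γ W (t + r))
      (slope γ W (ν r)) (Set.Ici r) r := by
    intro r hr
    obtain ⟨-, ha, hb⟩ := hν r hr.1
    have hi : HasDerivWithinAt (fun r : ℝ => t + r) 1 (Set.Ici r) r :=
      ((hasDerivAt_id r).const_add t).hasDerivWithinAt
    have := (hasDerivWithinAt_interpolation hγ W ha hb).scomp r hi
      (fun x (hx : r ≤ x) => show t + r ≤ t + x by linarith)
    rw [one_smul] at this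
    exact this
  have hΦc : Continuous fun r => Φ r (interpolation γ W t) :=
    continuous_iff_continuousAt.2 fun r => (hΦ.orbit _ r).continuousAt
  have key := dist_le_of_approx_trajectories_ODE (v := fun _ => F) (fun _ => hF.lipschitzWith)
    hcomp hderiv
    (fun r hr => hslope _ (hν r hr.1).1 _ (hν r hr.1).2.1 (hν r hr.1).2.2)
    hΦc.continuousOn (fun r _ => (hΦ.orbit _ r).hasDerivWithinAt)
    (fun r _ => (dist_self _).le) (δ := 0) (by simp [hΦ.initial]) s hs
  refine key.trans (le_trans ?_ hη.le)
  rw [add_zero, sub_zero]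
  exact gronwallBound_mono le_rfl hη0.le (NNReal.coe_nonneg _) hs.2

end IsTameField

/-- The averages of `U` with weights given by the step-sizes `γ` vanish. -/
def AveragesToZero (γ : ℕ → ℝ) (U : ℕ → D) : Prop :=
  ∃ Z : ℕ → D, Tendsto Z atTop (𝓝 0) ∧ ∀ᶠ n in atTop, Z (n + 1) = Z n + γ n • (U n - Z n)

/-- Solve the recursion for `γ n • U n`: all other terms vanish. Single noisy increments are thus
negligible without any bound on `U n`. -/
lemma AveragesToZero.tendsto_smul {U : ℕ → D} (h : AveragesToZero γ U)
    (hγ : Tendsto γ atTop (𝓝 0)) : Tendsto (fun n => γ n • U n) atTop (𝓝 0) := by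
  obtain ⟨Z, hZ, hrec⟩ := h
  have h1 : Tendsto (fun n => Z (n + 1) - Z n + γ n • Z n) atTop (𝓝 0) := by
    simpa using ((hZ.comp (tendsto_add_atTop_nat 1)).sub hZ).add (hγ.smul hZ)
  refine h1.congr' ?_
  filter_upwards [hrec] with n hn
  rw [hn]
  module

lemma AveragesToZero.pi {ι : Type*} [Fintype ι] {E : ι → Type*} [∀ i, NormedAddCommGroup (E i)]
    [∀ i, NormedSpace ℝ (E i)] {U : ℕ → ∀ i, E i}
    (h : ∀ i, AveragesToZero γ (fun n => U n i)) : AveragesToZero γ U := by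
  choose Z hZ hrec using h
  refine ⟨fun n i => Z i n, tendsto_pi_nhds.2 hZ, ?_⟩
  filter_upwards [eventually_all.2 hrec] with n hn
  ext i
  exact hn i

/-! ### From vanishing noise averages to pseudotrajectories. -/

namespace IsTameField

variable {π : Seminorm ℝ D} {L G : ℝ} (hF : IsTameField F π L G)
include hF

lemma norm_le (y : D) : ‖F y‖ ≤ ‖F 0‖ + L * π y := by
  have h := hF.lipschitz y 0
  rw [sub_zero] at h
  have := norm_add_le (F 0) (F y - F 0)
  rw [add_sub_cancel] at this
  linarith

/-- In the seminorm, increments are eventually at most `γ n * (G + 1)`, so the growth is at most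
linear in time. With `norm_le` this bounds `F (W n)` in norm, although `F` need not be bounded in
norm. -/
lemma exists_growth (hγ : IsStepSize γ) {W b : ℕ → D} (hb : Tendsto b atTop (𝓝 0))
    (hW : ∀ᶠ n in atTop, W (n + 1) = W n + γ n • (F (W n) + b n)) :
    ∃ C, ∀ᶠ n in atTop, π (W n) ≤ C * (1 + effTime γ n) := by
  obtain ⟨m, hm⟩ := eventually_atTop.1 ((hW.and ((tendsto_zero_iff_norm_tendsto_zero.1
    hb).eventually_le_const one_pos)).and (eventually_ge_atTop 1))
  have hG : 0 ≤ G := (apply_nonneg π _).trans (hF.bounded 0)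
  -- The steps taken before stage `n` have sizes `γ m, …, γ (n - 1)`, whose sum is at most `τ (n -
  -- 1) = τ n - γ n`.
  have key : ∀ n, m ≤ n → π (W n) ≤ π (W m) + (G + 1) * (effTime γ n - γ n) := by
    intro n hn
    induction n, hn using Nat.le_induction with
    | base =>
      have h1 := (hm m le_rfl).2
      obtain ⟨k, rfl⟩ : ∃ k, m = k + 1 := ⟨m - 1, by omega⟩
      rw [effTime_succ, add_sub_cancel_right]
      have := mul_nonneg (show 0 ≤ G + 1 by linarith) (hγ.effTime_nonneg k)
      linarith
    | succ n hn ih =>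
      obtain ⟨⟨h1, h2⟩, h3⟩ := hm n hn
      have hp := hγ.pos n h3
      rw [h1, effTime_succ, add_sub_cancel_right]
      have h4 : π (W n + γ n • (F (W n) + b n)) ≤ π (W n) + γ n * (G + 1) := by
        refine (map_add_le_add π _ _).trans ?_
        rw [map_smul_eq_mul, Real.norm_of_nonneg hp.le]
        have := (map_add_le_add π (F (W n)) (b n)).trans
          (add_le_add (hF.bounded _) ((hF.le_norm _).trans h2))
        gcongr
      linarith
  refine ⟨π (W m) + (G + 1), eventually_atTop.2 ⟨m, fun n hn => ?_⟩⟩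
  have h1 := key n hn
  have h2 := hγ.pos n (hm n hn).2
  have h3 := mul_nonneg (show 0 ≤ G + 1 by linarith) h2.le
  have h4 := mul_nonneg (apply_nonneg π (W m)) (hγ.effTime_nonneg n)
  linarith

/-- The slope is `(γ n / γ (n + 1)) • (F (W n) + b n)`. The excess of the ratio over `1` multiplies
a field of order `1 + τ n`, which is what `slow` compensates. -/
lemma tendsto_slope_sub (hγ : IsStepSize γ) {W b : ℕ → D} (hb : Tendsto b atTop (𝓝 0))
    (hW : ∀ᶠ n in atTop, W (n + 1) = W n + γ n • (F (W n) + b n)) :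
    Tendsto (fun n => slope γ W n - F (W n)) atTop (𝓝 0) := by
  obtain ⟨C, hC⟩ := hF.exists_growth hγ hb hW
  set A : ℝ := ‖F 0‖ + L * |C| with hA
  have hbound : ∀ᶠ n in atTop, ‖F (W n)‖ ≤ A * (1 + effTime γ n) := by
    filter_upwards [hC] with n hn
    have h1 := hγ.effTime_nonneg n
    have h2 : π (W n) ≤ |C| * (1 + effTime γ n) :=
      hn.trans (mul_le_mul_of_nonneg_right (le_abs_self C) (by linarith))
    have h3 := hF.norm_le (W n)
    have h4 := mul_le_mul_of_nonneg_left h2 hF.nonneg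
    have h5 := mul_nonneg (norm_nonneg (F 0)) h1
    rw [hA]
    linarith
  have hρ : Tendsto (fun n => γ n / γ (n + 1)) atTop (𝓝 1) := by
    have : Tendsto (fun n => γ n / γ (n + 1) - 1) atTop (𝓝 0) := by
      refine squeeze_zero_norm (fun n => ?_) (tendsto_zero_iff_norm_tendsto_zero.1 hγ.slow)
      rw [norm_mul]
      refine le_mul_of_one_le_right (norm_nonneg _) ?_
      have := hγ.effTime_nonneg n
      rw [Real.norm_of_nonneg] <;> linarith
    simpa using this.add_const 1
  have h1 : Tendsto (fun n => (γ n / γ (n + 1) - 1) • F (W n)) atTop (𝓝 0) := by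
    have hlim : Tendsto (fun n => ‖(γ n / γ (n + 1) - 1) * (1 + effTime γ n)‖ * A) atTop (𝓝 0) := by
      simpa using (tendsto_zero_iff_norm_tendsto_zero.1 hγ.slow).mul_const A
    refine squeeze_zero_norm' ?_ hlim
    filter_upwards [hbound] with n hn
    have := hγ.effTime_nonneg n
    rw [norm_smul, norm_mul, Real.norm_of_nonneg (show 0 ≤ 1 + effTime γ n by linarith), mul_assoc,
      mul_comm _ A]
    gcongr
  have h2 : Tendsto (fun n => (γ n / γ (n + 1) - 1) • F (W n) + (γ n / γ (n + 1)) • b n) atTop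
      (𝓝 0) := by
    simpa using h1.add (hρ.smul hb)
  refine h2.congr' ?_
  filter_upwards [hW] with n hn
  rw [slope, hn, add_sub_cancel_left, smul_smul, inv_mul_eq_div]
  module

/-- A stochastic approximation with vanishing noise averages and vanishing bias is an asymptotic
pseudotrajectory. -/
theorem isAPT [CompleteSpace D] (hγ : IsStepSize γ) {Y U b : ℕ → D}
    (hU : AveragesToZero γ U) (hb : Tendsto b atTop (𝓝 0))
    (hY : ∀ᶠ n in atTop, Y (n + 1) = Y n + γ n • (F (Y n) + U n + b n)) : IsAPT F γ Y := by
  obtain ⟨Φ, hΦ⟩ := exists_isFlow hF.lipschitzWith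
  obtain ⟨Z, hZ, hrec⟩ := hU
  -- Subtracting the averages cancels `γ n • U n`; what remains of them is `γ n • Z n` and the
  -- change of `F` from `Y n` to `W n`, both collected in `b'`.
  set W : ℕ → D := fun n => Y n - Z n with hWdef
  set b' : ℕ → D := fun n => (F (Y n) - F (W n)) + Z n + b n with hb'def
  have hb' : Tendsto b' atTop (𝓝 0) := by
    have h1 : Tendsto (fun n => F (Y n) - F (W n)) atTop (𝓝 0) := by
      have h2 : Tendsto (fun n => L * ‖Z n‖) atTop (𝓝 0) := by
        simpa using (tendsto_zero_iff_norm_tendsto_zero.1 hZ).const_mul L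
      refine squeeze_zero_norm (fun n => (hF.lipschitz _ _).trans ?_) h2
      refine mul_le_mul_of_nonneg_left ((hF.le_norm _).trans_eq ?_) hF.nonneg
      rw [hWdef, sub_sub_cancel]
    simpa using (h1.add hZ).add hb
  have hW : ∀ᶠ n in atTop, W (n + 1) = W n + γ n • (F (W n) + b' n) := by
    filter_upwards [hrec, hY] with n h1 h2
    simp only [hWdef, hb'def, h1, h2]
    module
  have hs := hF.tendsto_slope_sub hγ hb' hW
  have hs2 : Tendsto (fun n => γ (n + 1) * π (slope γ W n)) atTop (𝓝 0) := by
    have hlim : Tendsto (fun n => γ (n + 1) * (G + ‖slope γ W n - F (W n)‖)) atTop (𝓝 0) := by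
      simpa using (hγ.tendsto_zero.comp (tendsto_add_atTop_nat 1)).mul
        ((tendsto_zero_iff_norm_tendsto_zero.1 hs).const_add G)
    refine squeeze_zero (fun n => ?_) (fun n => ?_) hlim
    · exact mul_nonneg (hγ.pos _ (by omega)).le (apply_nonneg π _)
    · have hp := hγ.pos (n + 1) (by omega)
      have := (map_add_le_add π (F (W n)) (slope γ W n - F (W n))).trans
        (add_le_add (hF.bounded _) (hF.le_norm _))
      rw [add_sub_cancel] at this
      gcongr
  have hYW : Tendsto (fun n => Y n - W n) atTop (𝓝 0) := by
    simpa [hWdef] using hZ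
  refine ⟨Φ, hΦ, fun T hT => ENNReal.tendsto_nhds_zero.2 fun ε hε => ?_⟩
  obtain ⟨e, he0, heε⟩ : ∃ e : ℝ, 0 < e ∧ ENNReal.ofReal e ≤ ε := by
    rcases eq_or_ne ε ∞ with h | h
    · exact ⟨1, one_pos, h ▸ le_top⟩
    · exact ⟨ε.toReal, ENNReal.toReal_pos hε.ne' h, (ENNReal.ofReal_toReal h).le⟩
  set E : ℝ := Real.exp (L.toNNReal * T) with hE
  have hEpos : 0 < E := Real.exp_pos _
  -- The gap between the interpolations of `Y` and `W` counts twice: directly at time `t + s`, and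
  -- at time `t` after expansion by the flow, by a factor of at most `E`.
  have hη : 0 < min (e / 3) (e / 3 / E) := by positivity
  have hev := eventually_dist_interpolation_le hγ hYW hη
  obtain ⟨t0, ht0⟩ := eventually_atTop.1 hev
  filter_upwards [eventually_ge_atTop t0,
    hF.eventually_dist_flow_le hγ hΦ hs hs2 T (show 0 < e / 3 by positivity)] with t h1 h2
  refine iSup₂_le fun s hsT => le_trans ?_ heε
  rw [edist_dist]
  refine ENNReal.ofReal_le_ofReal ?_
  have ha := (ht0 (t + s) (by linarith [hsT.1])).trans (min_le_left _ _)
  have hb := h2 s hsT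
  have hc := hΦ.dist_le hF.lipschitzWith (interpolation γ W t) (interpolation γ Y t) hsT.1
  have hd : dist (interpolation γ W t) (interpolation γ Y t) * Real.exp (L.toNNReal * s) ≤
      e / 3 := by
    rw [dist_comm]
    calc dist (interpolation γ Y t) (interpolation γ W t) * Real.exp (L.toNNReal * s)
        ≤ (e / 3 / E) * E := by
          gcongr
          · exact (ht0 t h1).trans (min_le_right _ _)
          · exact Real.exp_le_exp.2 (mul_le_mul_of_nonneg_left hsT.2 (NNReal.coe_nonneg _))
      _ = e / 3 := by field_simp
  have htri := dist_triangle4 (interpolation γ Y (t + s)) (interpolation γ W (t + s))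
    (Φ s (interpolation γ W t)) (Φ s (interpolation γ Y t))
  linarith

end IsTameField

end Pseudotrajectory

/-! ### Polynomial schedules -/

lemma effTime_eq_sum_range (γ : ℕ → ℝ) (n : ℕ) :
    effTime γ n = ∑ k ∈ Finset.range n, γ (k + 1) := by
  induction n with
  | zero => simp [effTime_zero]
  | succ n ih => rw [effTime_succ, ih, Finset.sum_range_succ]

lemma schedule_pos {c p : ℝ} (hc : 0 < c) {n : ℕ} (hn : 1 ≤ n) : 0 < schedule c p n := by
  have : (0 : ℝ) < n := by exact_mod_cast hn
  unfold schedule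
  positivity

lemma tendsto_schedule {p : ℝ} (c : ℝ) (hp : 0 < p) :
    Tendsto (schedule c p) atTop (𝓝 0) :=
  ((tendsto_rpow_atTop hp).comp tendsto_natCast_atTop_atTop).const_div_atTop c

lemma schedule_succ_le {c p : ℝ} (hc : 0 < c) (hp : 0 ≤ p) {n : ℕ} (hn : 1 ≤ n) :
    schedule c p (n + 1) ≤ schedule c p n := by
  have : (0 : ℝ) < n := by exact_mod_cast hn
  unfold schedule
  gcongr
  simp

lemma isStepSize_schedule {c p : ℝ} (hc : 0 < c) (hp0 : 0 < p) (hp1 : p ≤ 1) :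
    IsStepSize (schedule c p) := by
  have hz := tendsto_schedule c hp0
  have hτ : Tendsto (effTime (schedule c p)) atTop atTop := by
    have h1 : ¬ Summable (schedule c p) := by
      intro h
      have h2 := h.mul_left c⁻¹
      have h3 : (fun n : ℕ => c⁻¹ * schedule c p n) = fun n : ℕ => 1 / (n : ℝ) ^ p := by
        ext n
        rw [schedule, mul_div, inv_mul_cancel₀ hc.ne']
      rw [h3, Real.summable_one_div_nat_rpow] at h2
      linarith
    rw [← summable_nat_add_iff 1, not_summable_iff_tendsto_nat_atTop_of_nonneg
      fun n => (schedule_pos hc (by omega)).le] at h1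
    exact h1.congr fun n => (effTime_eq_sum_range _ n).symm
  refine ⟨fun n hn => schedule_pos hc hn, hz, hτ, ?_⟩
  -- Up to `1 / n`, this is a Cesàro mean of vanishing step-sizes; and `γ n / γ (n + 1) - 1 ≤ 1 / n`
  -- because `p ≤ 1`.
  have hces : Tendsto (fun n : ℕ => (n : ℝ)⁻¹ * (1 + effTime (schedule c p) n)) atTop (𝓝 0) := by
    have h1 := (hz.comp (tendsto_add_atTop_nat 1)).cesaro
    have h2 := (tendsto_inv_atTop_nhds_zero_nat (𝕜 := ℝ)).add h1
    rw [add_zero] at h2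
    refine h2.congr fun n => ?_
    rw [effTime_eq_sum_range, mul_add, mul_one]
    rfl
  refine squeeze_zero' ?_ ?_ hces
  all_goals filter_upwards [eventually_ge_atTop 1, hτ.eventually_ge_atTop 0] with n hn hτn
  all_goals
    have hn' : (0 : ℝ) < n := by exact_mod_cast hn
    have hρ : schedule c p n / schedule c p (n + 1) = (1 + (n : ℝ)⁻¹) ^ p := by
      have h1 : 1 + (n : ℝ)⁻¹ = (n + 1) / n := by field_simp
      rw [h1, Real.div_rpow (by positivity) hn'.le, schedule, schedule]
      push_cast
      field_simp
    rw [hρ]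
  · have : 1 ≤ (1 + (n : ℝ)⁻¹) ^ p :=
      Real.one_le_rpow (by simp) hp0.le
    exact mul_nonneg (by linarith) (by linarith)
  · have : (1 + (n : ℝ)⁻¹) ^ p ≤ 1 + (n : ℝ)⁻¹ := by
      simpa using Real.rpow_le_rpow_of_exponent_le (x := 1 + (n : ℝ)⁻¹) (by simp) hp1
    exact mul_le_mul_of_nonneg_right (by linarith) (by linarith)

/-! ### Moment inequalities -/

/-- Bernoulli's inequality covers exponents at most `1`; multiplying by `1 + w` raises the exponent
by one, the cubic term being absorbed through `w ≤ 3`. The interval `[-1, 3]` is the range of `2 * r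
+ r ^ 2` for `|r| ≤ 1`. -/
lemma exists_one_add_rpow_le (s : ℝ) (hs : 1 ≤ s) : ∃ C : ℝ, 0 ≤ C ∧
    ∀ w : ℝ, -1 ≤ w → w ≤ 3 → (1 + w) ^ s ≤ 1 + s * w + C * w ^ 2 := by
  have hrec : ∀ (t C : ℝ), 0 ≤ t → 0 ≤ C →
      (∀ w : ℝ, -1 ≤ w → w ≤ 3 → (1 + w) ^ t ≤ 1 + t * w + C * w ^ 2) →
      ∀ w : ℝ, -1 ≤ w → w ≤ 3 → (1 + w) ^ (t + 1) ≤ 1 + (t + 1) * w + (t + 4 * C) * w ^ 2 := by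
    intro t C ht hC h w h1 h3
    rw [Real.rpow_add_one' (by linarith) (by linarith)]
    have h4 := mul_le_mul_of_nonneg_right (h w h1 h3) (show 0 ≤ 1 + w by linarith)
    have h5 : 0 ≤ C * w ^ 2 * (3 - w) := mul_nonneg (by positivity) (by linarith)
    nlinarith
  have key : ∀ n : ℕ, ∀ t : ℝ, 0 ≤ t → t ≤ n + 1 → ∃ C : ℝ, 0 ≤ C ∧
      ∀ w : ℝ, -1 ≤ w → w ≤ 3 → (1 + w) ^ t ≤ 1 + t * w + C * w ^ 2 := by
    intro n
    induction n with
    | zero =>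
      intro t h0 h1
      refine ⟨0, le_rfl, fun w hw _ => ?_⟩
      have := rpow_one_add_le_one_add_mul_self hw h0 (by simpa using h1)
      linarith
    | succ n ih =>
      intro t h0 h1
      rcases le_or_gt t 1 with h | h
      · exact ih t h0 (by have : (0 : ℝ) ≤ n := by positivity
                          linarith)
      · push_cast at h1
        obtain ⟨C, hC, hw⟩ := ih (t - 1) (by linarith) (by linarith)
        refine ⟨t - 1 + 4 * C, by linarith, ?_⟩
        have := hrec (t - 1) C (by linarith) hC hw
        simpa using this
  obtain ⟨n, hn⟩ := exists_nat_ge s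
  exact key n s (by linarith) (by linarith)

/-- For `|r| ≤ 1`, take the power `q / 2` of `(1 + r) ^ 2 = 1 + (2 * r + r ^ 2)`; for `|r| > 1`
every term is dominated by `|r| ^ q`. -/
lemma exists_abs_one_add_rpow_le (q : ℝ) (hq : 2 ≤ q) : ∃ C : ℝ, 1 ≤ C ∧
    ∀ r : ℝ, |1 + r| ^ q ≤ 1 + q * r + C * (r ^ 2 + |r| ^ q) := by
  obtain ⟨C, hC, h⟩ := exists_one_add_rpow_le (q / 2) (by linarith)
  have h2q : (1 : ℝ) ≤ 2 ^ q := Real.one_le_rpow (by norm_num) (by linarith)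
  refine ⟨(q / 2 + 9 * C) + (2 ^ q + q), by linarith, fun r => ?_⟩
  have hr0 : 0 ≤ |r| ^ q := by positivity
  rcases le_or_gt |r| 1 with hr | hr
  · have hr' := abs_le.1 hr
    have h1 := h (2 * r + r ^ 2) (by nlinarith [sq_nonneg (r + 1)]) (by nlinarith)
    have h2 : |1 + r| ^ q = (1 + (2 * r + r ^ 2)) ^ (q / 2) := by
      rw [show 1 + (2 * r + r ^ 2) = |1 + r| ^ (2 : ℝ) by
        rw [Real.rpow_two, sq_abs]; ring, ← Real.rpow_mul (abs_nonneg _)]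
      congr 1
      ring
    have h3 : (2 * r + r ^ 2) ^ 2 ≤ 9 * r ^ 2 := by
      have : (2 + r) ^ 2 ≤ 9 := by nlinarith
      calc (2 * r + r ^ 2) ^ 2 = (2 + r) ^ 2 * r ^ 2 := by ring
        _ ≤ 9 * r ^ 2 := by gcongr
    rw [h2]
    have h4 : C * (2 * r + r ^ 2) ^ 2 ≤ C * (9 * r ^ 2) := by gcongr
    have h5 : 0 ≤ (q / 2 + 9 * C) * |r| ^ q := by positivity
    have h6 : 0 ≤ (2 ^ q + q) * (r ^ 2 + |r| ^ q) := by positivity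
    nlinarith
  · have h1 : |1 + r| ^ q ≤ 2 ^ q * |r| ^ q := by
      rw [← Real.mul_rpow (by norm_num) (abs_nonneg _)]
      refine Real.rpow_le_rpow (abs_nonneg _) ?_ (by linarith)
      have := abs_add_le 1 r
      rw [abs_one] at this
      linarith
    have h2 : |r| ≤ |r| ^ q := by
      simpa using Real.rpow_le_rpow_of_exponent_le hr.le (show (1 : ℝ) ≤ q by linarith)
    have h3 : -(q * r) ≤ q * |r| ^ q := by
      have := neg_abs_le r
      nlinarith
    have h4 : 0 ≤ (q / 2 + 9 * C) * (r ^ 2 + |r| ^ q) := by positivity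
    have h5 : 0 ≤ (2 ^ q + q) * r ^ 2 := by positivity
    nlinarith

/-- Homogeneous form of the preceding inequality, with `r = h / x`; the point `x = 0` is treated
apart. -/
lemma exists_abs_add_rpow_le (q : ℝ) (hq : 2 ≤ q) : ∃ C : ℝ, 1 ≤ C ∧
    ∀ x h : ℝ, |x + h| ^ q ≤
      |x| ^ q + q * (|x| ^ (q - 2) * x) * h + C * (|x| ^ (q - 2) * h ^ 2 + |h| ^ q) := by
  obtain ⟨C, hC, H⟩ := exists_abs_one_add_rpow_le q hq
  refine ⟨C, hC, fun x h => ?_⟩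
  rcases eq_or_ne x 0 with rfl | hx
  · have h1 : 0 ≤ |h| ^ q := by positivity
    have h2 : 0 ≤ |(0 : ℝ)| ^ (q - 2) * h ^ 2 := by positivity
    have h3 : |(0 : ℝ)| ^ q = 0 := by rw [abs_zero, Real.zero_rpow (by linarith)]
    rw [zero_add, h3]
    nlinarith
  · have h1 := mul_le_mul_of_nonneg_left (H (h / x)) (show 0 ≤ |x| ^ q by positivity)
    have hxp : 0 < |x| := abs_pos.2 hx
    have h2 : |x| ^ q * |1 + h / x| ^ q = |x + h| ^ q := by
      rw [← Real.mul_rpow (abs_nonneg _) (abs_nonneg _), ← abs_mul]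
      congr 2
      field_simp
    have h3 : |x| ^ q * |h / x| ^ q = |h| ^ q := by
      rw [← Real.mul_rpow (abs_nonneg _) (abs_nonneg _), ← abs_mul]
      congr 2
      field_simp
    have h4 : |x| ^ q = |x| ^ (q - 2) * x ^ 2 := by
      rw [← sq_abs x, ← Real.rpow_two |x|, ← Real.rpow_add hxp]
      congr 1
      ring
    calc |x + h| ^ q = |x| ^ q * |1 + h / x| ^ q := h2.symm
      _ ≤ _ := h1
      _ = |x| ^ q + |x| ^ q * (q * (h / x)) + C * (|x| ^ q * (h / x) ^ 2 +
          |x| ^ q * |h / x| ^ q) := by ring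
      _ = _ := by
        rw [h3]
        nth_rewrite 2 [h4]
        nth_rewrite 2 [h4]
        field_simp

/-- Either `2 * C * b ^ 2 ≤ a ^ 2`, and the term in `a` absorbs everything, or `a ≤ √(2 * C) * b`,
and the term in `b` does. -/
lemma exists_young (q C : ℝ) (hq : 2 ≤ q) (hC : 0 < C) : ∃ C' : ℝ, 0 ≤ C' ∧
    ∀ a b : ℝ, 0 ≤ a → 0 ≤ b → C * (a ^ (q - 2) * b ^ 2) ≤ 1 / 2 * a ^ q + C' * b ^ q := by
  have hsplit : ∀ a : ℝ, 0 ≤ a → a ^ q = a ^ (q - 2) * a ^ 2 := by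
    intro a ha
    rw [← Real.rpow_two a, ← Real.rpow_add_of_nonneg ha (by linarith) (by norm_num)]
    congr 1
    ring
  refine ⟨C * √(2 * C) ^ (q - 2), by positivity, fun a b ha hb => ?_⟩
  rcases le_or_gt (2 * C * b ^ 2) (a ^ 2) with h | h
  · rw [hsplit a ha]
    have h1 : 0 ≤ a ^ (q - 2) := by positivity
    have h2 : 0 ≤ C * √(2 * C) ^ (q - 2) * b ^ q := by positivity
    nlinarith
  · have h1 : a ≤ √(2 * C) * b := by
      refine le_of_sq_le_sq ?_ (by positivity)
      rw [mul_pow, Real.sq_sqrt (by positivity)]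
      exact h.le
    have h2 : a ^ (q - 2) ≤ √(2 * C) ^ (q - 2) * b ^ (q - 2) := by
      rw [← Real.mul_rpow (by positivity) hb]
      exact Real.rpow_le_rpow ha h1 (by linarith)
    have h3 : 0 ≤ a ^ q := by positivity
    rw [hsplit b hb]
    have h4 := mul_le_mul_of_nonneg_left h2 (show 0 ≤ C * b ^ 2 by positivity)
    nlinarith

/-- One step of the averaging recursion contracts `q`-th powers up to a linear term and a small
remainder. -/
lemma exists_average_rpow_le (q : ℝ) (hq : 2 ≤ q) : ∃ C : ℝ, 0 ≤ C ∧
    ∀ γ z u : ℝ, 0 ≤ γ → γ ≤ 1 → |z + γ * (u - z)| ^ q ≤ (1 - γ / 2) * |z| ^ q +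
      q * (|(1 - γ) * z| ^ (q - 2) * ((1 - γ) * z)) * γ * u + C * γ ^ (1 + q / 2) * |u| ^ q := by
  obtain ⟨C, hC, H⟩ := exists_abs_add_rpow_le q hq
  obtain ⟨C', hC', H'⟩ := exists_young q C hq (by linarith)
  refine ⟨C' + C, by linarith, fun γ z u h0 h1 => ?_⟩
  set x : ℝ := (1 - γ) * z with hx
  have e1 : z + γ * (u - z) = x + γ * u := by rw [hx]; ring
  have e2 : |x| ^ q ≤ (1 - γ) * |z| ^ q := by
    rw [hx, abs_mul, Real.mul_rpow (abs_nonneg _) (abs_nonneg _), abs_of_nonneg (by linarith)]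
    refine mul_le_mul_of_nonneg_right ?_ (by positivity)
    exact Real.rpow_le_self_of_le_one (by linarith) (by linarith) (by linarith)
  have e3 := H x (γ * u)
  -- The quadratic term is `γ` times `|x| ^ (q - 2) * (√γ * |u|) ^ 2`. Young's inequality spends
  -- half of the contraction `γ * |z| ^ q` on it and leaves `γ ^ (1 + q / 2) * |u| ^ q`, the source
  -- of the threshold `2 / (2 + q)`.
  have e4 := H' |x| (√γ * |u|) (abs_nonneg _) (by positivity)
  have e5 : (√γ * |u|) ^ q = γ ^ (q / 2) * |u| ^ q := by
    rw [Real.mul_rpow (by positivity) (abs_nonneg _), Real.sqrt_eq_rpow, ← Real.rpow_mul h0]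
    congr 2
    ring
  have e6 : (√γ * |u|) ^ 2 = γ * u ^ 2 := by rw [mul_pow, Real.sq_sqrt h0, sq_abs]
  have e7 : γ ^ (1 + q / 2) = γ * γ ^ (q / 2) := by
    rw [Real.rpow_add_of_nonneg h0 (by norm_num) (by linarith), Real.rpow_one]
  have e8 : |γ * u| ^ q ≤ γ ^ (1 + q / 2) * |u| ^ q := by
    rw [abs_mul, Real.mul_rpow (abs_nonneg _) (abs_nonneg _), abs_of_nonneg h0]
    refine mul_le_mul_of_nonneg_right ?_ (by positivity)
    exact Real.rpow_le_rpow_of_exponent_ge_of_imp h0 h1 (by linarith)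
      fun _ h => by linarith
  rw [e5, e6] at e4
  have e9 := mul_le_mul_of_nonneg_left e4 h0
  have e10 := mul_le_mul_of_nonneg_left e8 (show 0 ≤ C by linarith)
  have e11 : 0 ≤ |z| ^ q := by positivity
  have e12 : γ * |x| ^ q ≤ γ * |z| ^ q := by
    refine mul_le_mul_of_nonneg_left (e2.trans ?_) h0
    nlinarith
  rw [e1]
  rw [e7] at e10 ⊢
  rw [mul_pow] at e3
  linarith

/-! ### Vanishing of noise averages -/

section Noise

variable {Ω : Type*} {m : MeasurableSpace Ω} {μ : Measure Ω} [IsProbabilityMeasure μ]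

/-- A contracting stochastic recursion with summable errors converges to zero. -/
lemma ae_tendsto_zero_of_condExp_le (ℱ : Filtration ℕ m) {V : ℕ → Ω → ℝ} {θ e : ℕ → ℝ}
    (hV0 : ∀ n ω, 0 ≤ V n ω) (hVm : ∀ n, StronglyMeasurable[ℱ n] (V n))
    (hVi : ∀ n, Integrable (V n) μ) (hθ0 : ∀ n, 0 ≤ θ n) (hθ : ¬ Summable θ)
    (he0 : ∀ n, 0 ≤ e n) (he : Summable e)
    (hrec : ∀ n, μ[V (n + 1) | ℱ n] ≤ᵐ[μ] fun ω => (1 - θ n) * V n ω + e n) :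
    ∀ᵐ ω ∂μ, Tendsto (fun n => V n ω) atTop (𝓝 0) := by
  set S : ℝ := ∑' k, e k with hS
  have hpart : ∀ n, ∑ k ∈ Finset.range n, e k ≤ S := fun n => he.sum_le_tsum _ fun k _ => he0 k
  have hmean : ∀ n, ∫ ω, V (n + 1) ω ∂μ + θ n * ∫ ω, V n ω ∂μ ≤ ∫ ω, V n ω ∂μ + e n := by
    intro n
    have h1 : ∫ ω, (μ[V (n + 1) | ℱ n]) ω ∂μ ≤ ∫ ω, ((1 - θ n) * V n ω + e n) ∂μ :=
      integral_mono_ae integrable_condExp (((hVi n).const_mul _).add (integrable_const _)) (hrec n)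
    rw [integral_condExp (ℱ.le n), integral_add ((hVi n).const_mul _) (integrable_const _),
      integral_const_mul, integral_const, probReal_univ, one_smul] at h1
    linarith
  -- Telescoping the means bounds them uniformly and makes `θ n * E[V n]` summable.
  have hsum : ∀ n, ∫ ω, V n ω ∂μ + ∑ k ∈ Finset.range n, θ k * ∫ ω, V k ω ∂μ ≤
      ∫ ω, V 0 ω ∂μ + ∑ k ∈ Finset.range n, e k := by
    intro n
    induction n with
    | zero => simp
    | succ n ih =>
      rw [Finset.sum_range_succ, Finset.sum_range_succ]
      linarith [hmean n]
  have hVint0 : ∀ n, 0 ≤ ∫ ω, V n ω ∂μ := fun n => integral_nonneg (hV0 n)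
  have hsumθ : Summable fun n => θ n * ∫ ω, V n ω ∂μ :=
    summable_of_sum_range_le (c := ∫ ω, V 0 ω ∂μ + S)
      (fun n => mul_nonneg (hθ0 n) (hVint0 n))
      fun n => by linarith [hsum n, hVint0 n, hpart n]
  -- the compensated process is a supermartingale
  set W : ℕ → Ω → ℝ := fun n ω => V n ω - ∑ k ∈ Finset.range n, e k with hW
  have hWi : ∀ n, Integrable (W n) μ := fun n => (hVi n).sub (integrable_const _)
  have hsuper : Supermartingale W ℱ μ := by
    refine supermartingale_nat (fun n => (hVm n).sub stronglyMeasurable_const) hWi fun n => ?_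
    have h1 : μ[W (n + 1) | ℱ n] =ᵐ[μ] μ[V (n + 1) | ℱ n] -
        μ[fun _ => ∑ k ∈ Finset.range (n + 1), e k | ℱ n] :=
      condExp_sub (hVi (n + 1)) (integrable_const _) (ℱ n)
    rw [condExp_const (ℱ.le n)] at h1
    filter_upwards [h1, hrec n] with ω h1 h2
    rw [h1, Pi.sub_apply, Finset.sum_range_succ]
    have := mul_nonneg (hθ0 n) (hV0 n ω)
    simp only [hW]
    linarith
  have hbdd : ∀ n, eLpNorm ((-W) n) 1 μ ≤ ((∫ ω, V 0 ω ∂μ + S + S).toNNReal : ℝ≥0∞) := by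
    intro n
    rw [Pi.neg_apply, eLpNorm_neg, eLpNorm_one_eq_lintegral_enorm,
      ← ofReal_integral_norm_eq_lintegral_enorm (hWi n)]
    refine ENNReal.ofReal_le_ofReal ?_
    have h1 : ∫ ω, ‖W n ω‖ ∂μ ≤ ∫ ω, (V n ω + S) ∂μ := by
      refine integral_mono (hWi n).norm ((hVi n).add (integrable_const _)) fun ω => ?_
      have h2 := hV0 n ω
      have h3 : 0 ≤ ∑ k ∈ Finset.range n, e k := Finset.sum_nonneg fun k _ => he0 k
      have h4 := hpart n
      simp only [hW, Real.norm_eq_abs]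
      rw [abs_le]
      constructor <;> linarith
    rw [integral_add (hVi n) (integrable_const _), integral_const, probReal_univ, one_smul] at h1
    have h2 : 0 ≤ ∑ k ∈ Finset.range n, θ k * ∫ ω, V k ω ∂μ :=
      Finset.sum_nonneg fun k _ => mul_nonneg (hθ0 k) (hVint0 k)
    linarith [hsum n, hpart n]
  have hconv := hsuper.neg.exists_ae_tendsto_of_bdd hbdd
  -- So `∑ θ n * V n` is finite almost surely; since `∑ θ n` diverges, the limit of `V n` given by
  -- supermartingale convergence cannot be positive.
  have hfin : ∀ᵐ ω ∂μ, ∑' n, ENNReal.ofReal (θ n * V n ω) ≠ ∞ := by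
    have hmeas : ∀ n, AEMeasurable (fun ω => ENNReal.ofReal (θ n * V n ω)) μ := fun n =>
      ((hVi n).const_mul (θ n)).aestronglyMeasurable.aemeasurable.ennreal_ofReal
    have h1 : ∫⁻ ω, ∑' n, ENNReal.ofReal (θ n * V n ω) ∂μ ≠ ∞ := by
      rw [lintegral_tsum hmeas]
      have h2 : ∀ n, ∫⁻ ω, ENNReal.ofReal (θ n * V n ω) ∂μ =
          ENNReal.ofReal (θ n * ∫ ω, V n ω ∂μ) := by
        intro n
        rw [← integral_const_mul, ofReal_integral_eq_lintegral_ofReal ((hVi n).const_mul _)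
          (ae_of_all _ fun ω => mul_nonneg (hθ0 n) (hV0 n ω))]
      simp_rw [h2]
      exact hsumθ.tsum_ofReal_ne_top
    exact (ae_lt_top' (AEMeasurable.tsum hmeas) h1).mono fun ω h => h.ne
  filter_upwards [hconv, hfin] with ω ⟨a, h1⟩ h2
  set ℓ : ℝ := -a + S with hℓ
  have hlim : Tendsto (fun n => V n ω) atTop (𝓝 ℓ) := by
    have h3 := h1.neg.add he.hasSum.tendsto_sum_nat
    refine h3.congr fun n => ?_
    simp [hW]
  have hsm : Summable fun n => θ n * V n ω := by
    refine (ENNReal.summable_toReal h2).congr fun n => ?_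
    rw [ENNReal.toReal_ofReal (mul_nonneg (hθ0 n) (hV0 n ω))]
  have hℓ0 : 0 ≤ ℓ := ge_of_tendsto' hlim fun n => hV0 n ω
  rcases hℓ0.eq_or_lt with h | h
  · rwa [← h] at hlim
  · exfalso
    apply hθ
    refine Summable.of_norm_bounded_eventually_nat (hsm.mul_left (2 / ℓ)) ?_
    filter_upwards [hlim.eventually_const_le (half_lt_self h)] with n hn
    rw [Real.norm_of_nonneg (hθ0 n)]
    have h4 := mul_le_mul_of_nonneg_left hn (hθ0 n)
    calc θ n = 2 / ℓ * (θ n * (ℓ / 2)) := by field_simp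
      _ ≤ 2 / ℓ * (θ n * V n ω) := by gcongr

/-- Recursive averages of a real-valued martingale difference sequence vanish. -/
lemma ae_tendsto_average_zero (ℱ : Filtration ℕ m) {γ β : ℕ → ℝ} {U Z : ℕ → Ω → ℝ} {q : ℝ}
    (hq : 2 ≤ q) (hγ0 : ∀ n, 0 ≤ γ n) (hγ1 : ∀ n, γ n ≤ 1) (hγ : ¬ Summable γ)
    (hU : ∀ n, StronglyMeasurable[ℱ (n + 1)] (U n)) (hLp : ∀ n, MemLp (U n) (ENNReal.ofReal q) μ)
    (hmean : ∀ n, μ[U n | ℱ n] =ᵐ[μ] 0)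
    (hmom : ∀ n, μ[fun ω => |U n ω| ^ q | ℱ n] ≤ᵐ[μ] fun _ => β n)
    (hβ0 : ∀ n, 0 ≤ β n) (hβ : Summable fun n => γ n ^ (1 + q / 2) * β n)
    (hZ0 : ∀ ω, Z 0 ω = 0) (hZ : ∀ n ω, Z (n + 1) ω = Z n ω + γ n * (U n ω - Z n ω)) :
    ∀ᵐ ω ∂μ, Tendsto (fun n => Z n ω) atTop (𝓝 0) := by
  obtain ⟨C, hC, H⟩ := exists_average_rpow_le q hq
  have hq0 : ENNReal.ofReal q ≠ 0 := by simpa using by linarith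
  have hqr : (ENNReal.ofReal q).toReal = q := ENNReal.toReal_ofReal (by linarith)
  have hq1 : 1 ≤ ENNReal.ofReal q := by
    rw [← ENNReal.ofReal_one]; exact ENNReal.ofReal_le_ofReal (by linarith)
  have hZs : ∀ n, Z (n + 1) = Z n + γ n • (U n - Z n) := fun n => funext fun ω => hZ n ω
  have hZm : ∀ n, StronglyMeasurable[ℱ n] (Z n) := by
    intro n
    induction n with
    | zero => rw [show Z 0 = fun _ => 0 from funext hZ0]; exact stronglyMeasurable_const
    | succ n ih =>
      have := ih.mono (ℱ.mono n.le_succ)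
      rw [hZs]
      exact this.add (((hU n).sub this).const_smul (γ n))
  have hZp : ∀ n, MemLp (Z n) (ENNReal.ofReal q) μ := by
    intro n
    induction n with
    | zero => rw [show Z 0 = fun _ => 0 from funext hZ0]; exact MemLp.zero'
    | succ n ih => rw [hZs]; exact ih.add (((hLp n).sub ih).const_smul (γ n))
  have hpow : ∀ {f : Ω → ℝ}, MemLp f (ENNReal.ofReal q) μ → Integrable (fun ω => |f ω| ^ q) μ := by
    intro f hf
    have := hf.integrable_norm_rpow hq0 ENNReal.ofReal_ne_top
    simpa [hqr] using this
  have hmpow : Measurable fun x : ℝ => |x| ^ q := by fun_prop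
  have hVm : ∀ n, StronglyMeasurable[ℱ n] fun ω => |Z n ω| ^ q := fun n =>
    (hmpow.comp (hZm n).measurable).stronglyMeasurable
  have hlim := ae_tendsto_zero_of_condExp_le (μ := μ) ℱ (V := fun n ω => |Z n ω| ^ q)
    (θ := fun n => γ n / 2)
    (e := fun n => C * (γ n ^ (1 + q / 2) * β n)) (fun n ω => by positivity) hVm
    (fun n => hpow (hZp n)) (fun n => by have := hγ0 n; positivity)
    (fun h => hγ (by simpa using h.mul_right 2))
    (fun n => mul_nonneg hC (mul_nonneg (Real.rpow_nonneg (hγ0 n) _) (hβ0 n))) (hβ.mul_left C) ?_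
  · filter_upwards [hlim] with ω hω
    have h1 := (hω.rpow_const (p := 1 / q) (Or.inr (by positivity)))
    rw [Real.zero_rpow (by positivity)] at h1
    rw [tendsto_zero_iff_abs_tendsto_zero]
    refine h1.congr fun n => ?_
    rw [← Real.rpow_mul (abs_nonneg _), mul_one_div_cancel (by linarith), Real.rpow_one]
    rfl
  · intro n
    have hUi : Integrable (U n) μ := (hLp n).integrable hq1
    set x : Ω → ℝ := fun ω => (1 - γ n) * Z n ω with hx
    set g : Ω → ℝ := fun ω => q * (|x ω| ^ (q - 2) * x ω) * γ n with hg
    have hxm : StronglyMeasurable[ℱ n] x := (hZm n).const_mul _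
    have hgm : StronglyMeasurable[ℱ n] g := by
      have : Measurable fun y : ℝ => q * (|y| ^ (q - 2) * y) * γ n := by fun_prop
      exact (this.comp hxm.measurable).stronglyMeasurable
    have hxp : MemLp x (ENNReal.ofReal q) μ := (hZp n).const_mul _
    -- Of `|x|` and `|U n|`, the larger one raised to the power `q` dominates the product `|x| ^ (q
    -- - 1) * |U n|`.
    have hgU : Integrable (g * U n) μ := by
      refine Integrable.mono' (((hpow hxp).add (hpow (hLp n))).const_mul (q * γ n))
        ((hgm.mono (ℱ.le n)).aestronglyMeasurable.mul hUi.aestronglyMeasurable)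
        (ae_of_all _ fun ω => ?_)
      have h1 : |x ω| ^ (q - 2) * |x ω| * |U n ω| ≤ |x ω| ^ q + |U n ω| ^ q := by
        have hs : ∀ y : ℝ, 0 ≤ y → y ^ q = y ^ (q - 2) * y * y := by
          intro y hy
          rw [mul_assoc, ← sq, ← Real.rpow_two, ← Real.rpow_add_of_nonneg hy (by linarith)
            (by norm_num)]
          congr 1
          ring
        have hx0 : 0 ≤ |x ω| ^ q := by positivity
        have hu0 : 0 ≤ |U n ω| ^ q := by positivity
        rcases le_total |U n ω| |x ω| with h | h
        · have : |x ω| ^ (q - 2) * |x ω| * |U n ω| ≤ |x ω| ^ (q - 2) * |x ω| * |x ω| := by gcongr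
          rw [← hs _ (abs_nonneg _)] at this
          linarith
        · have : |x ω| ^ (q - 2) * |x ω| * |U n ω| ≤
              |U n ω| ^ (q - 2) * |U n ω| * |U n ω| := by
            gcongr
          rw [← hs _ (abs_nonneg _)] at this
          linarith
      have h2 : ‖(g * U n) ω‖ = q * γ n * (|x ω| ^ (q - 2) * |x ω| * |U n ω|) := by
        simp only [hg, Pi.mul_apply, Real.norm_eq_abs, abs_mul]
        rw [abs_of_nonneg (show 0 ≤ q by linarith), abs_of_nonneg (hγ0 n),
          abs_of_nonneg (show 0 ≤ |x ω| ^ (q - 2) by positivity)]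
        ring
      rw [h2]
      exact mul_le_mul_of_nonneg_left h1 (mul_nonneg (by linarith) (hγ0 n))
    have hA : Integrable (fun ω => (1 - γ n / 2) * |Z n ω| ^ q) μ := (hpow (hZp n)).const_mul _
    have hAm : StronglyMeasurable[ℱ n] fun ω => (1 - γ n / 2) * |Z n ω| ^ q :=
      (hVm n).const_mul _
    have hB : Integrable ((C * γ n ^ (1 + q / 2)) • fun ω => |U n ω| ^ q) μ :=
      (hpow (hLp n)).smul _
    have hle : (fun ω => |Z (n + 1) ω| ^ q) ≤ᵐ[μ] ((fun ω => (1 - γ n / 2) * |Z n ω| ^ q) +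
        g * U n) + (C * γ n ^ (1 + q / 2)) • fun ω => |U n ω| ^ q :=
      ae_of_all _ fun ω => by
        simp only [hZ]
        exact H (γ n) (Z n ω) (U n ω) (hγ0 n) (hγ1 n)
    have e1 := condExp_mono (m := ℱ n) (hpow (hZp (n + 1))) ((hA.add hgU).add hB) hle
    have e2 := condExp_add (hA.add hgU) hB (ℱ n)
    have e3 := condExp_add hA hgU (ℱ n)
    -- The coefficient `g` is known at stage `n`, so the linear term inherits the zero conditional
    -- mean of `U n`.
    have e4 := condExp_mul_of_stronglyMeasurable_left hgm hgU hUi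
    have e5 := condExp_smul (μ := μ) (C * γ n ^ (1 + q / 2)) (fun ω => |U n ω| ^ q) (ℱ n)
    rw [condExp_of_stronglyMeasurable (ℱ.le n) hAm hA] at e3
    filter_upwards [e1, e2, e3, e4, e5, hmean n, hmom n] with ω e1 e2 e3 e4 e5 h1 h2
    rw [e2, Pi.add_apply, e3, Pi.add_apply, e4, Pi.mul_apply, h1, e5, Pi.smul_apply,
      smul_eq_mul, Pi.zero_apply, mul_zero, add_zero] at e1
    refine e1.trans ?_
    have := mul_le_mul_of_nonneg_left h2
      (mul_nonneg hC (Real.rpow_nonneg (hγ0 n) (1 + q / 2)))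
    linarith

end Noise

/-- Lets a finite exponent stand in for `q`: when `q = ∞` the almost sure bound gives moments of
every order `s`. -/
lemma OracleError.moment_le {Ω D : Type*} {G m : MeasurableSpace Ω} {μ : Measure Ω}
    [IsProbabilityMeasure μ] [NormedAddCommGroup D] [NormedSpace ℝ D] [CompleteSpace D] (hG : G ≤ m) {q : ℝ≥0∞}
    {σ s : ℝ} {U : Ω → D} (h : OracleError μ G q σ U) (hs : 2 ≤ s)
    (hsq : ENNReal.ofReal s = q ∨ q = ∞) :
    MemLp U (ENNReal.ofReal s) μ ∧ μ[fun ω => ‖U ω‖ ^ s | G] ≤ᵐ[μ] fun _ => σ ^ s := by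
  have hsr : (ENNReal.ofReal s).toReal = s := ENNReal.toReal_ofReal (by linarith)
  rcases hsq with rfl | rfl
  · exact ⟨h.memLp, by simpa [hsr] using h.moment ENNReal.ofReal_ne_top⟩
  · have hLp : MemLp U (ENNReal.ofReal s) μ := h.memLp.mono_exponent le_top
    refine ⟨hLp, ?_⟩
    have hint : Integrable (fun ω => ‖U ω‖ ^ s) μ := by
      simpa [hsr] using hLp.integrable_norm_rpow (by simp; linarith) ENNReal.ofReal_ne_top
    have h1 := condExp_mono (m := G) hint (integrable_const (σ ^ s))
      ((h.bounded rfl).mono fun ω hω => Real.rpow_le_rpow (norm_nonneg _) hω (by linarith))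
    rwa [condExp_const hG] at h1

/-! ### Finite-dimensional noise and summability of its moments. -/

section VectorNoise

variable {Ω : Type*} {m : MeasurableSpace Ω} {μ : Measure Ω} [IsProbabilityMeasure μ]
  {D : Type*} [NormedAddCommGroup D] [NormedSpace ℝ D] [FiniteDimensional ℝ D]

lemma IsStepSize.not_summable {γ : ℕ → ℝ} (hγ : IsStepSize γ) : ¬ Summable γ := by
  intro h
  have h1 := ((summable_nat_add_iff 1).2 h).hasSum.tendsto_sum_nat
  refine not_tendsto_nhds_of_tendsto_atTop hγ.tendsto_effTime _ (h1.congr fun n => ?_)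
  rw [effTime_eq_sum_range]

/-- The averages of a finite-dimensional martingale difference sequence vanish almost surely,
provided that the conditional moments of order `q` are small relative to the step-sizes. -/
theorem ae_averagesToZero (ℱ : Filtration ℕ m) {γ β : ℕ → ℝ} (hγ : IsStepSize γ) {U : ℕ → Ω → D}
    {q : ℝ} (hq : 2 ≤ q) (hU : ∀ n, 1 ≤ n → StronglyMeasurable[ℱ (n + 1)] (U n))
    (hLp : ∀ n, 1 ≤ n → MemLp (U n) (ENNReal.ofReal q) μ)
    (hmean : ∀ n, 1 ≤ n → μ[U n | ℱ n] =ᵐ[μ] 0)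
    (hmom : ∀ n, 1 ≤ n → μ[fun ω => ‖U n ω‖ ^ q | ℱ n] ≤ᵐ[μ] fun _ => β n)
    (hβ0 : ∀ n, 0 ≤ β n) (hβ : Summable fun n => γ n ^ (1 + q / 2) * β n) :
    ∀ᵐ ω ∂μ, AveragesToZero γ fun n => U n ω := by
  have : CompleteSpace D := FiniteDimensional.complete ℝ D
  have hq1 : 1 ≤ ENNReal.ofReal q := by
    rw [← ENNReal.ofReal_one]; exact ENNReal.ofReal_le_ofReal (by linarith)
  have hq0 : ENNReal.ofReal q ≠ 0 := (zero_lt_one.trans_le hq1).ne'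
  have hqr : (ENNReal.ofReal q).toReal = q := ENNReal.toReal_ofReal (by linarith)
  -- The averages start from zero at a stage `n₀ ≥ 1` after which `γ n ≤ 1`, as the contraction
  -- inequality requires.
  obtain ⟨n₀, hn₀⟩ := eventually_atTop.1
    ((hγ.tendsto_zero.eventually_le_const one_pos).and (eventually_ge_atTop 1))
  have h1 : ∀ k, 1 ≤ k + n₀ := fun k => (hn₀ (k + n₀) (by omega)).2
  let 𝒢 : Filtration ℕ m := ⟨fun k => ℱ (k + n₀), fun i j h => ℱ.mono (by omega), fun k => ℱ.le _⟩
  let Z : ℕ → Ω → D := fun k => Nat.rec (fun _ => 0)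
    (fun k z ω => z ω + γ (k + n₀) • (U (k + n₀) ω - z ω)) k
  let b := Module.finBasis ℝ D
  let ℓ : Fin (Module.finrank ℝ D) → StrongDual ℝ D := fun i =>
    LinearMap.toContinuousLinearMap (b.coord i)
  have hcoord : ∀ i, ∀ᵐ ω ∂μ, Tendsto (fun k => ℓ i (Z k ω)) atTop (𝓝 0) := by
    intro i
    refine ae_tendsto_average_zero 𝒢 hq (γ := fun k => γ (k + n₀))
      (β := fun k => ‖ℓ i‖ ^ q * β (k + n₀)) (U := fun k ω => ℓ i (U (k + n₀) ω))
      (fun k => (hγ.pos _ (h1 k)).le) (fun k => (hn₀ (k + n₀) (by omega)).1)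
      (by rw [summable_nat_add_iff]; exact hγ.not_summable) (fun k => ?_) (fun k => ?_)
      (fun k => ?_) (fun k => ?_) (fun k => ?_) ?_ (fun ω => map_zero _) (fun k ω => ?_)
    · have := (ℓ i).continuous.comp_stronglyMeasurable (hU (k + n₀) (h1 k))
      exact this.mono (ℱ.mono (by omega))
    · exact (ℓ i).comp_memLp' (hLp _ (h1 k))
    · have := (ℓ i).comp_condExp_comm ((hLp _ (h1 k)).integrable hq1) (m := ℱ (k + n₀))
      filter_upwards [this, hmean _ (h1 k)] with ω h2 h3
      simp only [Function.comp_apply, h3, Pi.zero_apply, map_zero] at h2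
      exact h2.symm
    · have hint : Integrable (fun ω => ‖U (k + n₀) ω‖ ^ q) μ := by
        simpa [hqr] using (hLp _ (h1 k)).integrable_norm_rpow hq0 ENNReal.ofReal_ne_top
      have hint' : Integrable (fun ω => |ℓ i (U (k + n₀) ω)| ^ q) μ := by
        simpa [hqr] using ((ℓ i).comp_memLp' (hLp _ (h1 k))).integrable_norm_rpow hq0
          ENNReal.ofReal_ne_top
      have hle : (fun ω => |ℓ i (U (k + n₀) ω)| ^ q) ≤ᵐ[μ]
          (‖ℓ i‖ ^ q) • fun ω => ‖U (k + n₀) ω‖ ^ q := ae_of_all _ fun ω => by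
        rw [Pi.smul_apply, smul_eq_mul, ← Real.mul_rpow (norm_nonneg _) (norm_nonneg _)]
        exact Real.rpow_le_rpow (abs_nonneg _) ((ℓ i).le_opNorm _) (by linarith)
      have h2 := condExp_mono (m := ℱ (k + n₀)) hint' (hint.smul _) hle
      have h3 := condExp_smul (μ := μ) (‖ℓ i‖ ^ q) (fun ω => ‖U (k + n₀) ω‖ ^ q) (ℱ (k + n₀))
      filter_upwards [h2, h3, hmom _ (h1 k)] with ω h2 h3 h4
      refine h2.trans ?_
      rw [h3, Pi.smul_apply, smul_eq_mul]
      exact mul_le_mul_of_nonneg_left h4 (by positivity)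
    · exact mul_nonneg (by positivity) (hβ0 _)
    · have := ((summable_nat_add_iff n₀).2 hβ).mul_left (‖ℓ i‖ ^ q)
      exact this.congr fun k => by ring
    · change ℓ i (Z k ω + γ (k + n₀) • (U (k + n₀) ω - Z k ω)) = _
      rw [map_add, map_smul, map_sub, smul_eq_mul]
  filter_upwards [ae_all_iff.2 hcoord] with ω hω
  -- Truncated subtraction gives the value `Z 0` before stage `n₀`, where no recursion is needed.
  refine ⟨fun n => Z (n - n₀) ω, ?_, ?_⟩
  · have h2 : Tendsto (fun k => ∑ i, ℓ i (Z k ω) • b i) atTop (𝓝 0) := by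
      simpa using tendsto_finsetSum Finset.univ fun i _ => (hω i).smul_const (b i)
    have h3 : (fun k => ∑ i, ℓ i (Z k ω) • b i) = fun k => Z k ω :=
      funext fun k => b.sum_repr (Z k ω)
    rw [h3] at h2
    exact h2.comp (tendsto_sub_atTop_nat n₀)
  · filter_upwards [eventually_ge_atTop n₀] with n hn
    obtain ⟨k, rfl⟩ := Nat.exists_eq_add_of_le' hn
    rw [Nat.add_sub_cancel, show k + n₀ + 1 - n₀ = k + 1 by omega]

lemma summable_schedule_moment {c p K r q : ℝ} (hc : 0 < c) (hK : 0 ≤ K)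
    (h : 1 < p * (1 + q / 2) - r * q) :
    Summable fun n => schedule c p n ^ (1 + q / 2) * (K * (n : ℝ) ^ r) ^ q := by
  have h1 := (Real.summable_one_div_nat_rpow (p := p * (1 + q / 2) - r * q)).2 h
  refine Summable.of_norm_bounded_eventually_nat (h1.mul_left (c ^ (1 + q / 2) * K ^ q)) ?_
  filter_upwards [eventually_ge_atTop 1] with n hn
  have hn' : (0 : ℝ) < n := by exact_mod_cast hn
  have hs := schedule_pos (p := p) hc hn
  rw [Real.norm_of_nonneg (by positivity), schedule, Real.div_rpow hc.le (by positivity),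
    Real.mul_rpow hK (by positivity), ← Real.rpow_mul hn'.le, ← Real.rpow_mul hn'.le,
    Real.rpow_sub hn']
  apply le_of_eq
  field_simp

/-- A finite exponent that can replace the exponent `q`. -/
lemma exists_finite_exponent {q : ℝ≥0∞} {p : ℝ} (hq : 2 ≤ q) (hp : 2 / (2 + q) < ENNReal.ofReal p) :
    ∃ s : ℝ, 2 ≤ s ∧ 1 < p * (1 + s / 2) ∧ (ENNReal.ofReal s = q ∨ q = ∞) := by
  have hp0 : 0 < p := ENNReal.ofReal_pos.1 (pos_of_gt hp)
  rcases eq_or_ne q ∞ with h | h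
  -- An exponent `s ≥ 2 / p` gives `p * (1 + s / 2) ≥ p + 1`.
  · refine ⟨max 2 (2 / p), le_max_left _ _, ?_, Or.inr h⟩
    have h1 : 2 / p ≤ max 2 (2 / p) := le_max_right _ _
    have h2 : p * (2 / p) ≤ p * max 2 (2 / p) := by gcongr
    rw [mul_div_cancel₀ _ hp0.ne'] at h2
    linarith
  · refine ⟨q.toReal, by simpa using ENNReal.toReal_mono h hq, ?_, Or.inl (ENNReal.ofReal_toReal h)⟩
    rw [← ENNReal.ofReal_toReal h, ← ENNReal.ofReal_ofNat, ← ENNReal.ofReal_add (by norm_num)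
      ENNReal.toReal_nonneg, ← ENNReal.ofReal_div_of_pos
        (by have := ENNReal.toReal_nonneg (a := q); linarith),
      ENNReal.ofReal_lt_ofReal_iff hp0, div_lt_iff₀
        (by have := ENNReal.toReal_nonneg (a := q); linarith)] at hp
    linarith

/-- Averages of oracle errors vanish. -/
theorem ae_averagesToZero_of_oracleError [CompleteSpace D] (ℱ : Filtration ℕ m) {c p σ : ℝ}
    {q : ℝ≥0∞} (hc : 0 < c) (hp1 : p ≤ 1) (hq : 2 ≤ q) (hp : 2 / (2 + q) < ENNReal.ofReal p)
    (hσ : 0 ≤ σ) {U : ℕ → Ω → D} (hU : ∀ n, 1 ≤ n → StronglyMeasurable[ℱ (n + 1)] (U n))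
    (herr : ∀ n, 1 ≤ n → OracleError μ (ℱ n) q σ (U n)) :
    ∀ᵐ ω ∂μ, AveragesToZero (schedule c p) fun n => U n ω := by
  have hp0 : 0 < p := ENNReal.ofReal_pos.1 (pos_of_gt hp)
  obtain ⟨s, hs, hps, hsq⟩ := exists_finite_exponent hq hp
  refine ae_averagesToZero ℱ (isStepSize_schedule hc hp0 hp1) hs hU
    (fun n hn => ((herr n hn).moment_le (ℱ.le n) hs hsq).1) (fun n hn => (herr n hn).unbiased)
    (β := fun _ => σ ^ s) (fun n hn => ((herr n hn).moment_le (ℱ.le n) hs hsq).2)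
    (fun _ => by positivity) ?_
  simpa using summable_schedule_moment (r := 0) hc hσ (by linarith : 1 < p * (1 + s / 2) - 0 * s)

/-- Averages of bounded martingale differences vanish, even if the bounds grow like `n ^ r`. -/
theorem ae_averagesToZero_of_bound (ℱ : Filtration ℕ m) {c p K r : ℝ} (hc : 0 < c)
    (hp1 : p ≤ 1) (hr : 0 ≤ r) (hrp : 2 * r < p) (hK : 0 ≤ K) {U : ℕ → Ω → D}
    (hU : ∀ n, 1 ≤ n → StronglyMeasurable[ℱ (n + 1)] (U n))
    (hmean : ∀ n, 1 ≤ n → μ[U n | ℱ n] =ᵐ[μ] 0)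
    (hbound : ∀ n, 1 ≤ n → ∀ᵐ ω ∂μ, ‖U n ω‖ ≤ K * (n : ℝ) ^ r) :
    ∀ᵐ ω ∂μ, AveragesToZero (schedule c p) fun n => U n ω := by
  -- Bounded noise has all moments; this exponent makes `q * (p / 2 - r) ≥ 1`, hence `p * (1 + q /
  -- 2) - r * q ≥ p + 1`.
  set q : ℝ := max 2 (1 / (p / 2 - r)) with hq
  have hq2 : 2 ≤ q := le_max_left _ _
  have hqr : (ENNReal.ofReal q).toReal = q := ENNReal.toReal_ofReal (by linarith)
  have hLp : ∀ n, 1 ≤ n → MemLp (U n) (ENNReal.ofReal q) μ := fun n hn =>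
    MemLp.of_bound ((hU n hn).mono (ℱ.le _)).aestronglyMeasurable _ (hbound n hn)
  refine ae_averagesToZero ℱ (isStepSize_schedule hc (by linarith) hp1) hq2 hU hLp hmean
    (β := fun n => (K * (n : ℝ) ^ r) ^ q) (fun n hn => ?_) (fun n => by positivity)
    (summable_schedule_moment hc hK ?_)
  · have hint : Integrable (fun ω => ‖U n ω‖ ^ q) μ := by
      simpa [hqr] using (hLp n hn).integrable_norm_rpow (by simp; linarith) ENNReal.ofReal_ne_top
    have h1 := condExp_mono (m := ℱ n) hint (integrable_const ((K * (n : ℝ) ^ r) ^ q))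
      ((hbound n hn).mono fun ω hω => Real.rpow_le_rpow (norm_nonneg _) hω (by linarith))
    rwa [condExp_const (ℱ.le n)] at h1
  · have h1 : 1 / (p / 2 - r) ≤ q := le_max_right _ _
    rw [div_le_iff₀ (by linarith)] at h1
    linarith

end VectorNoise

/-! ### Methods with a leading state -/

section Lead

variable {D : Type*} [NormedAddCommGroup D] [NormedSpace ℝ D] {γ : ℕ → ℝ} {F : D → D}
  {π : Seminorm ℝ D} {L G : ℝ}

lemma IsTameField.continuous (hF : IsTameField F π L G) : Continuous F :=
  hF.lipschitzWith.continuous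

lemma IsTameField.tendsto_sub (hF : IsTameField F π L G) {Y Y' : ℕ → D}
    (h : Tendsto (fun n => π (Y' n - Y n)) atTop (𝓝 0)) :
    Tendsto (fun n => F (Y' n) - F (Y n)) atTop (𝓝 0) :=
  squeeze_zero_norm (fun n => hF.lipschitz _ _) (by simpa using h.const_mul L)

/-- Evaluating the field at `Y'` instead of `Y` is a bias, and it vanishes as soon as the two are
close in the seminorm for which `F` is Lipschitz. -/
lemma IsTameField.isAPT_of_lead [CompleteSpace D] (hF : IsTameField F π L G) (hγ : IsStepSize γ)
    {Y Y' U : ℕ → D} (hU : AveragesToZero γ U)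
    (h : Tendsto (fun n => π (Y' n - Y n)) atTop (𝓝 0))
    (hY : ∀ n, 1 ≤ n → Y (n + 1) = Y n + γ n • (F (Y' n) + U n)) : IsAPT F γ Y := by
  refine hF.isAPT hγ hU (hF.tendsto_sub h) ?_
  filter_upwards [eventually_ge_atTop 1] with n hn
  rw [hY n hn]
  congr 2
  abel

/-- The leading state of an extra-gradient step is close to the base state. -/
lemma IsTameField.tendsto_lead_sub (hF : IsTameField F π L G) (hγ : IsStepSize γ)
    {Y Y' U : ℕ → D} (hU : AveragesToZero γ U)
    (hY : ∀ n, 1 ≤ n → Y' n = Y n + γ n • (F (Y n) + U n)) :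
    Tendsto (fun n => π (Y' n - Y n)) atTop (𝓝 0) := by
  have hlim : Tendsto (fun n => γ n * G + ‖γ n • U n‖) atTop (𝓝 0) := by
    simpa using (hγ.tendsto_zero.mul_const G).add
      (tendsto_zero_iff_norm_tendsto_zero.1 (hU.tendsto_smul hγ.tendsto_zero))
  refine squeeze_zero' (Eventually.of_forall fun n => apply_nonneg π _) ?_ hlim
  filter_upwards [eventually_ge_atTop 1] with n hn
  have hp := hγ.pos n hn
  rw [hY n hn, add_sub_cancel_left, smul_add]
  -- The field part is small only in the seminorm, where `F` is bounded; the noise part is small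
  -- even in norm.
  refine (map_add_le_add π _ _).trans (add_le_add ?_ (hF.le_norm _))
  rw [map_smul_eq_mul, Real.norm_of_nonneg hp.le]
  exact mul_le_mul_of_nonneg_left (hF.bounded _) hp.le

end Lead

/-! ### Measurability of oracle outputs. -/

lemma measurable_err {Ω P D S : Type*} {G : MeasurableSpace Ω} [MeasurableSpace P]
    [MeasurableSpace S] [MeasurableSpace D] {err : P → S → D}
    (herr : Measurable (Function.uncurry err)) {x : Ω → P} {s : Ω → S} (hx : Measurable[G] x)
    (hs : Measurable[G] s) : Measurable[G] fun ω => err (x ω) (s ω) :=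
  herr.comp (hx.prodMk hs)

lemma measurable_oracle {Ω P D S : Type*} {G : MeasurableSpace Ω} [MeasurableSpace P]
    [MeasurableSpace S] [MeasurableSpace D] [Add D] [MeasurableAdd₂ D] {v : P → D}
    (hv : Measurable v) {err : P → S → D}
    (herr : Measurable (Function.uncurry err)) {x : Ω → P} {s : Ω → S} (hx : Measurable[G] x)
    (hs : Measurable[G] s) : Measurable[G] fun ω => oracle v err (x ω) (s ω) :=
  (hv.comp hx).add (measurable_err herr hx hs)

lemma measurable_apply {Ω ι : Type*} {E : ι → Type*} {G : MeasurableSpace Ω}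
    [∀ i, MeasurableSpace (E i)] {x : Ω → ∀ i, E i} (hx : Measurable[G] x) (i : ι) :
    Measurable[G] fun ω => x ω i :=
  (measurable_pi_apply i).comp hx

lemma measurable_of_apply {Ω ι : Type*} {E : ι → Type*} {G : MeasurableSpace Ω}
    [∀ i, MeasurableSpace (E i)] {x : Ω → ∀ i, E i} (hx : ∀ i, Measurable[G] fun ω => x ω i) :
    Measurable[G] x :=
  measurable_pi_iff.2 hx

/-! ### Unconstrained games -/

section Unconstrained

variable {N : ℕ} {d : Fin N → ℕ}

lemma norm_single_le {ι : Type*} [Fintype ι] [DecidableEq ι] {E : ι → Type*}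
    [∀ i, NormedAddCommGroup (E i)] [∀ i, NormedSpace ℝ (E i)] (i : ι) :
    ‖ContinuousLinearMap.single ℝ E i‖ ≤ 1 :=
  ContinuousLinearMap.opNorm_le_bound _ zero_le_one fun z => by
    rw [one_mul, ContinuousLinearMap.single_apply]
    exact (Pi.norm_single (G := E) z).le

lemma norm_comp_single_le {ι : Type*} [Fintype ι] [DecidableEq ι] {E : ι → Type*}
    [∀ i, NormedAddCommGroup (E i)] [∀ i, NormedSpace ℝ (E i)] (i : ι)
    (φ : StrongDual ℝ (∀ i, E i)) : ‖φ.comp (ContinuousLinearMap.single ℝ E i)‖ ≤ ‖φ‖ :=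
  (φ.opNorm_comp_le _).trans (mul_le_of_le_one_right (norm_nonneg _) (norm_single_le i))

/-- Writes the individual gradient through the full derivative, the object to which the Lipschitz
assumptions refer. -/
lemma payoffGradient_apply {u : Fin N → Profile d → ℝ} (hu : IsSmoothGame u) (x : Profile d)
    (i : Fin N) : payoffGradient u x i = (InnerProductSpace.toDual ℝ _).symm
      ((fderiv ℝ (u i) x).comp (ContinuousLinearMap.single ℝ _ i)) := by
  have h1 : HasFDerivAt (u i) (fderiv ℝ (u i) x) (Function.update x i (x i)) := by
    rw [Function.update_eq_self]
    exact (hu.differentiable i x).hasFDerivAt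
  have h2 := (h1.comp (x i) (hasFDerivAt_update x (x i))).fderiv
  rw [payoffGradient, gradient]
  refine congrArg _ (h2.trans (congrArg _ ?_))
  ext z j : 2
  by_cases hj : j = i
  · subst hj; simp
  · simp [hj]

/-- Without constraints every direction is feasible, so Lipschitz payoffs have gradients bounded in
norm and the norm itself serves as seminorm. Sums over players replace maxima. -/
lemma IsSmoothGame.exists_isTameField {u : Fin N → Profile d → ℝ} (hu : IsSmoothGame u) :
    ∃ L G, IsTameField (payoffGradient u) (normSeminorm ℝ (Profile d)) L G := by
  choose G hG using hu.lipschitz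
  choose L hL using hu.smooth
  refine ⟨∑ i, (L i : ℝ), ∑ i, (G i : ℝ), Finset.sum_nonneg fun i _ => (L i).2, fun y => le_rfl,
    fun y z => ?_, fun y => ?_⟩
  · refine (pi_norm_le_iff_of_nonneg (mul_nonneg (Finset.sum_nonneg fun i _ => (L i).2)
      (apply_nonneg _ _))).2 fun i => ?_
    rw [Pi.sub_apply, payoffGradient_apply hu, payoffGradient_apply hu, ← map_sub,
      LinearIsometryEquiv.norm_map, ← ContinuousLinearMap.sub_comp]
    refine (norm_comp_single_le i _).trans (((hL i).norm_sub_le y z).trans ?_)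
    refine mul_le_mul_of_nonneg_right ?_ (norm_nonneg _)
    exact Finset.single_le_sum (f := fun i => (L i : ℝ)) (fun i _ => (L i).2) (Finset.mem_univ i)
  · refine (pi_norm_le_iff_of_nonneg (Finset.sum_nonneg fun i _ => (G i).2)).2 fun i => ?_
    rw [payoffGradient_apply hu, LinearIsometryEquiv.norm_map]
    refine (norm_comp_single_le i _).trans ((norm_fderiv_le_of_lipschitz ℝ (hG i)).trans ?_)
    exact Finset.single_le_sum (f := fun i => (G i : ℝ)) (fun i _ => (G i).2) (Finset.mem_univ i)

variable {Ω S : Type*} {m : MeasurableSpace Ω} [MeasurableSpace S] {μ : Measure Ω}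
  {ℱ : Filtration ℕ m} {u : Fin N → Profile d → ℝ}
  {err : Profile d → S → Profile d} {q : ℝ≥0∞} {σ c p : ℝ}

/-! ### Stochastic gradient ascent. -/

section SGA

variable {seed : ℕ → Ω → S} {X : ℕ → Ω → Profile d}

lemma IsSGA.measurable {γ : ℕ → ℝ} (h : IsSGA μ ℱ u err q σ γ seed X)
    (hv : Measurable (payoffGradient u)) (herr : Measurable (Function.uncurry err)) (n : ℕ)
    (hn : 1 ≤ n) : Measurable[ℱ n] (X n) := by
  induction n, hn using Nat.le_induction with
  | base => exact h.init
  | succ n hn ih =>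
    have hX := ih.mono (ℱ.mono n.le_succ) le_rfl
    rw [show X (n + 1) = _ from funext (h.step n hn)]
    exact hX.add ((measurable_oracle hv herr hX (h.seed_measurable n hn)).const_smul (γ n))

theorem IsSGA.ae_isAPT [IsProbabilityMeasure μ] (hc : 0 < c) (hp1 : p ≤ 1) (hu : IsSmoothGame u)
    (herr : Measurable (Function.uncurry err)) (hq : 2 ≤ q) (hσ : 0 ≤ σ)
    (h : IsSGA μ ℱ u err q σ (schedule c p) seed X) (hp : 2 / (2 + q) < ENNReal.ofReal p) :
    ∀ᵐ ω ∂μ, IsAPT (payoffGradient u) (schedule c p) (fun n => X n ω) := by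
  obtain ⟨L, G, hF⟩ := hu.exists_isTameField
  have hγ := isStepSize_schedule hc (ENNReal.ofReal_pos.1 (pos_of_gt hp)) hp1
  have hX := h.measurable hF.continuous.measurable herr
  have hU := ae_averagesToZero_of_oracleError ℱ hc hp1 hq hp hσ
    (fun n hn => (measurable_err herr ((hX n hn).mono (ℱ.mono n.le_succ) le_rfl)
      (h.seed_measurable n hn)).stronglyMeasurable) h.error
  filter_upwards [hU] with ω hω
  exact hF.isAPT_of_lead hγ hω (Y' := fun n => X n ω) (by simp) fun n hn => h.step n hn ω

end SGA

/-! ### Sequential gradient ascent. -/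

section SeqGA

variable {seed : ℕ → Ω → S} {X : ℕ → Ω → Profile d}

lemma measurable_seqQuery {G : MeasurableSpace Ω} {x x' : Ω → Profile d} {i : Fin N}
    (hx : Measurable[G] x) (hx' : ∀ j < i, Measurable[G] fun ω => x' ω j) :
    Measurable[G] fun ω => seqQuery (x ω) (x' ω) i := by
  refine measurable_of_apply fun j => ?_
  by_cases hj : j < i
  · simpa [seqQuery, hj] using hx' j hj
  · simpa [seqQuery, hj] using measurable_apply hx j

/-- Induction on the players: the query of player `i` involves new actions only of players before
`i`. -/
lemma IsSeqGA.measurable_next {γ : ℕ → ℝ} (h : IsSeqGA μ ℱ u err q σ γ seed X)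
    (hv : Measurable (payoffGradient u)) (herr : Measurable (Function.uncurry err)) {n : ℕ}
    (hn : 1 ≤ n) (hX : Measurable[ℱ n] (X n)) (i : Fin N) :
    Measurable[ℱ (n + 1)] fun ω => X (n + 1) ω i := by
  induction i using WellFoundedLT.induction with
  | ind i ih =>
    have hX' := hX.mono (ℱ.mono n.le_succ) le_rfl
    rw [show (fun ω => X (n + 1) ω i) = _ from funext fun ω => h.step n hn ω i]
    exact (measurable_apply hX' i).add ((measurable_apply (measurable_oracle hv herr
      (measurable_seqQuery hX' ih) (h.seed_measurable n hn)) i).const_smul (γ n))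

lemma IsSeqGA.measurable {γ : ℕ → ℝ} (h : IsSeqGA μ ℱ u err q σ γ seed X)
    (hv : Measurable (payoffGradient u)) (herr : Measurable (Function.uncurry err)) (n : ℕ)
    (hn : 1 ≤ n) : Measurable[ℱ n] (X n) := by
  induction n, hn using Nat.le_induction with
  | base => exact h.init
  | succ n hn ih => exact measurable_of_apply (h.measurable_next hv herr hn ih)

theorem IsSeqGA.ae_isAPT [IsProbabilityMeasure μ] (hc : 0 < c) (hp1 : p ≤ 1) (hu : IsSmoothGame u)
    (herr : Measurable (Function.uncurry err)) (hq : 2 ≤ q) (hσ : 0 ≤ σ)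
    (h : IsSeqGA μ ℱ u err q σ (schedule c p) seed X) (hp : 2 / (2 + q) < ENNReal.ofReal p) :
    ∀ᵐ ω ∂μ, IsAPT (payoffGradient u) (schedule c p) (fun n => X n ω) := by
  obtain ⟨L, G, hF⟩ := hu.exists_isTameField
  have hγ := isStepSize_schedule hc (ENNReal.ofReal_pos.1 (pos_of_gt hp)) hp1
  have hv := hF.continuous.measurable
  have hX := h.measurable hv herr
  -- The errors of different players come from different queries, so averages are treated player by
  -- player and joined by `AveragesToZero.pi`.
  have hU : ∀ i, ∀ᵐ ω ∂μ, AveragesToZero (schedule c p)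
      (fun n => err (seqQuery (X n ω) (X (n + 1) ω) i) (seed n ω) i) := fun i =>
    ae_averagesToZero_of_oracleError ℱ hc hp1 hq hp hσ
      (fun n hn => (measurable_apply (measurable_err herr
        (measurable_seqQuery ((hX n hn).mono (ℱ.mono n.le_succ) le_rfl)
          fun j _ => h.measurable_next hv herr hn (hX n hn) j)
        (h.seed_measurable n hn)) i).stronglyMeasurable)
      fun n hn => h.error n hn i
  filter_upwards [ae_all_iff.2 hU] with ω hω
  set Q : ℕ → Fin N → Profile d := fun n i => seqQuery (X n ω) (X (n + 1) ω) i with hQ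
  -- Queries differ from `X n` by displacements within one stage, each a vanishing multiple of a
  -- bounded field plus a vanishing noisy increment.
  have hstep : ∀ i, Tendsto (fun n => X (n + 1) ω i - X n ω i) atTop (𝓝 0) := by
    intro i
    have hlim : Tendsto (fun n => schedule c p n * G +
        ‖schedule c p n • err (Q n i) (seed n ω) i‖) atTop (𝓝 0) := by
      simpa using (hγ.tendsto_zero.mul_const G).add
        (tendsto_zero_iff_norm_tendsto_zero.1 ((hω i).tendsto_smul hγ.tendsto_zero))
    refine squeeze_zero_norm' ?_ hlim
    filter_upwards [eventually_ge_atTop 1] with n hn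
    have hs := (hγ.pos n hn).le
    rw [h.step n hn ω i, add_sub_cancel_left, oracle, Pi.add_apply, smul_add]
    refine (norm_add_le _ _).trans (add_le_add ?_ le_rfl)
    rw [norm_smul, Real.norm_of_nonneg hs]
    exact mul_le_mul_of_nonneg_left ((norm_le_pi_norm _ i).trans (hF.bounded _)) hs
  have hquery : ∀ i, Tendsto (fun n => Q n i - X n ω) atTop (𝓝 0) := by
    refine fun i => tendsto_pi_nhds.2 fun j => ?_
    by_cases hj : j < i
    · simpa [hQ, seqQuery, hj] using hstep j
    · simp [hQ, seqQuery, hj]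
  have hb : Tendsto (fun n i => payoffGradient u (Q n i) i - payoffGradient u (X n ω) i)
      atTop (𝓝 0) :=
    tendsto_pi_nhds.2 fun i => tendsto_pi_nhds.1
      (hF.tendsto_sub (tendsto_zero_iff_norm_tendsto_zero.1 (hquery i))) i
  refine hF.isAPT hγ (AveragesToZero.pi hω) hb ?_
  filter_upwards [eventually_ge_atTop 1] with n hn
  ext1 i
  rw [h.step n hn ω i, oracle]
  simp only [Pi.add_apply, Pi.smul_apply, hQ]
  congr 2
  abel

end SeqGA

/-! ### Extra-gradient. -/

section EG

variable {seed leadSeed : ℕ → Ω → S} {X lead : ℕ → Ω → Profile d}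

lemma IsEG.measurable_lead {γ : ℕ → ℝ} (h : IsEG μ ℱ u err q σ γ seed leadSeed X lead)
    (hv : Measurable (payoffGradient u)) (herr : Measurable (Function.uncurry err)) {n : ℕ}
    (hn : 1 ≤ n) (hX : Measurable[ℱ n] (X n)) : Measurable[ℱ (n + 1)] (lead n) := by
  have hX' := hX.mono (ℱ.mono n.le_succ) le_rfl
  rw [show lead n = _ from funext (h.leadStep n hn)]
  exact hX'.add ((measurable_oracle hv herr hX' (h.seed_measurable n hn)).const_smul (γ n))

lemma IsEG.measurable {γ : ℕ → ℝ} (h : IsEG μ ℱ u err q σ γ seed leadSeed X lead)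
    (hv : Measurable (payoffGradient u)) (herr : Measurable (Function.uncurry err)) (n : ℕ)
    (hn : 1 ≤ n) : Measurable[ℱ n] (X n) := by
  induction n, hn using Nat.le_induction with
  | base => exact h.init
  | succ n hn ih =>
    rw [show X (n + 1) = _ from funext (h.step n hn)]
    exact (ih.mono (ℱ.mono n.le_succ) le_rfl).add ((measurable_oracle hv herr
      (h.measurable_lead hv herr hn ih) (h.leadSeed_measurable n hn)).const_smul (γ n))

theorem IsEG.ae_isAPT [IsProbabilityMeasure μ] (hc : 0 < c) (hp1 : p ≤ 1) (hu : IsSmoothGame u)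
    (herr : Measurable (Function.uncurry err)) (hq : 2 ≤ q) (hσ : 0 ≤ σ)
    (h : IsEG μ ℱ u err q σ (schedule c p) seed leadSeed X lead)
    (hp : 2 / (2 + q) < ENNReal.ofReal p) :
    ∀ᵐ ω ∂μ, IsAPT (payoffGradient u) (schedule c p) (fun n => X n ω) := by
  obtain ⟨L, G, hF⟩ := hu.exists_isTameField
  have hγ := isStepSize_schedule hc (ENNReal.ofReal_pos.1 (pos_of_gt hp)) hp1
  have hv := hF.continuous.measurable
  have hX := h.measurable hv herr
  have hU := ae_averagesToZero_of_oracleError ℱ hc hp1 hq hp hσ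
    (fun n hn => (measurable_err herr ((hX n hn).mono (ℱ.mono n.le_succ) le_rfl)
      (h.seed_measurable n hn)).stronglyMeasurable) h.error
  have hU' := ae_averagesToZero_of_oracleError ℱ hc hp1 hq hp hσ
    (fun n hn => (measurable_err herr (h.measurable_lead hv herr hn (hX n hn))
      (h.leadSeed_measurable n hn)).stronglyMeasurable) h.leadError
  filter_upwards [hU, hU'] with ω hω hω'
  exact hF.isAPT_of_lead hγ hω' (Y' := fun n => lead n ω)
    (hF.tendsto_lead_sub hγ hω fun n hn => h.leadStep n hn ω) fun n hn => h.step n hn ω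

end EG

/-! ### Optimistic gradient. -/

section OG

variable {seed : ℕ → Ω → S} {X lead : ℕ → Ω → Profile d}

/-- The state and the previous leading state advance together: `lead (n + 1)` uses only `seed n`, so
it is already known at stage `n + 1`, in time for the step to `X (n + 2)`. -/
lemma IsOG.measurable {γ : ℕ → ℝ} (h : IsOG μ ℱ u err q σ γ seed X lead)
    (hv : Measurable (payoffGradient u)) (herr : Measurable (Function.uncurry err)) (n : ℕ) :
    Measurable[ℱ (n + 1)] (X (n + 1)) ∧ Measurable[ℱ (n + 1)] (lead n) := by
  induction n with
  | zero => exact ⟨h.init, h.leadInit⟩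
  | succ n ih =>
    have hX := ih.1.mono (ℱ.mono (n + 1).le_succ) le_rfl
    have hlead : Measurable[ℱ (n + 1)] (lead (n + 1)) := by
      rw [show lead (n + 1) = _ from funext (h.leadStep n)]
      exact ih.1.add ((measurable_oracle hv herr ih.2 (h.seed_measurable n)).const_smul (γ (n + 1)))
    have hlead' := hlead.mono (ℱ.mono (n + 1).le_succ) le_rfl
    refine ⟨?_, hlead'⟩
    rw [show X (n + 1 + 1) = _ from funext (h.step (n + 1) (by omega))]
    exact hX.add ((measurable_oracle hv herr hlead' (h.seed_measurable _)).const_smul (γ (n + 1)))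

theorem IsOG.ae_isAPT [IsProbabilityMeasure μ] (hc : 0 < c) (hp1 : p ≤ 1) (hu : IsSmoothGame u)
    (herr : Measurable (Function.uncurry err)) (hq : 2 ≤ q) (hσ : 0 ≤ σ)
    (h : IsOG μ ℱ u err q σ (schedule c p) seed X lead)
    (hp : 2 / (2 + q) < ENNReal.ofReal p) :
    ∀ᵐ ω ∂μ, IsAPT (payoffGradient u) (schedule c p) (fun n => X n ω) := by
  obtain ⟨L, G, hF⟩ := hu.exists_isTameField
  have hp0 := ENNReal.ofReal_pos.1 (pos_of_gt hp)
  have hγ := isStepSize_schedule hc hp0 hp1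
  have hmeas := h.measurable hF.continuous.measurable herr
  have hU := ae_averagesToZero_of_oracleError ℱ hc hp1 hq hp hσ
    (fun n _ => (measurable_err herr (hmeas n).2 (h.seed_measurable n)).stronglyMeasurable) h.error
  filter_upwards [hU] with ω hω
  refine hF.isAPT_of_lead hγ hω (Y' := fun n => lead n ω) ?_ fun n hn => h.step n hn ω
  -- The noise in `lead (n + 1)` is that of the previous query, scaled by `γ (n + 1) ≤ γ n`. The
  -- initial query has an unconstrained error and is excluded by `n ≥ 1`.
  rw [← tendsto_add_atTop_iff_nat 1]
  have hlim : Tendsto (fun n => schedule c p (n + 1) * G +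
      ‖schedule c p n • err (lead n ω) (seed n ω)‖) atTop (𝓝 0) := by
    simpa using ((hγ.tendsto_zero.comp (tendsto_add_atTop_nat 1)).mul_const G).add
      (tendsto_zero_iff_norm_tendsto_zero.1 (hω.tendsto_smul hγ.tendsto_zero))
  refine squeeze_zero' (Eventually.of_forall fun n => apply_nonneg _ _) ?_ hlim
  filter_upwards [eventually_ge_atTop 1] with n hn
  have hs := (hγ.pos (n + 1) (by omega)).le
  rw [h.leadStep, add_sub_cancel_left, oracle, smul_add]
  refine (map_add_le_add _ _ _).trans (add_le_add ?_ ?_)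
  · rw [map_smul_eq_mul, Real.norm_of_nonneg hs]
    exact mul_le_mul_of_nonneg_left (hF.bounded _) hs
  · rw [coe_normSeminorm, norm_smul, norm_smul, Real.norm_of_nonneg hs, Real.norm_of_nonneg (hγ.pos n hn).le]
    exact mul_le_mul_of_nonneg_right (schedule_succ_le hc hp0.le hn) (norm_nonneg _)

end OG

end Unconstrained

/-! ### Mirror maps -/

section MirrorMap

variable {V : Type*} [NormedAddCommGroup V] [NormedSpace ℝ V] {X : Set V} {h : V → ℝ}

/-- Compactness gives a minimizer of `g = h - y` on a ball, and strong convexity confines all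
competitors to it. If `g z < g x₀` at distance `R > 1` from `x₀`, the point of the segment at
distance `1` has value at most `g x₀ - (R - 1) * K / 2`; comparison with the minimum `g w₀` over the
unit ball forces `R ≤ R₀`. -/
lemma IsRegularizer.exists_isMaxOn [FiniteDimensional ℝ V] (hX : IsClosed X) (hne : X.Nonempty)
    (hh : IsRegularizer X h) (y : StrongDual ℝ V) :
    ∃ x, x ∈ X ∧ IsMaxOn (fun z => y z - h z) X x := by
  have : ProperSpace V := FiniteDimensional.proper ℝ V
  obtain ⟨K, hK, hconv⟩ := hh.strongConvex
  obtain ⟨x₀, hx₀⟩ := hne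
  set g : V → ℝ := fun z => h z - y z with hg
  have hgc : ContinuousOn g X := hh.continuousOn.sub y.continuous.continuousOn
  have hmin : ∀ R : ℝ, 0 ≤ R → ∃ x ∈ X ∩ Metric.closedBall x₀ R,
      ∀ z ∈ X ∩ Metric.closedBall x₀ R, g x ≤ g z := fun R hR =>
    ((isCompact_closedBall x₀ R).inter_left hX).exists_isMinOn
      ⟨x₀, hx₀, Metric.mem_closedBall_self hR⟩ (hgc.mono Set.inter_subset_left)
  obtain ⟨w₀, -, hw₀⟩ := hmin 1 zero_le_one
  set R₀ : ℝ := max 1 (1 + 2 * (g x₀ - g w₀) / K) with hR₀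
  have hR₀1 : 1 ≤ R₀ := le_max_left _ _
  obtain ⟨x, hx, hxmin⟩ := hmin R₀ (by linarith)
  refine ⟨x, hx.1, fun z hz => ?_⟩
  have hgoal : g x ≤ g z → y z - h z ≤ y x - h x := fun hle => by
    simp only [hg] at hle
    linarith
  apply hgoal
  have hx₀' : g x ≤ g x₀ := hxmin x₀ ⟨hx₀, Metric.mem_closedBall_self (by linarith)⟩
  rcases le_or_gt (g x₀) (g z) with hle | hlt
  · exact hx₀'.trans hle
  · refine hxmin z ⟨hz, ?_⟩
    rw [mem_closedBall_iff_norm]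
    by_contra! hR
    set R : ℝ := ‖z - x₀‖ with hRdef
    have hR1 : 1 < R := hR₀1.trans_lt hR
    have hRpos : 0 < R := by linarith
    have hinv : R⁻¹ ≤ 1 := inv_le_one_of_one_le₀ hR1.le
    have hineq := hconv.2
    have hc := hineq hx₀ hz (a := 1 - R⁻¹) (b := R⁻¹) (by linarith) (by positivity) (by ring)
    have hmem : (1 - R⁻¹) • x₀ + R⁻¹ • z ∈ X :=
      hconv.1 hx₀ hz (by linarith) (by positivity) (by ring)
    have hball : (1 - R⁻¹) • x₀ + R⁻¹ • z ∈ Metric.closedBall x₀ 1 := by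
      rw [mem_closedBall_iff_norm]
      have : (1 - R⁻¹) • x₀ + R⁻¹ • z - x₀ = R⁻¹ • (z - x₀) := by module
      rw [this, norm_smul, Real.norm_of_nonneg (by positivity), ← hRdef,
        inv_mul_cancel₀ hRpos.ne']
    have hw := hw₀ _ ⟨hmem, hball⟩
    have hsym : ‖x₀ - z‖ = R := by rw [norm_sub_rev]
    have hw' : g w₀ ≤ (1 - R⁻¹) * g x₀ + R⁻¹ * g z - (1 - R⁻¹) * R⁻¹ * (K / 2 * R ^ 2) := by
      refine hw.trans ?_
      simp only [hg, map_add, map_smul, smul_eq_mul, hsym] at hc ⊢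
      linarith
    have h1 : R⁻¹ * g z ≤ R⁻¹ * g x₀ := mul_le_mul_of_nonneg_left hlt.le (by positivity)
    have h2 : (1 - R⁻¹) * R⁻¹ * (K / 2 * R ^ 2) = (R - 1) * (K / 2) := by
      field_simp
    have h3 : (R - 1) * (K / 2) ≤ g x₀ - g w₀ := by linarith
    have h4 : 1 + 2 * (g x₀ - g w₀) / K < R := (le_max_right _ _).trans_lt hR
    have h5 : 2 * (g x₀ - g w₀) / K < R - 1 := by linarith
    rw [div_lt_iff₀ hK] at h5
    linarith

lemma mirrorMap_spec [FiniteDimensional ℝ V] (hX : IsClosed X) (hne : X.Nonempty)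
    (hh : IsRegularizer X h) (y : StrongDual ℝ V) :
    mirrorMap X h y ∈ X ∧ IsMaxOn (fun z => y z - h z) X (mirrorMap X h y) :=
  Classical.epsilon_spec (hh.exists_isMaxOn hX hne y)

/-- Testing maximality at midpoints gives growth `K / 4` times the squared distance from the
maximizer; adding the estimates for `y` and `z` cancels `h`. -/
lemma mirrorMap_monotone [FiniteDimensional ℝ V] (hX : IsClosed X) (hne : X.Nonempty)
    (hh : IsRegularizer X h) {K : ℝ} (hK : StrongConvexOn X K h) (y z : StrongDual ℝ V) :
    K / 2 * ‖mirrorMap X h y - mirrorMap X h z‖ ^ 2 ≤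
      (y - z) (mirrorMap X h y - mirrorMap X h z) := by
  have hgrow : ∀ y : StrongDual ℝ V, ∀ w ∈ X,
      K / 4 * ‖mirrorMap X h y - w‖ ^ 2 ≤
        (y (mirrorMap X h y) - h (mirrorMap X h y)) - (y w - h w) := by
    intro y w hw
    obtain ⟨hx, hmax⟩ := mirrorMap_spec hX hne hh y
    have hineq := hK.2
    have hc := hineq hx hw (a := 1 / 2) (b := 1 / 2) (by norm_num) (by norm_num) (by norm_num)
    have hcv := hK.1
    have hm := hmax (hcv hx hw (a := 1 / 2) (b := 1 / 2) (by norm_num) (by norm_num)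
      (by norm_num))
    simp only [Set.mem_ofPred_eq, map_add, map_smul, smul_eq_mul] at hm hc
    linarith
  have h1 := hgrow y _ (mirrorMap_spec hX hne hh z).1
  have h2 := hgrow z _ (mirrorMap_spec hX hne hh y).1
  rw [norm_sub_rev] at h2
  rw [_root_.sub_apply, map_sub, map_sub]
  linarith

end MirrorMap

/-! ### Gradients along a convex set. -/

section Gradient

variable {E : Type*} [NormedAddCommGroup E] [NormedSpace ℝ E]

lemma abs_fderivWithin_le_of_lipschitzOnWith {s : Set E} {f : E → ℝ} {f' : StrongDual ℝ E}
    {x v : E} {G : NNReal} (hf : HasFDerivWithinAt f f' s x) (hG : LipschitzOnWith G f s)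
    (hx : x ∈ s) (hv : ∀ᶠ n : ℕ in atTop, x + (n : ℝ)⁻¹ • v ∈ s) : |f' v| ≤ G * ‖v‖ := by
  have hlim : Tendsto (fun n : ℕ => (n : ℝ) • (f (x + (n : ℝ)⁻¹ • v) - f x))
      atTop (𝓝 (f' v)) := by
    refine hf.lim ?_ hv ?_
    · simpa using (tendsto_inv_atTop_nhds_zero_nat (𝕜 := ℝ)).smul_const v
    · refine tendsto_const_nhds.congr' ?_
      filter_upwards [eventually_ge_atTop 1] with n hn
      have : (n : ℝ) ≠ 0 := by exact_mod_cast (by omega : n ≠ 0)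
      rw [smul_smul, mul_inv_cancel₀ this, one_smul]
  refine le_of_tendsto hlim.abs ?_
  filter_upwards [hv, eventually_ge_atTop 1] with n hn hn1
  have hn0 : (0 : ℝ) < n := by exact_mod_cast hn1
  have h1 := hG.norm_sub_le hn hx
  rw [add_sub_cancel_left, norm_smul, Real.norm_of_nonneg (inv_nonneg.2 hn0.le)] at h1
  rw [smul_eq_mul, abs_mul, abs_of_pos hn0]
  calc (n : ℝ) * |f (x + (n : ℝ)⁻¹ • v) - f x| ≤ n * (G * ((n : ℝ)⁻¹ * ‖v‖)) := by
        gcongr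
        exact (Real.norm_eq_abs _).ge.trans h1
    _ = G * ‖v‖ := by field_simp

/-- A continuous choice of gradients of a Lipschitz function on a convex set is bounded by the
Lipschitz constant in the directions of the set. -/
lemma abs_gradient_sub_le {C : Set E} (hC : Convex ℝ C) {f : E → ℝ} {df : E → StrongDual ℝ E}
    {G : NNReal} (hf : ∀ x ∈ C, HasFDerivWithinAt f (df x) C x) (hG : LipschitzOnWith G f C)
    (hdf : ContinuousOn df C) {x a b : E} (hx : x ∈ C) (ha : a ∈ C) (hb : b ∈ C) :
    |df x (a - b)| ≤ G * ‖a - b‖ := by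
  -- At `x` itself `a - b` may be infeasible. Moving `x` slightly towards the midpoint of `a` and
  -- `b` makes it feasible, and continuity of `df` carries the bound back to `x`.
  set ξ : ℕ → E := fun k => (1 - ((k : ℝ) + 1)⁻¹) • x +
    ((k : ℝ) + 1)⁻¹ • ((1 / 2 : ℝ) • a + (1 / 2 : ℝ) • b) with hξ
  have ht1 : ∀ k : ℕ, ((k : ℝ) + 1)⁻¹ ≤ 1 := fun k =>
    inv_le_one_of_one_le₀ (by have : (0 : ℝ) ≤ k := by positivity
                              linarith)
  have hmem : ∀ (k : ℕ) (s : ℝ), 0 ≤ s → s ≤ ((k : ℝ) + 1)⁻¹ / 2 → ξ k + s • (a - b) ∈ C := by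
    intro k s h0 hs
    have hk : (0 : ℝ) < (k : ℝ) + 1 := by positivity
    have hs' : s * (k + 1) ≤ 1 / 2 := by
      have := mul_le_mul_of_nonneg_right hs hk.le
      rwa [div_mul_eq_mul_div, inv_mul_cancel₀ hk.ne'] at this
    have hs0 : 0 ≤ s * (k + 1) := by positivity
    have hab : (1 / 2 + s * (k + 1)) • a + (1 / 2 - s * (k + 1)) • b ∈ C :=
      hC ha hb (by linarith) (by linarith) (by ring)
    have hfin := hC hx hab (a := 1 - ((k : ℝ) + 1)⁻¹) (b := ((k : ℝ) + 1)⁻¹)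
      (by linarith [ht1 k]) (by positivity) (by ring)
    convert hfin using 1
    have : s = ((k : ℝ) + 1)⁻¹ * (s * (k + 1)) := by field_simp
    rw [hξ]
    nth_rewrite 1 [this]
    module
  have hξC : ∀ k, ξ k ∈ C := fun k => by
    simpa using hmem k 0 le_rfl (by positivity)
  have hbound : ∀ k, |df (ξ k) (a - b)| ≤ G * ‖a - b‖ := by
    intro k
    refine abs_fderivWithin_le_of_lipschitzOnWith (hf _ (hξC k)) hG (hξC k) ?_
    filter_upwards [tendsto_inv_atTop_nhds_zero_nat (𝕜 := ℝ) |>.eventually_le_const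
      (show 0 < ((k : ℝ) + 1)⁻¹ / 2 by positivity)] with n hn
    exact hmem k _ (by positivity) hn
  have hξlim : Tendsto ξ atTop (𝓝 x) := by
    have h0 : Tendsto (fun k : ℕ => ((k : ℝ) + 1)⁻¹) atTop (𝓝 0) := by
      simpa using tendsto_one_div_add_atTop_nhds_zero_nat (𝕜 := ℝ)
    have h1 := ((h0.const_sub 1).smul_const x).add
      (h0.smul_const ((1 / 2 : ℝ) • a + (1 / 2 : ℝ) • b))
    rwa [sub_zero, one_smul, zero_smul, add_zero] at h1
  have hlim : Tendsto (fun k => df (ξ k)) atTop (𝓝 (df x)) :=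
    (hdf x hx).tendsto.comp (tendsto_nhdsWithin_iff.2 ⟨hξlim, Eventually.of_forall hξC⟩)
  have hlim' : Tendsto (fun k => df (ξ k) (a - b)) atTop (𝓝 (df x (a - b))) :=
    ((ContinuousLinearMap.apply ℝ ℝ (a - b)).continuous.tendsto _).comp hlim
  exact le_of_tendsto' hlim'.abs hbound

end Gradient

/-- The supremum of a family of linear forms of norm at most one, as a seminorm. -/
noncomputable def supSeminorm {D I : Type*} [NormedAddCommGroup D] [NormedSpace ℝ D]
    (φ : I → D →ₗ[ℝ] ℝ) (hφ : ∀ i y, |φ i y| ≤ ‖y‖) : Seminorm ℝ D :=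
  Seminorm.of (fun y => ⨆ i, |φ i y|)
    (fun x y => Real.iSup_le (fun i => by
      rw [map_add]
      exact (abs_add_le _ _).trans (add_le_add
        (le_ciSup (f := fun i => |φ i x|) ⟨‖x‖, Set.forall_mem_range.2 fun i => hφ i x⟩ i)
        (le_ciSup (f := fun i => |φ i y|) ⟨‖y‖, Set.forall_mem_range.2 fun i => hφ i y⟩ i)))
      (add_nonneg (Real.iSup_nonneg fun i => abs_nonneg _)
        (Real.iSup_nonneg fun i => abs_nonneg _)))
    (fun a x => by
      simp only [map_smul, smul_eq_mul, abs_mul]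
      rw [Real.mul_iSup_of_nonneg (norm_nonneg a)]
      rfl)

lemma le_supSeminorm {D I : Type*} [NormedAddCommGroup D] [NormedSpace ℝ D]
    {φ : I → D →ₗ[ℝ] ℝ} (hφ : ∀ i y, |φ i y| ≤ ‖y‖) (i : I) (y : D) :
    |φ i y| ≤ supSeminorm φ hφ y :=
  le_ciSup (f := fun i => |φ i y|) ⟨‖y‖, Set.forall_mem_range.2 fun i => hφ i y⟩ i

lemma supSeminorm_le {D I : Type*} [NormedAddCommGroup D] [NormedSpace ℝ D]
    {φ : I → D →ₗ[ℝ] ℝ} (hφ : ∀ i y, |φ i y| ≤ ‖y‖) {y : D} {a : ℝ} (ha : 0 ≤ a)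
    (h : ∀ i, |φ i y| ≤ a) : supSeminorm φ hφ y ≤ a :=
  Real.iSup_le h ha

section MirrorField

variable {N : ℕ} {V : Fin N → Type*} [∀ i, NormedAddCommGroup (V i)] [∀ i, NormedSpace ℝ (V i)]

/-- The slope of a dual profile along the segment between two actions of the same player. -/
noncomputable def directionalForm (X : ∀ i, Set (V i)) (k : Σ i, X i × X i) :
    (∀ i, StrongDual ℝ (V i)) →ₗ[ℝ] ℝ where
  -- For equal actions the inverse of `0` is `0` and the form vanishes.
  toFun y := ‖(k.2.1 : V k.1) - k.2.2‖⁻¹ * y k.1 (k.2.1 - k.2.2)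
  map_add' y z := by simp only [Pi.add_apply, _root_.add_apply]; ring
  map_smul' a y := by
    simp only [Pi.smul_apply, _root_.smul_apply, smul_eq_mul, RingHom.id_apply]; ring

lemma abs_directionalForm_eq (X : ∀ i, Set (V i)) (k : Σ i, X i × X i)
    (y : ∀ i, StrongDual ℝ (V i)) : |directionalForm X k y| =
      ‖(k.2.1 : V k.1) - k.2.2‖⁻¹ * |y k.1 (k.2.1 - k.2.2)| := by
  rw [directionalForm, LinearMap.coe_mk, AddHom.coe_mk, abs_mul, abs_of_nonneg (by positivity)]

lemma abs_directionalForm_le_of_le {X : ∀ i, Set (V i)} {k : Σ i, X i × X i}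
    {y : ∀ i, StrongDual ℝ (V i)} {a : ℝ} (ha : 0 ≤ a)
    (h : |y k.1 (k.2.1 - k.2.2)| ≤ a * ‖(k.2.1 : V k.1) - k.2.2‖) :
    |directionalForm X k y| ≤ a := by
  rw [abs_directionalForm_eq]
  calc _ ≤ ‖(k.2.1 : V k.1) - k.2.2‖⁻¹ * (a * ‖(k.2.1 : V k.1) - k.2.2‖) := by gcongr
    _ = a * (‖(k.2.1 : V k.1) - k.2.2‖⁻¹ * ‖(k.2.1 : V k.1) - k.2.2‖) := by ring
    _ ≤ a := mul_le_of_le_one_right ha inv_mul_le_one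

lemma abs_directionalForm_le (X : ∀ i, Set (V i)) (k : Σ i, X i × X i)
    (y : ∀ i, StrongDual ℝ (V i)) : |directionalForm X k y| ≤ ‖y‖ :=
  abs_directionalForm_le_of_le (norm_nonneg _) (((y k.1).le_opNorm _).trans
    (mul_le_mul_of_nonneg_right (norm_le_pi_norm y k.1) (norm_nonneg _)))

variable {X : ∀ i, Set (V i)} {h : ∀ i, V i → ℝ} {u : Fin N → (∀ i, V i) → ℝ}
  {du : Fin N → (∀ i, V i) → StrongDual ℝ (∀ i, V i)} [∀ i, FiniteDimensional ℝ (V i)]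

/-- The seminorm of dual profiles in the directions of the action sets. -/
noncomputable def directionalSeminorm (X : ∀ i, Set (V i)) :
    Seminorm ℝ (∀ i, StrongDual ℝ (V i)) :=
  supSeminorm (directionalForm X) (abs_directionalForm_le X)

/-- By strong monotonicity, `K i / 2 * ‖Δ‖ ^ 2` is at most the dual difference applied to `Δ`. As
`Δ` joins two feasible actions, only the directional seminorm enters. -/
lemma exists_mirrorProfile_sub_le (hX : ∀ i, IsClosed (X i)) (hne : ∀ i, (X i).Nonempty)
    (hh : ∀ i, IsRegularizer (X i) (h i)) : ∃ L : ℝ, 0 ≤ L ∧ ∀ y z,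
      ‖mirrorProfile X h y - mirrorProfile X h z‖ ≤ L * directionalSeminorm X (y - z) := by
  choose K hK hconv using fun i => (hh i).strongConvex
  refine ⟨∑ i, 2 / K i, Finset.sum_nonneg fun i _ => by have := hK i; positivity, fun y z => ?_⟩
  have hπ := apply_nonneg (directionalSeminorm X) (y - z)
  refine (pi_norm_le_iff_of_nonneg (mul_nonneg (Finset.sum_nonneg fun i _ => by
    have := hK i; positivity) hπ)).2 fun i => ?_
  have hKi := hK i
  have hle : 2 / K i ≤ ∑ i, 2 / K i := Finset.single_le_sum (f := fun i => 2 / K i)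
    (fun i _ => by have := hK i; positivity) (Finset.mem_univ i)
  refine le_trans ?_ (mul_le_mul_of_nonneg_right hle hπ)
  rw [Pi.sub_apply]
  have hm := mirrorMap_monotone (hX i) (hne i) (hh i) (hconv i) (y i) (z i)
  have hy := (mirrorMap_spec (hX i) (hne i) (hh i) (y i)).1
  have hz := (mirrorMap_spec (hX i) (hne i) (hh i) (z i)).1
  have hd := le_supSeminorm (abs_directionalForm_le X) ⟨i, ⟨_, hy⟩, ⟨_, hz⟩⟩ (y - z)
  rw [abs_directionalForm_eq] at hd
  simp only [Pi.sub_apply] at hd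
  simp only [mirrorProfile]
  set Δ := mirrorMap (X i) (h i) (y i) - mirrorMap (X i) (h i) (z i) with hΔ
  rcases (norm_nonneg Δ).eq_or_lt with h0 | h0
  · rw [← h0]
    positivity
  · have h1 : |(y i - z i) Δ| ≤ directionalSeminorm X (y - z) * ‖Δ‖ := by
      rw [inv_mul_le_iff₀ h0, mul_comm] at hd
      exact hd
    have h2 : K i / 2 * ‖Δ‖ * ‖Δ‖ ≤ directionalSeminorm X (y - z) * ‖Δ‖ := by
      have := le_abs_self ((y i - z i) Δ)
      nlinarith
    have h3 := le_of_mul_le_mul_right h2 h0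
    rw [div_mul_eq_mul_div, le_div_iff₀ hKi]
    linarith

lemma mirrorProfile_mem (hX : ∀ i, IsClosed (X i)) (hne : ∀ i, (X i).Nonempty)
    (hh : ∀ i, IsRegularizer (X i) (h i)) (y : ∀ i, StrongDual ℝ (V i)) :
    mirrorProfile X h y ∈ Set.univ.pi X :=
  fun i _ => (mirrorMap_spec (hX i) (hne i) (hh i) (y i)).1

lemma continuous_mirrorProfile (hX : ∀ i, IsClosed (X i)) (hne : ∀ i, (X i).Nonempty)
    (hh : ∀ i, IsRegularizer (X i) (h i)) : Continuous (mirrorProfile X h) := by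
  obtain ⟨L, hL, hle⟩ := exists_mirrorProfile_sub_le hX hne hh
  refine (LipschitzWith.of_dist_le' (K := L) fun y z => ?_).continuous
  rw [dist_eq_norm, dist_eq_norm]
  refine (hle y z).trans (mul_le_mul_of_nonneg_left ?_ hL)
  exact supSeminorm_le _ (norm_nonneg _) fun k => abs_directionalForm_le X k _

/-- Here the seminorm is essential: a Lipschitz payoff bounds the chosen gradient only along the
action sets, while components transversal to them may be unbounded. -/
lemma IsContinuousGame.exists_isTameField (hu : IsContinuousGame X u du)
    (hh : ∀ i, IsRegularizer (X i) (h i)) : ∃ L G,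
      IsTameField (fun y => dualGradient du (mirrorProfile X h y)) (directionalSeminorm X) L G := by
  choose G hG using hu.lipschitz
  choose L hL using hu.smooth
  obtain ⟨K, hK, hQ⟩ := exists_mirrorProfile_sub_le hu.closed hu.nonempty hh
  have hmem := mirrorProfile_mem hu.closed hu.nonempty hh
  have hC : Convex ℝ (Set.univ.pi X) := convex_pi fun i _ => hu.convex i
  have hL0 : 0 ≤ ∑ i, (L i : ℝ) := Finset.sum_nonneg fun i _ => (L i).2
  have hG0 : 0 ≤ ∑ i, (G i : ℝ) := Finset.sum_nonneg fun i _ => (G i).2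
  refine ⟨(∑ i, (L i : ℝ)) * K, ∑ i, (G i : ℝ), by positivity,
    fun y => supSeminorm_le _ (norm_nonneg _) fun k => abs_directionalForm_le X k _,
    fun y z => ?_, fun y => supSeminorm_le _ hG0 fun ⟨i, a, b⟩ => ?_⟩
  · refine (pi_norm_le_iff_of_nonneg (mul_nonneg (by positivity) (apply_nonneg _ _))).2 fun i => ?_
    rw [Pi.sub_apply, dualGradient, dualGradient, ← ContinuousLinearMap.sub_comp]
    refine (norm_comp_single_le i _).trans (((hL i).norm_sub_le (hmem y) (hmem z)).trans ?_)
    rw [mul_assoc]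
    refine mul_le_mul ?_ (hQ y z) (norm_nonneg _) hL0
    exact Finset.single_le_sum (f := fun i => (L i : ℝ)) (fun i _ => (L i).2) (Finset.mem_univ i)
  · refine abs_directionalForm_le_of_le hG0 ?_
    set x := mirrorProfile X h y with hx
    have hupd : ∀ a : X i, Function.update x i a ∈ Set.univ.pi X := by
      intro a j _
      rcases eq_or_ne j i with rfl | hj
      · simp
      · rw [Function.update_of_ne hj]
        exact hmem y j trivial
    have hsub : Function.update x i (a : V i) - Function.update x i (b : V i) =
        Pi.single i ((a : V i) - b) := by
      ext1 j
      rcases eq_or_ne j i with rfl | hj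
      · simp
      · simp [hj]
    have hmain := abs_gradient_sub_le hC (hu.hasGradient i) (hG i) (hL i).continuousOn (hmem y)
      (hupd a) (hupd b)
    rw [hsub, Pi.norm_single] at hmain
    refine hmain.trans (mul_le_mul_of_nonneg_right ?_ (norm_nonneg _))
    exact Finset.single_le_sum (f := fun i => (G i : ℝ)) (fun i _ => (G i).2) (Finset.mem_univ i)

/-! ### Mirror-prox. -/

section MirrorProx

variable [∀ i, MeasurableSpace (V i)] [∀ i, BorelSpace (V i)] {Ω S : Type*}
  {m : MeasurableSpace Ω} [MeasurableSpace S] {μ : Measure Ω} {ℱ : Filtration ℕ m}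
  {err : (∀ i, V i) → S → ∀ i, StrongDual ℝ (V i)} {q : ℝ≥0∞} {σ c p : ℝ}
  {seed leadSeed : ℕ → Ω → S} {Y leadY : ℕ → Ω → ∀ i, StrongDual ℝ (V i)}

instance instSecondCountableTopologyStrongDual {W : Type*} [NormedAddCommGroup W]
    [NormedSpace ℝ W] [FiniteDimensional ℝ W] : SecondCountableTopology (StrongDual ℝ W) :=
  have : ProperSpace (StrongDual ℝ W) := FiniteDimensional.proper ℝ _
  inferInstance

instance instSecondCountableTopologyAction (i : Fin N) : SecondCountableTopology (V i) :=
  have : ProperSpace (V i) := FiniteDimensional.proper ℝ _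
  inferInstance

lemma IsMP.measurable_lead {γ : ℕ → ℝ} (hmp : IsMP μ ℱ X h du err q σ γ seed leadSeed Y leadY)
    (hQ : Continuous (mirrorProfile X h))
    (hF : Continuous fun y => dualGradient du (mirrorProfile X h y))
    (herr : Measurable (Function.uncurry err)) {n : ℕ} (hn : 1 ≤ n) (hY : Measurable[ℱ n] (Y n)) :
    Measurable[ℱ (n + 1)] (leadY n) := by
  have hY' := hY.mono (ℱ.mono n.le_succ) le_rfl
  rw [show leadY n = _ from funext (hmp.leadStep n hn)]
  exact hY'.add (((hF.measurable.comp hY').add (measurable_err herr (hQ.measurable.comp hY')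
    (hmp.seed_measurable n hn))).const_smul (γ n))

lemma IsMP.measurable {γ : ℕ → ℝ} (hmp : IsMP μ ℱ X h du err q σ γ seed leadSeed Y leadY)
    (hQ : Continuous (mirrorProfile X h))
    (hF : Continuous fun y => dualGradient du (mirrorProfile X h y))
    (herr : Measurable (Function.uncurry err)) (n : ℕ) (hn : 1 ≤ n) : Measurable[ℱ n] (Y n) := by
  induction n, hn using Nat.le_induction with
  | base => exact hmp.init
  | succ n hn ih =>
    have hl := hmp.measurable_lead hQ hF herr hn ih
    rw [show Y (n + 1) = _ from funext (hmp.step n hn)]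
    exact (ih.mono (ℱ.mono n.le_succ) le_rfl).add (((hF.measurable.comp hl).add
      (measurable_err herr (hQ.measurable.comp hl) (hmp.leadSeed_measurable n hn))).const_smul
        (γ n))

theorem IsMP.ae_isAPT [IsProbabilityMeasure μ] (hc : 0 < c) (hp1 : p ≤ 1)
    (hu : IsContinuousGame X u du) (hh : ∀ i, IsRegularizer (X i) (h i))
    (herr : Measurable (Function.uncurry err)) (hq : 2 ≤ q) (hσ : 0 ≤ σ)
    (hmp : IsMP μ ℱ X h du err q σ (schedule c p) seed leadSeed Y leadY)
    (hp : 2 / (2 + q) < ENNReal.ofReal p) :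
    ∀ᵐ ω ∂μ, IsAPT (fun y => dualGradient du (mirrorProfile X h y)) (schedule c p)
      (fun n => Y n ω) := by
  obtain ⟨L, G, hF⟩ := hu.exists_isTameField hh
  have hγ := isStepSize_schedule hc (ENNReal.ofReal_pos.1 (pos_of_gt hp)) hp1
  have hQ := continuous_mirrorProfile hu.closed hu.nonempty hh
  have hY := hmp.measurable hQ hF.continuous herr
  have hU := ae_averagesToZero_of_oracleError ℱ hc hp1 hq hp hσ
    (fun n hn => (measurable_err herr (hQ.measurable.comp ((hY n hn).mono (ℱ.mono n.le_succ)
      le_rfl)) (hmp.seed_measurable n hn)).stronglyMeasurable) hmp.error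
  have hU' := ae_averagesToZero_of_oracleError ℱ hc hp1 hq hp hσ
    (fun n hn => (measurable_err herr (hQ.measurable.comp (hmp.measurable_lead hQ hF.continuous
      herr hn (hY n hn))) (hmp.leadSeed_measurable n hn)).stronglyMeasurable) hmp.leadError
  filter_upwards [hU, hU'] with ω hω hω'
  exact hF.isAPT_of_lead hγ hω' (Y' := fun n => leadY n ω)
    (hF.tendsto_lead_sub hγ hω fun n hn => hmp.leadStep n hn ω) fun n hn => hmp.step n hn ω

end MirrorProx

end MirrorField

/-! ### Random draws from a finite set -/

section Draw

lemma stronglyMeasurable_draw {Ω J D : Type*} [Fintype J] [NormedAddCommGroup D] [NormedSpace ℝ D]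
    {G : MeasurableSpace Ω} {a : Ω → J} (ha : ∀ j, MeasurableSet {ω | a ω = j}) {f : J → Ω → D}
    (hf : ∀ j, StronglyMeasurable (f j)) : StronglyMeasurable fun ω => f (a ω) ω := by
  classical
  have h : (fun ω => f (a ω) ω) = fun ω => ∑ j, {ω | a ω = j}.indicator (f j) ω := by
    ext ω
    simp [Set.indicator_apply]
  rw [h]
  exact Finset.stronglyMeasurable_fun_sum _ fun j _ => (hf j).indicator (ha j)

/-- Split along the finitely many outcomes; on each, the `G`-measurable factor `f j` comes out of
the conditional expectation. -/
lemma condExp_draw {Ω J D : Type*} [Fintype J] [NormedAddCommGroup D] [NormedSpace ℝ D]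
    [CompleteSpace D] {G m : MeasurableSpace Ω} {μ : Measure Ω} [IsProbabilityMeasure μ]
    (hG : G ≤ m) {a : Ω → J} (ha : ∀ j, MeasurableSet {ω | a ω = j}) {w : J → Ω → ℝ}
    (hw : ∀ j, μ⟦{ω | a ω = j} | G⟧ =ᵐ[μ] w j) {f : J → Ω → D}
    (hf : ∀ j, StronglyMeasurable[G] (f j)) {B : ℝ} (hB : ∀ j ω, ‖f j ω‖ ≤ B) :
    μ[fun ω => f (a ω) ω | G] =ᵐ[μ] fun ω => ∑ j, w j ω • f j ω := by
  classical
  set χ : J → Ω → ℝ := fun j => {ω | a ω = j}.indicator fun _ => (1 : ℝ) with hχ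
  have hsum : (fun ω => f (a ω) ω) = ∑ j, χ j • f j := by
    ext ω
    simp [hχ, Finset.sum_apply, Set.indicator_apply]
  have hχi : ∀ j, Integrable (χ j) μ := fun j => (integrable_const _).indicator (ha j)
  have hi : ∀ j, Integrable (χ j • f j) μ := by
    intro j
    refine Integrable.mono' (integrable_const B) ((hχi j).aestronglyMeasurable.smul
      ((hf j).mono hG).aestronglyMeasurable) (ae_of_all _ fun ω => ?_)
    have h0 : 0 ≤ B := (norm_nonneg _).trans (hB j ω)
    by_cases h : a ω = j
    · simpa [hχ, h] using hB j ω
    · simpa [hχ, h] using h0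
  have h1 := condExp_finsetSum (μ := μ) (s := Finset.univ) (f := fun j => χ j • f j)
    (fun j _ => hi j) G
  have h2 : ∀ j, μ[χ j • f j | G] =ᵐ[μ] μ[χ j | G] • f j := fun j =>
    condExp_smul_of_aestronglyMeasurable_right (hχi j) (hi j) (hf j).aestronglyMeasurable
  rw [hsum]
  filter_upwards [h1, ae_all_iff.2 h2, ae_all_iff.2 hw] with ω h1 h2 h3
  rw [h1, Finset.sum_apply]
  refine Finset.sum_congr rfl fun j _ => ?_
  rw [h2 j, Pi.smul_apply', h3 j]

/-- The averages of the fluctuations of a finite draw around its conditional mean vanish. -/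
theorem ae_averagesToZero_of_draw {Ω J D : Type*} [Fintype J] [NormedAddCommGroup D]
    [NormedSpace ℝ D] [FiniteDimensional ℝ D] [CompleteSpace D] {m : MeasurableSpace Ω}
    {μ : Measure Ω} [IsProbabilityMeasure μ] (ℱ : Filtration ℕ m) {c p K r : ℝ} (hc : 0 < c)
    (hp1 : p ≤ 1) (hr : 0 ≤ r) (hrp : 2 * r < p) (hK : 0 ≤ K) {a : ℕ → Ω → J}
    (ha : ∀ n, 1 ≤ n → ∀ j, MeasurableSet[ℱ (n + 1)] {ω | a n ω = j}) {w : ℕ → J → Ω → ℝ}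
    (hw : ∀ n, 1 ≤ n → ∀ j, μ⟦{ω | a n ω = j} | ℱ n⟧ =ᵐ[μ] w n j)
    (hw0 : ∀ n, 1 ≤ n → ∀ j ω, 0 ≤ w n j ω) (hw1 : ∀ n, 1 ≤ n → ∀ ω, ∑ j, w n j ω = 1)
    {f : ℕ → J → Ω → D} {M : ℕ → Ω → D}
    (hf : ∀ n, 1 ≤ n → ∀ j, StronglyMeasurable[ℱ n] (f n j))
    (hM : ∀ n, 1 ≤ n → StronglyMeasurable[ℱ n] (M n))
    (hfM : ∀ n, 1 ≤ n → ∀ ω, ∑ j, w n j ω • f n j ω = M n ω)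
    (hB : ∀ n, 1 ≤ n → ∀ j ω, ‖f n j ω‖ ≤ K * (n : ℝ) ^ r) :
    ∀ᵐ ω ∂μ, AveragesToZero (schedule c p) fun n => f n (a n ω) ω - M n ω := by
  have hMB : ∀ n, 1 ≤ n → ∀ ω, ‖M n ω‖ ≤ K * (n : ℝ) ^ r := by
    intro n hn ω
    rw [← hfM n hn ω]
    calc ‖∑ j, w n j ω • f n j ω‖ ≤ ∑ j, w n j ω * (K * (n : ℝ) ^ r) := by
          refine norm_sum_le_of_le _ fun j _ => ?_
          rw [norm_smul, Real.norm_of_nonneg (hw0 n hn j ω)]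
          exact mul_le_mul_of_nonneg_left (hB n hn j ω) (hw0 n hn j ω)
      _ = K * (n : ℝ) ^ r := by rw [← Finset.sum_mul, hw1 n hn ω, one_mul]
  have hmeas : ∀ n, 1 ≤ n → StronglyMeasurable[ℱ (n + 1)] fun ω => f n (a n ω) ω := fun n hn =>
    stronglyMeasurable_draw (ha n hn) fun j => (hf n hn j).mono (ℱ.mono n.le_succ)
  refine ae_averagesToZero_of_bound ℱ hc hp1 hr hrp (K := 2 * K) (by linarith)
    (fun n hn => (hmeas n hn).sub ((hM n hn).mono (ℱ.mono n.le_succ))) (fun n hn => ?_)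
    (fun n hn => ae_of_all _ fun ω => ?_)
  · have h1 : Integrable (fun ω => f n (a n ω) ω) μ :=
      Integrable.mono' (integrable_const _)
        ((hmeas n hn).mono (ℱ.le _)).aestronglyMeasurable (ae_of_all _ fun ω => hB n hn _ ω)
    have h2 : Integrable (M n) μ := Integrable.mono' (integrable_const _)
      ((hM n hn).mono (ℱ.le _)).aestronglyMeasurable (ae_of_all _ fun ω => hMB n hn ω)
    have h3 := condExp_sub h1 h2 (ℱ n)
    rw [condExp_of_stronglyMeasurable (ℱ.le n) (hM n hn) h2] at h3
    have h4 := condExp_draw (ℱ.le n) (fun j => ℱ.le (n + 1) _ (ha n hn j)) (hw n hn) (hf n hn)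
      (hB n hn)
    filter_upwards [h3, h4] with ω h3 h4
    change (μ[(fun ω => f n (a n ω) ω) - M n | ℱ n]) ω = 0
    rw [h3, Pi.sub_apply, h4, hfM n hn, sub_self]
  · have := norm_sub_le (f n (a n ω) ω) (M n ω)
    have := hB n hn (a n ω) ω
    have := hMB n hn ω
    linarith

end Draw

/-! ### Products of mixed strategies -/

/-- The profiles of vectors with entries in `[0, 1]`. -/
def IsSubmixed {N : ℕ} {A : Fin N → Type*} (x : ∀ i, A i → ℝ) : Prop := ∀ i α, 0 ≤ x i α ∧ x i α ≤ 1

lemma IsSubmixed.update_single {N : ℕ} {A : Fin N → Type*} [∀ i, DecidableEq (A i)] {x : ∀ i, A i → ℝ} (hx : IsSubmixed x)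
    (i : Fin N) (α : A i) : IsSubmixed (Function.update x i (Pi.single α 1)) := by
  intro j β
  rcases eq_or_ne j i with rfl | hj
  · rw [Function.update_self, Pi.single_apply]
    split_ifs <;> norm_num
  · rw [Function.update_of_ne hj]
    exact hx j β

section Mixed

variable {N : ℕ} {A : Fin N → Type*} [∀ i, Fintype (A i)]

/-- Resampling the strategy of player `i`. -/
lemma sum_prod_resample [∀ i, DecidableEq (A i)] (z : ∀ i, A i → ℝ) (i : Fin N) (y : A i → ℝ)
    (ψ : (∀ i, A i) → ℝ) :
    ∑ b : ∀ j, A j, (∏ j, z j (b j)) * ∑ β, y β * ψ (Function.update b i β) =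
      (∑ β, z i β) * ∑ b : ∀ j, A j, (∏ j, Function.update z i y j (b j)) * ψ b := by
  -- This involution exchanges the strategy of player `i` with the independent sample, turning the
  -- weight `z i (b i) * y β` into `z i β * y (b i)`.
  set e : (∀ j, A j) × A i → (∀ j, A j) × A i := fun t => (Function.update t.1 i t.2, t.1 i)
  have he : Function.Involutive e := fun t => by simp [e]
  have h1 : ∀ (x : ∀ j, A j → ℝ) (b : ∀ j, A j), ∏ j, x j (b j) =
      x i (b i) * ∏ j ∈ Finset.univ.erase i, x j (b j) := fun x b =>
    (Finset.mul_prod_erase _ _ (Finset.mem_univ i)).symm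
  have h2 : ∀ b : ∀ j, A j, ∀ β, ∏ j ∈ Finset.univ.erase i, z j (Function.update b i β j) =
      ∏ j ∈ Finset.univ.erase i, z j (b j) := fun b β =>
    Finset.prod_congr rfl fun j hj => by rw [Function.update_of_ne (Finset.ne_of_mem_erase hj)]
  have h3 : ∀ b : ∀ j, A j, ∏ j ∈ Finset.univ.erase i, Function.update z i y j (b j) =
      ∏ j ∈ Finset.univ.erase i, z j (b j) := fun b =>
    Finset.prod_congr rfl fun j hj => by rw [Function.update_of_ne (Finset.ne_of_mem_erase hj)]
  calc ∑ b : ∀ j, A j, (∏ j, z j (b j)) * ∑ β, y β * ψ (Function.update b i β)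
      = ∑ t : (∀ j, A j) × A i, (z i (t.1 i) * ∏ j ∈ Finset.univ.erase i, z j (t.1 j)) *
          (y t.2 * ψ (Function.update t.1 i t.2)) := by
        rw [Fintype.sum_prod_type]
        exact Finset.sum_congr rfl fun b _ => by rw [Finset.mul_sum, h1]
    _ = ∑ t : (∀ j, A j) × A i, (z i t.2 * ∏ j ∈ Finset.univ.erase i, z j (t.1 j)) *
          (y (t.1 i) * ψ t.1) := by
        refine (Equiv.sum_comp (he.toPerm e) (fun t : (∀ j, A j) × A i =>
          (z i t.2 * ∏ j ∈ Finset.univ.erase i, z j (t.1 j)) * (y (t.1 i) * ψ t.1))).symm.trans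
          (Finset.sum_congr rfl fun t _ => ?_) |>.symm
        simp [e, h2]
    _ = ∑ b : ∀ j, A j, ∑ β, z i β * ((∏ j, Function.update z i y j (b j)) * ψ b) := by
        rw [Fintype.sum_prod_type]
        refine Finset.sum_congr rfl fun b _ => Finset.sum_congr rfl fun β _ => ?_
        rw [h1 (Function.update z i y), h3, Function.update_self]
        ring
    _ = _ := by
        simp_rw [← Finset.sum_mul]
        rw [← Finset.mul_sum]

lemma sum_prod_eq_one [DecidableEq (∀ i, A i)] {z : ∀ i, A i → ℝ} (hz : ∀ i, ∑ α, z i α = 1) :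
    ∑ b : ∀ j, A j, ∏ j, z j (b j) = 1 := by
  rw [← Fintype.prod_sum, Finset.prod_eq_one fun i _ => hz i]

/-- Resample player `i` with the point mass at `α`. This makes realization-based feedback unbiased.
-/
lemma payoffVector_eq [∀ i, DecidableEq (A i)] (u : Fin N → (∀ i, A i) → ℝ) {z : ∀ i, A i → ℝ}
    (i : Fin N) (hz : ∑ α, z i α = 1) (α : A i) :
    payoffVector u z i α = ∑ b : ∀ j, A j, (∏ j, z j (b j)) * u i (Function.update b i α) := by
  have h := sum_prod_resample z i (Pi.single α 1) (u i)
  rw [hz, one_mul] at h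
  rw [payoffVector, mixedPayoff]
  convert h.symm using 2 with b _ b _
  · congr!
  · congr 1
    rw [Finset.sum_eq_single α]
    · simp
    · intro β _ hβ
      simp [hβ]
    · simp

/-- Replace the factors one at a time; the others lie in `[0, 1]` and cost nothing. -/
lemma abs_prod_sub_prod_le {ι : Type*} (s : Finset ι) {a b : ι → ℝ}
    (ha : ∀ j, 0 ≤ a j ∧ a j ≤ 1) (hb : ∀ j, 0 ≤ b j ∧ b j ≤ 1) :
    |∏ j ∈ s, a j - ∏ j ∈ s, b j| ≤ ∑ j ∈ s, |a j - b j| := by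
  classical
  induction s using Finset.induction_on with
  | empty => simp
  | insert k s hk ih =>
    rw [Finset.prod_insert hk, Finset.prod_insert hk, Finset.sum_insert hk]
    have h1 : 0 ≤ ∏ j ∈ s, a j := Finset.prod_nonneg fun j _ => (ha j).1
    have h2 : ∏ j ∈ s, a j ≤ 1 := Finset.prod_le_one (fun j _ => (ha j).1) fun j _ => (ha j).2
    have h3 : a k * ∏ j ∈ s, a j - b k * ∏ j ∈ s, b j =
        (a k - b k) * ∏ j ∈ s, a j + b k * (∏ j ∈ s, a j - ∏ j ∈ s, b j) := by ring
    rw [h3]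
    refine (abs_add_le _ _).trans (add_le_add ?_ ?_)
    · rw [abs_mul, abs_of_nonneg h1]
      exact mul_le_of_le_one_right (abs_nonneg _) h2
    · rw [abs_mul, abs_of_nonneg (hb k).1]
      exact (mul_le_of_le_one_left (abs_nonneg _) (hb k).2).trans ih

/-- A bound on the payoffs of a finite game. -/
def payoffBound (u : Fin N → (∀ i, A i) → ℝ) : ℝ :=
  ∑ i, ∑ a : ∀ j, A j, |u i a|

lemma payoffBound_nonneg (u : Fin N → (∀ i, A i) → ℝ) : 0 ≤ payoffBound u :=
  Finset.sum_nonneg fun _ _ => Finset.sum_nonneg fun _ _ => abs_nonneg _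

lemma sum_abs_le_payoffBound (u : Fin N → (∀ i, A i) → ℝ) (i : Fin N) :
    ∑ a : ∀ j, A j, |u i a| ≤ payoffBound u :=
  Finset.single_le_sum (f := fun i => ∑ a : ∀ j, A j, |u i a|)
    (fun _ _ => Finset.sum_nonneg fun _ _ => abs_nonneg _) (Finset.mem_univ i)

lemma abs_le_payoffBound (u : Fin N → (∀ i, A i) → ℝ) (i : Fin N) (a : ∀ j, A j) :
    |u i a| ≤ payoffBound u :=
  (Finset.single_le_sum (f := fun a => |u i a|) (fun _ _ => abs_nonneg _)
    (Finset.mem_univ a)).trans (sum_abs_le_payoffBound u i)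

lemma abs_mixedPayoff_le (u : Fin N → (∀ i, A i) → ℝ) (i : Fin N) {x : ∀ i, A i → ℝ}
    (hx : IsSubmixed x) : |mixedPayoff u i x| ≤ payoffBound u := by
  refine (Finset.abs_sum_le_sum_abs _ _).trans (le_trans ?_ (sum_abs_le_payoffBound u i))
  refine Finset.sum_le_sum fun a _ => ?_
  rw [abs_mul, abs_of_nonneg (Finset.prod_nonneg fun j _ => (hx j _).1)]
  exact mul_le_of_le_one_left (abs_nonneg _)
    (Finset.prod_le_one (fun j _ => (hx j _).1) fun j _ => (hx j _).2)

lemma abs_apply_sub_le (x z : ∀ i, A i → ℝ) (i : Fin N) (α : A i) :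
    |x i α - z i α| ≤ ‖x - z‖ :=
  (norm_le_pi_norm ((x - z) i) α).trans (norm_le_pi_norm (x - z) i)

lemma norm_profile_le {x : ∀ i, A i → ℝ} {B : ℝ} (hB : 0 ≤ B) (h : ∀ i α, |x i α| ≤ B) :
    ‖x‖ ≤ B :=
  (pi_norm_le_iff_of_nonneg hB).2 fun i => (pi_norm_le_iff_of_nonneg hB).2 (h i)

lemma norm_payoffVector_le (u : Fin N → (∀ i, A i) → ℝ) {x : ∀ i, A i → ℝ} (hx : IsSubmixed x) :
    ‖payoffVector u x‖ ≤ payoffBound u := by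
  classical
  refine norm_profile_le (payoffBound_nonneg u) fun i α => abs_mixedPayoff_le u i ?_
  convert hx.update_single i α

lemma norm_payoffVector_sub_le (u : Fin N → (∀ i, A i) → ℝ) {x z : ∀ i, A i → ℝ}
    (hx : IsSubmixed x) (hz : IsSubmixed z) :
    ‖payoffVector u x - payoffVector u z‖ ≤ payoffBound u * N * ‖x - z‖ := by
  classical
  have hB := payoffBound_nonneg u
  refine norm_profile_le (by positivity) fun i α => ?_
  have hmix : ∀ {x z : ∀ i, A i → ℝ}, IsSubmixed x → IsSubmixed z → ∀ {ε : ℝ}, 0 ≤ ε →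
      (∀ j β, |x j β - z j β| ≤ ε) →
      |mixedPayoff u i x - mixedPayoff u i z| ≤ payoffBound u * N * ε := by
    intro x z hx hz ε hε h
    rw [mixedPayoff, mixedPayoff, ← Finset.sum_sub_distrib]
    calc _ ≤ ∑ a : ∀ j, A j, |u i a| * (N * ε) := by
          refine (Finset.abs_sum_le_sum_abs _ _).trans (Finset.sum_le_sum fun a _ => ?_)
          rw [← sub_mul, abs_mul, mul_comm]
          refine mul_le_mul_of_nonneg_left ?_ (abs_nonneg _)
          refine (abs_prod_sub_prod_le _ (fun j => hx j (a j)) fun j => hz j (a j)).trans ?_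
          refine (Finset.sum_le_sum fun j _ => h j (a j)).trans_eq ?_
          simp
      _ ≤ payoffBound u * N * ε := by
          rw [← Finset.sum_mul, mul_assoc]
          exact mul_le_mul_of_nonneg_right (sum_abs_le_payoffBound u i) (by positivity)
  have hd : ∀ j β, |Function.update x i (Pi.single α 1) j β -
      Function.update z i (Pi.single α 1) j β| ≤ ‖x - z‖ := by
    intro j β
    rcases eq_or_ne j i with rfl | hj
    · simp
    · rw [Function.update_of_ne hj, Function.update_of_ne hj]
      exact abs_apply_sub_le x z j β
  rw [Pi.sub_apply, Pi.sub_apply, payoffVector, payoffVector]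
  convert hmix (hx.update_single i α) (hz.update_single i α) (norm_nonneg _) hd

lemma isSubmixed_of_sum_eq_one {x : ∀ i, A i → ℝ} (h0 : ∀ i α, 0 ≤ x i α)
    (h1 : ∀ i, ∑ α, x i α = 1) : IsSubmixed x := fun i α =>
  ⟨h0 i α, (Finset.single_le_sum (fun β _ => h0 i β) (Finset.mem_univ α)).trans_eq (h1 i)⟩

lemma norm_finiteOracle_le (u : Fin N → (∀ i, A i) → ℝ) (fb : Feedback) {x : ∀ i, A i → ℝ}
    (hx : IsSubmixed x) (b : ∀ i, A i) : ‖finiteOracle u fb x b‖ ≤ payoffBound u := by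
  cases fb with
  | full => exact norm_payoffVector_le u hx
  | realized => exact norm_profile_le (payoffBound_nonneg u) fun i α => abs_le_payoffBound u i _

lemma le_explore {ε : ℝ} (h1 : ε ≤ 1) {x : ∀ i, A i → ℝ} (hx : IsSubmixed x)
    (i : Fin N) (α : A i) : ε / Fintype.card (A i) ≤ explore ε x i α := by
  rw [explore, mul_one_div]
  have := mul_nonneg (sub_nonneg.2 h1) (hx i α).1
  linarith

/-- Importance weighting turns the law `z i` of player `i` into the point mass at `α`, already term
by term in the sum. -/
lemma sum_iwe (u : Fin N → (∀ i, A i) → ℝ) {z : ∀ i, A i → ℝ} (hz : ∀ i α, 0 < z i α) :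
    ∑ b : ∀ j, A j, (∏ j, z j (b j)) • iwe u z b = payoffVector u z := by
  classical
  ext i α
  rw [Finset.sum_apply, Finset.sum_apply, payoffVector, mixedPayoff]
  refine Finset.sum_congr rfl fun b _ => ?_
  have h1 : ∀ x : ∀ j, A j → ℝ, ∏ j, x j (b j) =
      x i (b i) * ∏ j ∈ Finset.univ.erase i, x j (b j) := fun x =>
    (Finset.mul_prod_erase _ _ (Finset.mem_univ i)).symm
  have h2 : ∏ j ∈ Finset.univ.erase i, Function.update z i (Pi.single α 1) j (b j) =
      ∏ j ∈ Finset.univ.erase i, z j (b j) :=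
    Finset.prod_congr rfl fun j hj => by rw [Function.update_of_ne (Finset.ne_of_mem_erase hj)]
  have hgoal : (∏ j, z j (b j)) * ((if b i = α then 1 else 0) / z i α * u i b) =
      (∏ j, Function.update z i (Pi.single α 1) j (b j)) * u i b := by
    rw [h1 z, h1 (Function.update z i (Pi.single α 1)), h2, Function.update_self]
    by_cases hb : b i = α
    · have := (hz i α).ne'
      rw [if_pos hb, hb, Pi.single_eq_same]
      field_simp
    · rw [if_neg hb, Pi.single_eq_of_ne hb]
      ring
  simp only [iwe, Pi.smul_apply, smul_eq_mul]
  convert hgoal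

lemma norm_iwe_le (u : Fin N → (∀ i, A i) → ℝ) {z : ∀ i, A i → ℝ} {κ : ℝ} (hκ : 0 < κ)
    (hz : ∀ i α, κ ≤ z i α) (b : ∀ i, A i) : ‖iwe u z b‖ ≤ payoffBound u / κ := by
  classical
  have hB := payoffBound_nonneg u
  refine norm_profile_le (by positivity) fun i α => ?_
  have h1 : |iwe u z b i α| ≤ 1 / z i α * |u i b| := by
    have hpos := hκ.trans_le (hz i α)
    rw [iwe, abs_mul, abs_div, abs_of_pos hpos]
    gcongr
    split_ifs <;> simp
  refine h1.trans ?_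
  calc 1 / z i α * |u i b| ≤ 1 / κ * payoffBound u := by
        gcongr
        · exact hz i α
        · exact abs_le_payoffBound u i b
    _ = payoffBound u / κ := by ring

lemma sum_finiteOracle (u : Fin N → (∀ i, A i) → ℝ) (fb : Feedback) {x : ∀ i, A i → ℝ}
    (hx : ∀ i, ∑ α, x i α = 1) :
    ∑ b : ∀ j, A j, (∏ j, x j (b j)) • finiteOracle u fb x b = payoffVector u x := by
  classical
  cases fb with
  | full => simp only [finiteOracle]; rw [← Finset.sum_smul, sum_prod_eq_one hx, one_smul]
  | realized =>
    ext i α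
    rw [payoffVector_eq u i (hx i), Finset.sum_apply, Finset.sum_apply]
    refine Finset.sum_congr rfl fun b _ => ?_
    simp only [finiteOracle, Pi.smul_apply, smul_eq_mul]

end Mixed

section FiniteGames

variable {N : ℕ} {A : Fin N → Type*} [∀ i, Fintype (A i)] [∀ i, Nonempty (A i)]

/-! ### The logit map -/

lemma sum_exp_pos {B : Type*} [Fintype B] [Nonempty B] (y : B → ℝ) : 0 < ∑ β, Real.exp (y β) :=
  Finset.sum_pos (fun _ _ => Real.exp_pos _) Finset.univ_nonempty

lemma logit_nonneg (y : ∀ i, A i → ℝ) (i : Fin N) (α : A i) : 0 ≤ logit y i α :=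
  div_nonneg (Real.exp_pos _).le (sum_exp_pos _).le

lemma sum_logit (y : ∀ i, A i → ℝ) (i : Fin N) : ∑ α, logit y i α = 1 := by
  simp only [logit]
  rw [← Finset.sum_div, div_self (sum_exp_pos _).ne']

lemma isSubmixed_logit (y : ∀ i, A i → ℝ) : IsSubmixed (logit y) :=
  isSubmixed_of_sum_eq_one (logit_nonneg y) (sum_logit y)

/-- Moving scores by at most `ε` decreases the numerator and increases the denominator by factors of
at most `exp ε` each; then `1 - exp (-2 * ε) ≤ 2 * ε`, and logit values are at most `1`. -/
lemma logit_sub_le (y z : ∀ i, A i → ℝ) (i : Fin N) (α : A i) :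
    logit y i α - logit z i α ≤ 2 * ‖y - z‖ := by
  set ε := ‖y - z‖ with hε
  have hd : ∀ β, |y i β - z i β| ≤ ε := fun β => abs_apply_sub_le y z i β
  have h1 : Real.exp (y i α) * Real.exp (-ε) ≤ Real.exp (z i α) := by
    rw [← Real.exp_add]
    exact Real.exp_le_exp.2 (by linarith [(abs_le.1 (hd α)).2])
  have h2 : ∑ β, Real.exp (z i β) ≤ Real.exp ε * ∑ β, Real.exp (y i β) := by
    rw [Finset.mul_sum]
    refine Finset.sum_le_sum fun β _ => ?_
    rw [← Real.exp_add]
    exact Real.exp_le_exp.2 (by linarith [(abs_le.1 (hd β)).1])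
  have hy := sum_exp_pos (y i)
  have hz := sum_exp_pos (z i)
  have h3 : Real.exp (-(2 * ε)) * logit y i α ≤ logit z i α := by
    rw [logit, logit, mul_div_assoc', div_le_div_iff₀ hy hz]
    calc Real.exp (-(2 * ε)) * Real.exp (y i α) * ∑ β, Real.exp (z i β)
        ≤ Real.exp (-(2 * ε)) * Real.exp (y i α) * (Real.exp ε * ∑ β, Real.exp (y i β)) := by
          gcongr
      _ = Real.exp (y i α) * Real.exp (-ε) * ∑ β, Real.exp (y i β) := by
          rw [show -(2 * ε) = -ε + -ε by ring, Real.exp_add]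
          have : Real.exp (-ε) * Real.exp ε = 1 := by rw [← Real.exp_add]; simp
          linear_combination (Real.exp (-ε) * Real.exp (y i α) * ∑ β, Real.exp (y i β)) * this
      _ ≤ _ := by gcongr
  have h4 := Real.add_one_le_exp (-(2 * ε))
  have h5 := mul_le_mul_of_nonneg_right h4 (logit_nonneg y i α)
  have h6 := (isSubmixed_logit y i α).2
  have h7 : 0 ≤ ε := norm_nonneg _
  nlinarith

lemma norm_logit_sub_le (y z : ∀ i, A i → ℝ) : ‖logit y - logit z‖ ≤ 2 * ‖y - z‖ := by
  refine norm_profile_le (by positivity) fun i α => abs_le.2 ⟨?_, logit_sub_le y z i α⟩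
  have := logit_sub_le z y i α
  rw [norm_sub_rev] at this
  rw [Pi.sub_apply, Pi.sub_apply]
  linarith

lemma continuous_logit : Continuous (logit : (∀ i, A i → ℝ) → ∀ i, A i → ℝ) :=
  (LipschitzWith.of_dist_le' fun y z => by
    rw [dist_eq_norm, dist_eq_norm]; exact norm_logit_sub_le y z).continuous

lemma isTameField_logitField (u : Fin N → (∀ i, A i) → ℝ) :
    IsTameField (logitField u) (normSeminorm ℝ (∀ i, A i → ℝ)) (payoffBound u * N * 2)
      (payoffBound u) where
  nonneg := by have := payoffBound_nonneg u; positivity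
  le_norm _ := le_rfl
  lipschitz y z := by
    have h1 := norm_payoffVector_sub_le u (isSubmixed_logit y) (isSubmixed_logit z)
    have h2 := norm_logit_sub_le y z
    have h3 := payoffBound_nonneg u
    refine h1.trans ?_
    rw [mul_assoc _ 2]
    exact mul_le_mul_of_nonneg_left h2 (by positivity)
  bounded y := norm_payoffVector_le u (isSubmixed_logit y)

variable {Ω : Type*} {m : MeasurableSpace Ω} {μ : Measure Ω} {ℱ : Filtration ℕ m}
  {u : Fin N → (∀ i, A i) → ℝ} {c p : ℝ}

/-! ### Exponential weights -/

section EW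

variable {fb : Feedback} {a : ℕ → Ω → ∀ i, A i} {Y : ℕ → Ω → ∀ i, A i → ℝ}

lemma continuous_finiteOracle_logit (u : Fin N → (∀ i, A i) → ℝ) (fb : Feedback) (b : ∀ i, A i) :
    Continuous fun y => finiteOracle u fb (logit y) b := by
  cases fb with
  | full => exact (isTameField_logitField u).continuous
  | realized => exact continuous_const

lemma IsEW.measurable {γ : ℕ → ℝ} (h : IsEW μ ℱ u fb γ a Y) (n : ℕ) (hn : 1 ≤ n) :
    Measurable[ℱ n] (Y n) := by
  induction n, hn using Nat.le_induction with
  | base => exact h.init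
  | succ n hn ih =>
    have hY := ih.mono (ℱ.mono n.le_succ) le_rfl
    rw [show Y (n + 1) = _ from funext (h.step n hn)]
    exact hY.add ((stronglyMeasurable_draw (h.drawn.measurable n hn)
      (f := fun b ω => finiteOracle u fb (logit (Y n ω)) b) fun b =>
        ((continuous_finiteOracle_logit u fb b).measurable.comp
          hY).stronglyMeasurable).measurable.const_smul (γ n))

theorem IsEW.ae_isAPT [IsProbabilityMeasure μ] (hc : 0 < c) (hp0 : 0 < p) (hp1 : p ≤ 1)
    (h : IsEW μ ℱ u fb (schedule c p) a Y) :
    ∀ᵐ ω ∂μ, IsAPT (logitField u) (schedule c p) (fun n => Y n ω) := by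
  classical
  have hF := isTameField_logitField u
  have hγ := isStepSize_schedule hc hp0 hp1
  have hY := h.measurable
  -- Full information is a draw whose outcome does not affect the oracle, so both kinds of feedback
  -- are covered at once.
  have hU := ae_averagesToZero_of_draw (μ := μ) ℱ (r := 0) hc hp1 le_rfl (by linarith)
    (payoffBound_nonneg u) h.drawn.measurable (w := fun n b ω => ∏ i, logit (Y n ω) i (b i))
    h.drawn.law (fun n _ b ω => Finset.prod_nonneg fun i _ => logit_nonneg _ _ _)
    (fun n _ ω => sum_prod_eq_one (sum_logit _))
    (f := fun n b ω => finiteOracle u fb (logit (Y n ω)) b) (M := fun n ω => logitField u (Y n ω))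
    (fun n hn b => ((continuous_finiteOracle_logit u fb b).measurable.comp
      (hY n hn)).stronglyMeasurable)
    (fun n hn => (hF.continuous.measurable.comp (hY n hn)).stronglyMeasurable)
    (fun n _ ω => sum_finiteOracle u fb (sum_logit _))
    (fun n _ b ω => by simpa using norm_finiteOracle_le u fb (isSubmixed_logit (Y n ω)) b)
  filter_upwards [hU] with ω hω
  exact hF.isAPT_of_lead hγ hω (Y' := fun n => Y n ω) (by simp) fun n hn => by
    rw [h.step n hn ω, add_sub_cancel]

end EW

/-! ### EXP3 -/

section EXP3

variable {a : ℕ → Ω → ∀ i, A i} {Y : ℕ → Ω → ∀ i, A i → ℝ} {δ r : ℝ}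

lemma card_pos' (i : Fin N) : (0 : ℝ) < Fintype.card (A i) := by
  exact_mod_cast Fintype.card_pos

lemma sum_explore (ε : ℝ) {x : ∀ i, A i → ℝ} (hx : ∀ i, ∑ α, x i α = 1) (i : Fin N) :
    ∑ α, explore ε x i α = 1 := by
  have := (card_pos' (A := A) i).ne'
  simp only [explore]
  rw [Finset.sum_add_distrib, ← Finset.mul_sum, hx i, Finset.sum_const, Finset.card_univ,
    nsmul_eq_mul]
  field_simp
  ring

lemma norm_explore_sub_le {ε : ℝ} (h0 : 0 ≤ ε) {x : ∀ i, A i → ℝ} (hx : IsSubmixed x) :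
    ‖explore ε x - x‖ ≤ ε := by
  refine norm_profile_le h0 fun i α => ?_
  have h1 : (explore ε x - x) i α = ε * (1 / (Fintype.card (A i) : ℝ) - x i α) := by
    rw [Pi.sub_apply, Pi.sub_apply, explore]; ring
  have h2 : 1 / (Fintype.card (A i) : ℝ) ≤ 1 := by
    rw [div_le_one (card_pos' i)]
    exact_mod_cast Fintype.card_pos (α := A i)
  have h3 : 0 < 1 / (Fintype.card (A i) : ℝ) := one_div_pos.2 (card_pos' i)
  have h4 := hx i α
  rw [h1, abs_mul, abs_of_nonneg h0]
  refine mul_le_of_le_one_right h0 (abs_le.2 ⟨?_, ?_⟩) <;> linarith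

lemma measurable_iwe_explore (u : Fin N → (∀ i, A i) → ℝ) (ε : ℝ) (b : ∀ i, A i) :
    Measurable fun y => iwe u (explore ε (logit y)) b := by
  refine measurable_of_apply fun i => measurable_of_apply fun α => ?_
  have h1 : Measurable fun y : ∀ i, A i → ℝ => logit y i α :=
    measurable_apply (measurable_apply continuous_logit.measurable i) α
  simp only [iwe, explore]
  exact (((h1.const_mul _).add_const _).const_div _).mul_const _

lemma IsEXP3.measurable {γ δ : ℕ → ℝ} (h : IsEXP3 μ ℱ u γ δ a Y) (n : ℕ) (hn : 1 ≤ n) :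
    Measurable[ℱ n] (Y n) := by
  induction n, hn using Nat.le_induction with
  | base => exact h.init
  | succ n hn ih =>
    have hY := ih.mono (ℱ.mono n.le_succ) le_rfl
    rw [show Y (n + 1) = _ from funext (h.step n hn)]
    exact hY.add ((stronglyMeasurable_draw (h.drawn.measurable n hn)
      (f := fun b ω => iwe u (explore (δ n) (logit (Y n ω))) b) fun b =>
        ((measurable_iwe_explore u (δ n) b).comp hY).stronglyMeasurable).measurable.const_smul
          (γ n))

lemma schedule_le_one (h1 : δ ≤ 1) (hr : 0 ≤ r) {n : ℕ} (hn : 1 ≤ n) :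
    schedule δ r n ≤ 1 := by
  have : (1 : ℝ) ≤ (n : ℝ) ^ r := Real.one_le_rpow (by exact_mod_cast hn) hr
  rw [schedule, div_le_one (by linarith)]
  linarith

theorem IsEXP3.ae_isAPT [IsProbabilityMeasure μ] (hc : 0 < c) (hp1 : p ≤ 1) (hδ : 0 < δ)
    (hδ1 : δ ≤ 1) (hr : 0 < r) (h : IsEXP3 μ ℱ u (schedule c p) (schedule δ r) a Y)
    (hrp : 2 * r < p) : ∀ᵐ ω ∂μ, IsAPT (logitField u) (schedule c p) (fun n => Y n ω) := by
  classical
  have hF := isTameField_logitField u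
  have hγ := isStepSize_schedule hc (by linarith) hp1
  have hY := h.measurable
  -- A common bound on the numbers of strategies, positive even without players; exploration then
  -- gives every strategy probability at least `δ n / C`, so the estimator is of order `n ^ r`.
  set C : ℝ := 1 + ∑ i, (Fintype.card (A i) : ℝ) with hC
  have hC0 : 0 < C := by positivity
  have hcard : ∀ i, (Fintype.card (A i) : ℝ) ≤ C := fun i => by
    have := Finset.single_le_sum (f := fun i => (Fintype.card (A i) : ℝ))
      (fun i _ => (card_pos' i).le) (Finset.mem_univ i)
    linarith
  have hlow : ∀ n, 1 ≤ n → ∀ ω i α,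
      schedule δ r n / C ≤ explore (schedule δ r n) (logit (Y n ω)) i α := by
    intro n hn ω i α
    refine le_trans ?_ (le_explore (schedule_le_one hδ1 hr.le hn) (isSubmixed_logit _) i α)
    exact div_le_div_of_nonneg_left (schedule_pos hδ hn).le (card_pos' i) (hcard i)
  have hpos : ∀ n, 1 ≤ n → ∀ ω i α, 0 < explore (schedule δ r n) (logit (Y n ω)) i α :=
    fun n hn ω i α => (div_pos (schedule_pos hδ hn) hC0).trans_le (hlow n hn ω i α)
  have hsum : ∀ n ω i, ∑ α, explore (schedule δ r n) (logit (Y n ω)) i α = 1 := fun n ω =>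
    sum_explore _ (sum_logit _)
  have hsub : ∀ n, 1 ≤ n → ∀ ω, IsSubmixed (explore (schedule δ r n) (logit (Y n ω))) :=
    fun n hn ω => isSubmixed_of_sum_eq_one (fun i α => (hpos n hn ω i α).le) (hsum n ω)
  have hiwe : ∀ n, 1 ≤ n → ∀ b, StronglyMeasurable[ℱ n]
      fun ω => iwe u (explore (schedule δ r n) (logit (Y n ω))) b := fun n hn b =>
    ((measurable_iwe_explore u _ b).comp (hY n hn)).stronglyMeasurable
  have hexp : ∀ n i α, Measurable fun y : ∀ i, A i → ℝ => explore (schedule δ r n) (logit y) i α :=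
    fun n i α => by
      have h1 : Measurable fun y : ∀ i, A i → ℝ => logit y i α :=
        measurable_apply (measurable_apply continuous_logit.measurable i) α
      simp only [explore]
      exact (h1.const_mul _).add_const _
  have hM : ∀ n, 1 ≤ n → StronglyMeasurable[ℱ n]
      fun ω => payoffVector u (explore (schedule δ r n) (logit (Y n ω))) := by
    intro n hn
    -- Measurability of the mean is read off its expression as a finite sum of measurable
    -- estimators.
    rw [show (fun ω => payoffVector u (explore (schedule δ r n) (logit (Y n ω)))) = fun ω =>
      ∑ b : ∀ j, A j, (∏ j, explore (schedule δ r n) (logit (Y n ω)) j (b j)) •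
        iwe u (explore (schedule δ r n) (logit (Y n ω))) b from
      funext fun ω => (sum_iwe u (hpos n hn ω)).symm]
    refine Finset.stronglyMeasurable_fun_sum _ fun b _ => ?_
    have hprod : StronglyMeasurable[ℱ n]
        fun ω => ∏ j, explore (schedule δ r n) (logit (Y n ω)) j (b j) :=
      Finset.stronglyMeasurable_fun_prod _ fun j _ =>
        ((hexp n j (b j)).comp (hY n hn)).stronglyMeasurable
    exact hprod.smul (hiwe n hn b)
  have hU := ae_averagesToZero_of_draw (μ := μ) ℱ (K := payoffBound u * C / δ) hc hp1 hr.le hrp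
    (by have := payoffBound_nonneg u; positivity) h.drawn.measurable
    (w := fun n b ω => ∏ i, explore (schedule δ r n) (logit (Y n ω)) i (b i))
    h.drawn.law (fun n hn b ω => Finset.prod_nonneg fun i _ => (hpos n hn ω i _).le)
    (fun n _ ω => sum_prod_eq_one (hsum n ω))
    (f := fun n b ω => iwe u (explore (schedule δ r n) (logit (Y n ω))) b)
    (M := fun n ω => payoffVector u (explore (schedule δ r n) (logit (Y n ω))))
    hiwe hM (fun n hn ω => sum_iwe u (hpos n hn ω))
    (fun n hn b ω => by
      refine (norm_iwe_le u (div_pos (schedule_pos hδ hn) hC0) (hlow n hn ω) b).trans_eq ?_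
      have hn' : (0 : ℝ) < n := by exact_mod_cast hn
      rw [schedule]
      field_simp)
  filter_upwards [hU] with ω hω
  -- The estimator is unbiased at the exploring strategies, which lie within `δ n` of the logit
  -- strategies.
  have hb : Tendsto (fun n => payoffVector u (explore (schedule δ r n) (logit (Y n ω))) -
      logitField u (Y n ω)) atTop (𝓝 0) := by
    have hlim : Tendsto (fun n => payoffBound u * N * schedule δ r n) atTop (𝓝 0) := by
      simpa using (tendsto_schedule δ hr).const_mul (payoffBound u * N)
    refine squeeze_zero_norm' ?_ hlim
    filter_upwards [eventually_ge_atTop 1] with n hn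
    refine (norm_payoffVector_sub_le u (hsub n hn ω) (isSubmixed_logit _)).trans ?_
    refine mul_le_mul_of_nonneg_left ?_ (mul_nonneg (payoffBound_nonneg u) (Nat.cast_nonneg N))
    exact norm_explore_sub_le (schedule_pos hδ hn).le (isSubmixed_logit _)
  refine hF.isAPT hγ hω hb ?_
  filter_upwards [eventually_ge_atTop 1] with n hn
  rw [h.step n hn ω]
  congr 2
  abel

end EXP3

end FiniteGames

/-! ### Simultaneous perturbation stochastic approximation -/

/-- A second-order Taylor bound for functions with Lipschitz derivative. -/
lemma abs_taylor_le {E : Type*} [NormedAddCommGroup E] [NormedSpace ℝ E] {f : E → ℝ} {L : NNReal}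
    (hf : Differentiable ℝ f) (hL : LipschitzWith L (fderiv ℝ f)) (x v : E) :
    |f (x + v) - f x - fderiv ℝ f x v| ≤ L * ‖v‖ * ‖v‖ := by
  have h := (convex_closedBall x ‖v‖).norm_image_sub_le_of_norm_fderiv_le' (𝕜 := ℝ)
    (f := f) (φ := fderiv ℝ f x) (C := L * ‖v‖) (x := x) (y := x + v)
    (fun z _ => hf z) (fun z hz => ?_) (Metric.mem_closedBall_self (norm_nonneg v))
    (by simp)
  · simpa using h
  · refine (hL.norm_sub_le z x).trans (mul_le_mul_of_nonneg_left ?_ L.2)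
    exact mem_closedBall_iff_norm.1 hz

/-- The signed basis vector with index `β`. -/
noncomputable def signedVector {k : ℕ} (β : SignedIndex k) : EuclideanSpace ℝ (Fin k) :=
  EuclideanSpace.single β.1 ((β.2 : ℤ) : ℝ)

lemma norm_signedVector {k : ℕ} (β : SignedIndex k) : ‖signedVector β‖ = 1 := by
  rcases Int.units_eq_one_or β.2 with h | h <;> simp [signedVector, h]

lemma sum_signedIndex {k : ℕ} (hk : 0 < k) : ∑ _β : SignedIndex k, 1 / (2 * (k : ℝ)) = 1 := by
  have : (k : ℝ) ≠ 0 := by exact_mod_cast hk.ne'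
  rw [Finset.sum_const, Finset.card_univ, Fintype.card_prod, Fintype.card_fin, Fintype.card_units_int,
    nsmul_eq_mul]
  push_cast
  field_simp

/-- Opposite signs cancel `a` and double the linear term, and only the index `l` contributes to
coordinate `l`. The constant `a` later holds the base payoff and the perturbations by other players.
-/
lemma sum_signedVector {k : ℕ} (φ : StrongDual ℝ (EuclideanSpace ℝ (Fin k))) (a ε : ℝ)
    (l : Fin k) : ∑ β : SignedIndex k, 1 / (2 * (k : ℝ)) *
      ((a + ε * φ (signedVector β)) * signedVector β l) =
    ε / k * φ (EuclideanSpace.single l 1) := by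
  have hk : (k : ℝ) ≠ 0 := by
    have := l.pos
    exact_mod_cast this.ne'
  have hneg : ∀ i : Fin k, EuclideanSpace.single i (-1 : ℝ) = -EuclideanSpace.single i (1 : ℝ) :=
    fun i => by ext j; simp; split_ifs <;> simp
  rw [Fintype.sum_prod_type, Finset.sum_eq_single l]
  · simp only [UnitsInt.univ, signedVector]
    rw [Finset.sum_pair (by decide)]
    simp only [Units.val_one, Units.val_neg, Int.cast_one, Int.cast_neg, hneg, map_neg]
    simp
    field_simp
    ring
  · intro i _ hi
    refine Finset.sum_eq_zero fun s _ => ?_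
    simp [signedVector, hi.symm]
  · simp

section SPSA

variable {N : ℕ} {d : Fin N → ℕ} {u : Fin N → Profile d → ℝ}

lemma signedBasis_apply (j : ∀ i, SignedIndex (d i)) (i : Fin N) :
    signedBasis j i = signedVector (j i) := rfl

lemma norm_signedBasis_le (j : ∀ i, SignedIndex (d i)) : ‖signedBasis j‖ ≤ 1 :=
  (pi_norm_le_iff_of_nonneg zero_le_one).2 fun i => (norm_signedVector (j i)).le

lemma signedBasis_update (j : ∀ i, SignedIndex (d i)) (i : Fin N) (β : SignedIndex (d i)) :
    signedBasis (Function.update j i β) =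
      Function.update (signedBasis j) i 0 + Pi.single i (signedVector β) := by
  ext1 k
  rcases eq_or_ne k i with rfl | hk
  · simp [signedBasis_apply]
  · simp [signedBasis_apply, hk]

lemma sum_signed_prod (hd : ∀ i, 0 < d i) :
    ∑ _j : ∀ i, SignedIndex (d i), ∏ i, (1 / (2 * (d i : ℝ))) = 1 :=
  sum_prod_eq_one (A := fun i => SignedIndex (d i)) (z := fun i _ => 1 / (2 * (d i : ℝ)))
    fun i => sum_signedIndex (hd i)

/-- The linearization of the one-point estimator is unbiased. -/
lemma sum_linear_estimate (hu : IsSmoothGame u) (hd : ∀ i, 0 < d i) (x : Profile d) (ε : ℝ)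
    (i : Fin N) (l : Fin (d i)) :
    ∑ j : ∀ i, SignedIndex (d i), (∏ i, (1 / (2 * (d i : ℝ)))) *
      ((u i x + ε * fderiv ℝ (u i) x (signedBasis j)) * signedBasis j i l) =
    ε / d i * payoffGradient u x i l := by
  classical
  set z : ∀ i, SignedIndex (d i) → ℝ := fun i _ => 1 / (2 * (d i : ℝ)) with hz
  -- Resampling the direction of player `i` from its own law changes nothing in the mean and
  -- isolates an inner sum in which the other players are frozen.
  have h := sum_prod_resample z i (z i)
    (fun j => (u i x + ε * fderiv ℝ (u i) x (signedBasis j)) * signedBasis j i l)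
  rw [sum_signedIndex (hd i), one_mul, Function.update_eq_self] at h
  refine h.symm.trans ?_
  have hgrad : payoffGradient u x i l =
      (fderiv ℝ (u i) x).comp (ContinuousLinearMap.single ℝ _ i) (EuclideanSpace.single l 1) := by
    rw [payoffGradient_apply hu, ← InnerProductSpace.toDual_symm_apply,
      EuclideanSpace.inner_single_right]
    simp
  have hinner : ∀ b : ∀ i, SignedIndex (d i), ∑ β, z i β *
      ((u i x + ε * fderiv ℝ (u i) x (signedBasis (Function.update b i β))) *
        signedBasis (Function.update b i β) i l) = ε / d i * payoffGradient u x i l := by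
    intro b
    rw [hgrad, ← sum_signedVector _
      (u i x + ε * fderiv ℝ (u i) x (Function.update (signedBasis b) i 0)) ε l]
    refine Finset.sum_congr rfl fun β _ => ?_
    rw [signedBasis_update, map_add]
    simp only [hz, Pi.add_apply, Function.update_self, Pi.single_eq_same, zero_add,
      ContinuousLinearMap.comp_apply, ContinuousLinearMap.single_apply]
    ring
  simp_rw [hinner]
  rw [← Finset.sum_mul, sum_signed_prod hd, one_mul]

/-- The one-point gradient estimator along the directions `j`. -/
noncomputable def spsaEstimate (u : Fin N → Profile d → ℝ) (ε : ℝ) (x : Profile d)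
    (j : ∀ i, SignedIndex (d i)) : Profile d :=
  fun i => (d i / ε * u i (x + ε • signedBasis j)) • signedBasis j i

/-- The mean of the one-point gradient estimator. -/
noncomputable def spsaMean (u : Fin N → Profile d → ℝ) (ε : ℝ) (x : Profile d) : Profile d :=
  ∑ j, (∏ i, (1 / (2 * (d i : ℝ)))) • spsaEstimate u ε x j

lemma norm_spsaEstimate_le {B : ℝ} (hB : ∀ i x, |u i x| ≤ B) (hB0 : 0 ≤ B) {ε : ℝ} (hε : 0 < ε)
    (x : Profile d) (j : ∀ i, SignedIndex (d i)) :
    ‖spsaEstimate u ε x j‖ ≤ (∑ i, (d i : ℝ)) * B / ε := by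
  refine (pi_norm_le_iff_of_nonneg (by positivity)).2 fun i => ?_
  have hd : (d i : ℝ) ≤ ∑ i, (d i : ℝ) :=
    Finset.single_le_sum (f := fun i => (d i : ℝ)) (fun i _ => Nat.cast_nonneg _)
      (Finset.mem_univ i)
  rw [spsaEstimate, norm_smul, signedBasis_apply, norm_signedVector, mul_one, Real.norm_eq_abs,
    abs_mul, abs_of_nonneg (by positivity)]
  calc (d i : ℝ) / ε * |u i (x + ε • signedBasis j)| ≤ (∑ i, (d i : ℝ)) / ε * B := by
        gcongr
        exact hB i _
    _ = _ := by ring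

/-- The gradient is the exact mean of the linearized estimator; only the Taylor remainder is left,
of order `ε ^ 2` before division by `ε`. -/
lemma exists_norm_spsaMean_sub_le (hu : IsSmoothGame u) (hd : ∀ i, 0 < d i) :
    ∃ C : ℝ, ∀ ε x, 0 < ε → ‖spsaMean u ε x - payoffGradient u x‖ ≤ C * ε := by
  choose L hL using hu.smooth
  refine ⟨∑ i, d i * (L i : ℝ), fun ε x hε => ?_⟩
  have hterm : ∀ i, (0 : ℝ) ≤ d i * L i := fun i => mul_nonneg (Nat.cast_nonneg _) (L i).2
  refine (pi_norm_le_iff_of_nonneg (mul_nonneg (Finset.sum_nonneg fun i _ => hterm i) hε.le)).2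
    fun i => ?_
  have hdi : (d i : ℝ) ≠ 0 := by exact_mod_cast (hd i).ne'
  have hgrad : payoffGradient u x i = ∑ j : ∀ i, SignedIndex (d i),
      (∏ i, (1 / (2 * (d i : ℝ)))) • ((d i / ε * (u i x + ε * fderiv ℝ (u i) x (signedBasis j))) •
        signedBasis j i) := by
    ext l
    have h := sum_linear_estimate hu hd x ε i l
    have h' : payoffGradient u x i l = d i / ε * (ε / d i * payoffGradient u x i l) := by
      field_simp
    rw [h', ← h, Finset.mul_sum, WithLp.ofLp_sum, Finset.sum_apply]
    refine Finset.sum_congr rfl fun j _ => ?_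
    simp only [PiLp.smul_apply, smul_eq_mul]
    ring
  have hdiff : (spsaMean u ε x - payoffGradient u x) i = ∑ j : ∀ i, SignedIndex (d i),
      (∏ i, (1 / (2 * (d i : ℝ)))) • ((d i / ε * (u i (x + ε • signedBasis j) - u i x -
        fderiv ℝ (u i) x (ε • signedBasis j))) • signedBasis j i) := by
    rw [Pi.sub_apply, hgrad, spsaMean, Finset.sum_apply, ← Finset.sum_sub_distrib]
    refine Finset.sum_congr rfl fun j _ => ?_
    rw [Pi.smul_apply, spsaEstimate, ← smul_sub, ← sub_smul, map_smul, smul_eq_mul]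
    congr 2
    ring
  rw [hdiff]
  have hle : ∀ j : ∀ i, SignedIndex (d i), ‖(∏ i, (1 / (2 * (d i : ℝ)))) •
      ((d i / ε * (u i (x + ε • signedBasis j) - u i x -
        fderiv ℝ (u i) x (ε • signedBasis j))) • signedBasis j i)‖ ≤
      (∏ i, (1 / (2 * (d i : ℝ)))) * (d i * L i * ε) := by
    intro j
    have hw : (0 : ℝ) ≤ ∏ i, (1 / (2 * (d i : ℝ))) := Finset.prod_nonneg fun i _ => by positivity
    rw [norm_smul, Real.norm_of_nonneg hw, norm_smul, signedBasis_apply, norm_signedVector,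
      mul_one, norm_mul, Real.norm_of_nonneg (show 0 ≤ (d i : ℝ) / ε by positivity)]
    refine mul_le_mul_of_nonneg_left ?_ hw
    have h1 := abs_taylor_le (hu.differentiable i) (hL i) x (ε • signedBasis j)
    have h2 : ‖ε • signedBasis j‖ ≤ ε := by
      rw [norm_smul, Real.norm_of_nonneg hε.le]
      exact mul_le_of_le_one_right hε.le (norm_signedBasis_le j)
    calc _ ≤ (d i : ℝ) / ε * (L i * ε * ε) := by
          refine mul_le_mul_of_nonneg_left (h1.trans ?_) (by positivity)
          gcongr
      _ = d i * L i * ε := by field_simp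
  refine (norm_sum_le_of_le _ fun j _ => hle j).trans ?_
  rw [← Finset.sum_mul, sum_signed_prod hd, one_mul]
  refine mul_le_mul_of_nonneg_right ?_ hε.le
  exact Finset.single_le_sum (f := fun i => (d i : ℝ) * (L i : ℝ)) (fun i _ => hterm i)
    (Finset.mem_univ i)

variable {Ω : Type*} {m : MeasurableSpace Ω} {μ : Measure Ω} {ℱ : Filtration ℕ m} {c p δ r : ℝ}
  {dir : ℕ → Ω → ∀ i, SignedIndex (d i)} {X : ℕ → Ω → Profile d}

lemma continuous_spsaEstimate (hu : IsSmoothGame u) (ε : ℝ) (j : ∀ i, SignedIndex (d i)) :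
    Continuous fun x => spsaEstimate u ε x j := by
  refine continuous_pi fun i => ?_
  have := (hu.differentiable i).continuous
  unfold spsaEstimate
  fun_prop

lemma IsSPSA.step_eq {γ δ : ℕ → ℝ} (h : IsSPSA μ ℱ u γ δ dir X) {n : ℕ} (hn : 1 ≤ n) (ω : Ω) :
    X (n + 1) ω = X n ω + γ n • spsaEstimate u (δ n) (X n ω) (dir n ω) := by
  ext1 i
  exact h.step n hn ω i

lemma IsSPSA.measurable {γ δ : ℕ → ℝ} (h : IsSPSA μ ℱ u γ δ dir X) (hu : IsSmoothGame u) (n : ℕ)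
    (hn : 1 ≤ n) : Measurable[ℱ n] (X n) := by
  induction n, hn using Nat.le_induction with
  | base => exact h.init
  | succ n hn ih =>
    have hX := ih.mono (ℱ.mono n.le_succ) le_rfl
    rw [show X (n + 1) = _ from funext (h.step_eq hn)]
    exact hX.add ((stronglyMeasurable_draw (h.dir_measurable n hn)
      (f := fun j ω => spsaEstimate u (δ n) (X n ω) j) fun j =>
        ((continuous_spsaEstimate hu (δ n) j).measurable.comp
          hX).stronglyMeasurable).measurable.const_smul (γ n))

theorem IsSPSA.ae_isAPT [IsProbabilityMeasure μ] (hc : 0 < c) (hp1 : p ≤ 1)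
    (hu : IsSmoothGame u) (hbdd : ∀ i, ∃ B : ℝ, ∀ x, |u i x| ≤ B) (hδ : 0 < δ) (hr : 0 < r)
    (h : IsSPSA μ ℱ u (schedule c p) (schedule δ r) dir X) (hrp : 2 * r < p) :
    ∀ᵐ ω ∂μ, IsAPT (payoffGradient u) (schedule c p) (fun n => X n ω) := by
  -- In dimension zero there is no signed basis vector, so no direction can exist at any sample
  -- point.
  by_cases hd : ∀ i, 0 < d i
  swap
  · push Not at hd
    obtain ⟨i, hi⟩ := hd
    exact ae_of_all _ fun ω => absurd (dir 0 ω i).1.pos (by omega)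
  obtain ⟨L, G, hF⟩ := hu.exists_isTameField
  have hγ := isStepSize_schedule hc (by linarith) hp1
  have hX := h.measurable hu
  choose B' hB' using hbdd
  set B : ℝ := ∑ i, |B' i| with hBdef
  have hB0 : 0 ≤ B := Finset.sum_nonneg fun _ _ => abs_nonneg _
  have hB : ∀ i x, |u i x| ≤ B := fun i x => ((hB' i x).trans (le_abs_self _)).trans
    (Finset.single_le_sum (f := fun i => |B' i|) (fun _ _ => abs_nonneg _) (Finset.mem_univ i))
  have hest : ∀ n, 1 ≤ n → ∀ j, StronglyMeasurable[ℱ n]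
      fun ω => spsaEstimate u (schedule δ r n) (X n ω) j := fun n hn j =>
    ((continuous_spsaEstimate hu _ j).measurable.comp (hX n hn)).stronglyMeasurable
  have hU := ae_averagesToZero_of_draw (μ := μ) ℱ (K := (∑ i, (d i : ℝ)) * B / δ) hc hp1 hr.le
    hrp (by positivity) h.dir_measurable (w := fun _ _ _ => ∏ i, (1 / (2 * (d i : ℝ))))
    h.dir_law (fun n _ j ω => Finset.prod_nonneg fun i _ => by positivity)
    (fun n _ ω => sum_signed_prod hd)
    (f := fun n j ω => spsaEstimate u (schedule δ r n) (X n ω) j)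
    (M := fun n ω => spsaMean u (schedule δ r n) (X n ω)) hest
    (fun n hn => Finset.stronglyMeasurable_fun_sum _ fun j _ =>
      (hest n hn j).const_smul (∏ i, (1 / (2 * (d i : ℝ)))))
    (fun n hn ω => rfl)
    (fun n hn j ω => by
      refine (norm_spsaEstimate_le hB hB0 (schedule_pos hδ hn) _ j).trans_eq ?_
      have hn' : (0 : ℝ) < n := by exact_mod_cast hn
      rw [schedule]
      field_simp)
  obtain ⟨C, hC⟩ := exists_norm_spsaMean_sub_le hu hd
  filter_upwards [hU] with ω hω
  have hb : Tendsto (fun n => spsaMean u (schedule δ r n) (X n ω) - payoffGradient u (X n ω))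
      atTop (𝓝 0) := by
    have hlim : Tendsto (fun n => C * schedule δ r n) atTop (𝓝 0) := by
      simpa using (tendsto_schedule δ hr).const_mul C
    refine squeeze_zero_norm' ?_ hlim
    filter_upwards [eventually_ge_atTop 1] with n hn using hC _ _ (schedule_pos hδ hn)
  refine hF.isAPT hγ hω hb ?_
  filter_upwards [eventually_ge_atTop 1] with n hn
  rw [h.step_eq hn ω]
  congr 2
  abel

end SPSA

end LearningInGames

theorem mainTheorem10
    {Ω : Type*} [m : MeasurableSpace Ω] (μ : Measure Ω) [IsProbabilityMeasure μ]
    (ℱ : Filtration ℕ m) {S : Type*} [MeasurableSpace S]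
    (N : ℕ) (d : Fin N → ℕ)
    (V : Fin N → Type*) [∀ i, NormedAddCommGroup (V i)] [∀ i, NormedSpace ℝ (V i)]
    [∀ i, FiniteDimensional ℝ (V i)] [∀ i, MeasurableSpace (V i)] [∀ i, BorelSpace (V i)]
    (A : Fin N → Type*) [∀ i, Fintype (A i)] [∀ i, Nonempty (A i)]
    (c p : ℝ) (hc : 0 < c) (hp0 : 0 ≤ p) (hp1 : p ≤ 1) :
    -- stochastic gradient ascent
    (∀ (u : Fin N → Profile d → ℝ) (err : Profile d → S → Profile d) (q : ℝ≥0∞) (σ : ℝ)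
        (seed : ℕ → Ω → S) (X : ℕ → Ω → Profile d),
      IsSmoothGame u → Measurable (Function.uncurry err) → 2 ≤ q → 0 ≤ σ →
      IsSGA μ ℱ u err q σ (schedule c p) seed X →
      2 / (2 + q) < ENNReal.ofReal p →
      ∀ᵐ ω ∂μ, IsAPT (payoffGradient u) (schedule c p) (fun n => X n ω)) ∧
    -- sequential gradient ascent
    (∀ (u : Fin N → Profile d → ℝ) (err : Profile d → S → Profile d) (q : ℝ≥0∞) (σ : ℝ)
        (seed : ℕ → Ω → S) (X : ℕ → Ω → Profile d),
      IsSmoothGame u → Measurable (Function.uncurry err) → 2 ≤ q → 0 ≤ σ →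
      IsSeqGA μ ℱ u err q σ (schedule c p) seed X →
      2 / (2 + q) < ENNReal.ofReal p →
      ∀ᵐ ω ∂μ, IsAPT (payoffGradient u) (schedule c p) (fun n => X n ω)) ∧
    -- extra-gradient
    (∀ (u : Fin N → Profile d → ℝ) (err : Profile d → S → Profile d) (q : ℝ≥0∞) (σ : ℝ)
        (seed leadSeed : ℕ → Ω → S) (X lead : ℕ → Ω → Profile d),
      IsSmoothGame u → Measurable (Function.uncurry err) → 2 ≤ q → 0 ≤ σ →
      IsEG μ ℱ u err q σ (schedule c p) seed leadSeed X lead →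
      2 / (2 + q) < ENNReal.ofReal p →
      ∀ᵐ ω ∂μ, IsAPT (payoffGradient u) (schedule c p) (fun n => X n ω)) ∧
    -- optimistic gradient
    (∀ (u : Fin N → Profile d → ℝ) (err : Profile d → S → Profile d) (q : ℝ≥0∞) (σ : ℝ)
        (seed : ℕ → Ω → S) (X lead : ℕ → Ω → Profile d),
      IsSmoothGame u → Measurable (Function.uncurry err) → 2 ≤ q → 0 ≤ σ →
      IsOG μ ℱ u err q σ (schedule c p) seed X lead →
      2 / (2 + q) < ENNReal.ofReal p →
      ∀ᵐ ω ∂μ, IsAPT (payoffGradient u) (schedule c p) (fun n => X n ω)) ∧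
    -- mirror-prox
    (∀ (X : ∀ i, Set (V i)) (u : Fin N → (∀ i, V i) → ℝ)
        (du : Fin N → (∀ i, V i) → StrongDual ℝ (∀ i, V i)) (h : ∀ i, V i → ℝ)
        (err : (∀ i, V i) → S → ∀ i, StrongDual ℝ (V i)) (q : ℝ≥0∞) (σ : ℝ)
        (seed leadSeed : ℕ → Ω → S) (Y leadY : ℕ → Ω → ∀ i, StrongDual ℝ (V i)),
      IsContinuousGame X u du → (∀ i, IsRegularizer (X i) (h i)) →
      Measurable (Function.uncurry err) → 2 ≤ q → 0 ≤ σ →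
      IsMP μ ℱ X h du err q σ (schedule c p) seed leadSeed Y leadY →
      2 / (2 + q) < ENNReal.ofReal p →
      ∀ᵐ ω ∂μ, IsAPT (fun y => dualGradient du (mirrorProfile X h y)) (schedule c p)
        (fun n => Y n ω)) ∧
    -- exponential weights, with either kind of feedback
    (∀ (u : Fin N → (∀ i, A i) → ℝ) (fb : Feedback)
        (a : ℕ → Ω → ∀ i, A i) (Y : ℕ → Ω → ∀ i, A i → ℝ),
      IsEW μ ℱ u fb (schedule c p) a Y →
      0 < p →
      ∀ᵐ ω ∂μ, IsAPT (logitField u) (schedule c p) (fun n => Y n ω)) ∧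
    -- simultaneous perturbation stochastic approximation
    (∀ (u : Fin N → Profile d → ℝ) (δ r : ℝ)
        (dir : ℕ → Ω → ∀ i, SignedIndex (d i)) (X : ℕ → Ω → Profile d),
      IsSmoothGame u → (∀ i, ∃ B : ℝ, ∀ x, |u i x| ≤ B) →
      0 < δ → 0 < r → r < 1 / 2 →
      IsSPSA μ ℱ u (schedule c p) (schedule δ r) dir X →
      2 * r < p →
      ∀ᵐ ω ∂μ, IsAPT (payoffGradient u) (schedule c p) (fun n => X n ω)) ∧
    -- EXP3
    (∀ (u : Fin N → (∀ i, A i) → ℝ) (δ r : ℝ)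
        (a : ℕ → Ω → ∀ i, A i) (Y : ℕ → Ω → ∀ i, A i → ℝ),
      0 < δ → δ ≤ 1 → 0 < r → r < 1 / 2 →
      IsEXP3 μ ℱ u (schedule c p) (schedule δ r) a Y →
      2 * r < p →
      ∀ᵐ ω ∂μ, IsAPT (logitField u) (schedule c p) (fun n => Y n ω)) := by
  refine ⟨fun u err q σ seed X hu herr hq hσ h hp => h.ae_isAPT hc hp1 hu herr hq hσ hp,
    fun u err q σ seed X hu herr hq hσ h hp => h.ae_isAPT hc hp1 hu herr hq hσ hp,
    fun u err q σ seed leadSeed X lead hu herr hq hσ h hp => h.ae_isAPT hc hp1 hu herr hq hσ hp,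
    fun u err q σ seed X lead hu herr hq hσ h hp => h.ae_isAPT hc hp1 hu herr hq hσ hp,
    fun X u du h err q σ seed leadSeed Y leadY hu hh herr hq hσ hmp hp =>
      hmp.ae_isAPT hc hp1 hu hh herr hq hσ hp,
    fun u fb a Y h hp => h.ae_isAPT hc hp hp1,
    fun u δ r dir X hu hbdd hδ hr _ h hrp => h.ae_isAPT hc hp1 hu hbdd hδ hr hrp,
    fun u δ r a Y hδ hδ1 hr _ h hrp => h.ae_isAPT hc hp1 hδ hδ1 hr hrp⟩
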